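/- Let $M$ be a compact smooth manifold (without boundary) of dimension $2n$, let $x\in C^\infty(M)$ have $0$ as a regular value, put $Z=x^{-1}(0)$, and let $k\ge 0$, $m=2k+1$. The $b^m$-tangent bundle of $(M,Z,x)$ has fibre $T_pM$ at $p\notin Z$ and $T_pZ\oplus\langle x^m\partial_x\rangle$ at $p\in Z$; a smooth $b^m$-two-form is a smooth section of $\Lambda^2$ of its dual, i.e. locally of the form $\frac{dx}{x^m}\wedge\alpha+\beta$ with $\alpha,\beta$ smooth differential forms. Let $\omega$ be a $b^{2k+1}$-symplectic form on $(M,Z,x)$: a smooth closed $b^{2k+1}$-two-form of maximal rank at every point of $M$. A folded symplectic form on $M$ is a smooth closed two-form $\eta$ such that $\eta^n$ is transverse to the zero section of $\Lambda^{2n}T^*M$ and, for the inclusion $i:S\to M$ of its (possibly empty) zero set $S$, $(i^*\eta)^{n-1}$ vanishes nowhere on $S$. Then $M$ carries a folded symplectic form. It is obtained from $\omega$ by desingularization, as follows. (1) $\omega$ has a Laurent decomposition: for some $\delta>0$ the set $U=\{|x|<\delta\}$ is a tubular neighbourhood of $Z$ with a smooth projection $\pi:U\to Z$ restricting to the identity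 on $Z$ and such that $(\pi,x):U\to Z\times(-\delta,\delta)$ is a diffeomorphism, and on $U$ $$\omega=\frac{dx}{x^{2k+1}}\wedge\Big(\sum_{i=0}^{2k}x^i\,\pi^*\hat\alpha_i\Big)+\beta$$ with closed smooth one-forms $\hat\alpha_i$ on $Z$ and a smooth two-form $\beta$ on $U$. (2) There are smooth even functions $f:\mathbb R\to\mathbb R$ with $f'(t)>0$ for $t>0$, $f(t)=t^2-2$ for $|t|\le 1$, and, for $|t|>2$, $f(t)=\log|t|$ if $k=0$ and $f(t)=-\frac{1}{2k\,t^{2k}}$ if $k>0$. (3) For every Laurent decomposition as in (1) and every $f$ as in (2) there is $\varepsilon_0>0$ such that for all $0<\varepsilon<\varepsilon_0$, with $f_\varepsilon(t)=\varepsilon^{-2k}f(t/\varepsilon)$, the two-form $\omega_\varepsilon$ on $M$ equal to $$d(f_\varepsilon\circ x)\wedge\Big(\sum_{i=0}^{2k}x^i\,\pi^*\hat\alpha_i\Big)+\beta$$ on $U$ and to $\omega$ on $M\setminus U$ is a folded symplectic form, and $\omega_\varepsilon=\omega$ on $\{|x|\ge 2\varepsilon\}$. -/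

import Mathlib

open scoped Manifold ContDiff Topology

noncomputable section

namespace BSymp

/-! ### Linear algebra of two-forms -/

section LinearAlgebra

variable {V : Type*} [AddCommGroup V] [Module ℝ V] [TopologicalSpace V]

/-- The wedge product `θ ∧ a` of a linear functional `θ` and an alternating `1`-form `a`:
`(θ ∧ a)(u, v) = θ u * a v - θ v * a u`. -/
def wedge (θ : V →L[ℝ] ℝ) (a : V [⋀^Fin 1]→L[ℝ] ℝ) : V [⋀^Fin 2]→L[ℝ] ℝ :=
  let a' : V →L[ℝ] ℝ := (ContinuousAlternatingMap.ofSubsingleton ℝ V ℝ (0 : Fin 1)).symm a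
  { toFun := fun v => θ (v 0) * a' (v 1) - θ (v 1) * a' (v 0)
    map_update_add' := by
      intro _ v i u w
      fin_cases i <;> simp [Function.update] <;> ring
    map_update_smul' := by
      intro _ v i c u
      fin_cases i <;> simp [Function.update] <;> ring
    cont := by fun_prop
    map_eq_zero_of_eq' := by
      intro v i j h hij
      fin_cases i <;> fin_cases j <;> simp_all }

theorem wedge_apply (θ : V →L[ℝ] ℝ) (a : V [⋀^Fin 1]→L[ℝ] ℝ) (u v : V) :
    wedge θ a ![u, v] = θ u * a ![v] - θ v * a ![u] := by
  have h : ∀ w : V, (ContinuousAlternatingMap.ofSubsingleton ℝ V ℝ (0 : Fin 1)).symm a w =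
      a ![w] := by
    intro w
    change a (fun _ => w) = a ![w]
    congr 1
    ext i
    fin_cases i
    rfl
  change θ u * _ - θ v * _ = _
  rw [← h, ← h]
  rfl

/-- The value of the `r`-fold wedge power `Ω ∧ ⋯ ∧ Ω` of a two-form on `2r` vectors:
`Ω^r (v₁, …, v₂ᵣ) = 2⁻ʳ ∑_σ sign σ ∏ᵢ Ω (v_{σ(2i-1)}, v_{σ(2i)})`. -/
def wedgePow (r : ℕ) (Ω : V [⋀^Fin 2]→L[ℝ] ℝ) (v : Fin (2 * r) → V) : ℝ :=
  (2 ^ r : ℝ)⁻¹ * ∑ σ : Equiv.Perm (Fin (2 * r)), ((Equiv.Perm.sign σ : ℤ) : ℝ) *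
    ∏ i : Fin r, Ω ![v (σ ⟨2 * i.1, by omega⟩), v (σ ⟨2 * i.1 + 1, by omega⟩)]

end LinearAlgebra

/-- The model space of a manifold of dimension `d`. -/
abbrev Model (d : ℕ) : Type := EuclideanSpace ℝ (Fin d)

section Manifold

variable {d : ℕ} {M : Type*} [TopologicalSpace M] [ChartedSpace (Model d) M]

/-! ### Differential forms on a manifold -/

variable (d M) in
/-- A (not necessarily continuous) differential `j`-form on `M`. -/
abbrev Form (j : ℕ) : Type _ := ∀ p : M, (TangentSpace (𝓡 d) p) [⋀^Fin j]→L[ℝ] ℝ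

/-- The coordinate expression of a form in the preferred chart `φ` at `p`, that is the pullback
`(φ⁻¹)^* η`, which is meaningful on the target of `φ`. -/
def inChart {j : ℕ} (η : Form d M j) (p : M) : Model d → (Model d) [⋀^Fin j]→L[ℝ] ℝ :=
  fun y => (η ((extChartAt (𝓡 d) p).symm y)).compContinuousLinearMap
    (mfderiv 𝓘(ℝ, Model d) (𝓡 d) (extChartAt (𝓡 d) p).symm y)

/-- The form `η` is smooth at `p`. (Smoothness on an open set means smoothness at all its
points.) -/
def SmoothAt {j : ℕ} (η : Form d M j) (p : M) : Prop :=
  ContDiffAt ℝ ∞ (inChart η p) (extChartAt (𝓡 d) p p)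

/-- The exterior derivative of a form, computed at each point `p` in the preferred chart `φ` at
`p`: `dη = φ^* d((φ⁻¹)^* η)`. -/
def extD {j : ℕ} (η : Form d M j) : Form d M (j + 1) := fun p =>
  (extDeriv (inChart η p) (extChartAt (𝓡 d) p p)).compContinuousLinearMap
    (mfderiv (𝓡 d) 𝓘(ℝ, Model d) (extChartAt (𝓡 d) p) p)

/-- The differential of a real function, as a linear functional on the tangent space. -/
def dFun (x : M → ℝ) (p : M) : TangentSpace (𝓡 d) p →L[ℝ] ℝ :=
  mfderiv (𝓡 d) 𝓘(ℝ, ℝ) x p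

/-- `x` is a smooth function on `M` with regular value `0`, so that `Z = x⁻¹(0)` is a (closed,
embedded) hypersurface with global defining function `x`. -/
structure IsDefiningFunction (x : M → ℝ) : Prop where
  smooth : ContMDiff (𝓡 d) 𝓘(ℝ, ℝ) ∞ x
  regular : ∀ p : M, x p = 0 → dFun (d := d) x p ≠ 0

/-! ### The `b^m`-tangent bundle and `b^m`-forms -/

/-- The fibre at `p` of the `b^m`-tangent bundle of `(M, Z, x)`, where `Z = x⁻¹(0)`, realized inside
`T_p M × ℝ` as the pairs `(u, c)` with `dx(u) = x(p)^m c`.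

For `p ∉ Z` the number `c = dx(u) / x(p)^m` is determined by `u`, and the fibre is `T_p M`.
For `p ∈ Z` and `m ≥ 1` the condition says `dx(u) = 0`, and the fibre is
`T_p Z ⊕ ℝ · (x^m ∂/∂x)`, where `x^m ∂/∂x = (0, 1)`.
The second coordinate is the `b^m`-one-form `dx / x^m`. -/
def bTangent (m : ℕ) (x : M → ℝ) (p : M) : Submodule ℝ (TangentSpace (𝓡 d) p × ℝ) where
  carrier := {w | dFun x p w.1 = x p ^ m * w.2}
  add_mem' := by
    intro a b ha hb
    simp only [Set.mem_ofPred_eq, Prod.fst_add, Prod.snd_add, map_add] at *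
    rw [ha, hb]; ring
  zero_mem' := by simp
  smul_mem' := by
    intro c a ha
    simp only [Set.mem_ofPred_eq, Prod.smul_fst, Prod.smul_snd, map_smul, smul_eq_mul] at *
    rw [ha]; ring

/-- Off `Z`, the identification `u ↦ (u, dx(u) / x^m)` of `T_p M` with the `b^m`-tangent fibre. -/
def bLift (m : ℕ) (x : M → ℝ) (p : M) (hp : x p ≠ 0) :
    TangentSpace (𝓡 d) p →L[ℝ] bTangent (d := d) m x p :=
  ((ContinuousLinearMap.id ℝ (TangentSpace (𝓡 d) p)).prod
    ((x p ^ m)⁻¹ • dFun (d := d) x p)).codRestrict (bTangent m x p) (by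
      intro u
      change dFun x p u = x p ^ m * ((x p ^ m)⁻¹ * dFun x p u)
      rw [mul_inv_cancel_left₀ (pow_ne_zero m hp)])

variable (d) in
/-- A (not necessarily continuous) section of `Λ²` of the `b^m`-cotangent bundle. -/
abbrev BTwoForm (m : ℕ) (x : M → ℝ) : Type _ :=
  ∀ p : M, (bTangent (d := d) m x p) [⋀^Fin 2]→L[ℝ] ℝ

variable {m : ℕ} {x : M → ℝ}

/-- The equation `Ω = (dx / x^m) ∧ a + b` at the point `p`, where `a` is an alternating one-form
and `b` an alternating two-form on `T_p M`, pulled back to the `b^m`-tangent fibre. -/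
def BTwoForm.EqAt (Ω : BTwoForm d m x) (p : M)
    (a : (TangentSpace (𝓡 d) p) [⋀^Fin 1]→L[ℝ] ℝ)
    (b : (TangentSpace (𝓡 d) p) [⋀^Fin 2]→L[ℝ] ℝ) : Prop :=
  ∀ w w' : bTangent (d := d) m x p,
    Ω p ![w, w'] = (w.1.2 * a ![w'.1.1] - w'.1.2 * a ![w.1.1]) + b ![w.1.1, w'.1.1]

/-- Smoothness of a section of `Λ²` of the `b^m`-cotangent bundle: near every point it is
`(dx / x^m) ∧ α + β` with smooth forms `α` and `β`. -/
def BTwoForm.IsSmooth (Ω : BTwoForm d m x) : Prop :=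
  ∀ p : M, ∃ (α : Form d M 1) (β : Form d M 2),
    ∀ᶠ q in 𝓝 p, SmoothAt α q ∧ SmoothAt β q ∧ Ω.EqAt q (α q) (β q)

open Classical in
/-- The ordinary two-form on `M \ Z` given by a `b^m`-two-form (with value `0` on `Z`). -/
def BTwoForm.toForm (Ω : BTwoForm d m x) : Form d M 2 := fun p =>
  if hp : x p ≠ 0 then (Ω p).compContinuousLinearMap (bLift m x p hp) else 0

/-- `Ω` is a `b^m`-symplectic form on `(M, Z, x)`: a smooth closed `b^m`-two-form of maximal rank at
every point of `M`, the points of `Z` included. As `M \ Z` is dense, closedness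
may be tested there. -/
structure IsBSymplectic (Ω : BTwoForm d m x) : Prop where
  smooth : Ω.IsSmooth
  closed : ∀ p : M, x p ≠ 0 → extD Ω.toForm p = 0
  nondegenerate : ∀ (p : M) (w : bTangent (d := d) m x p),
    (∀ w' : bTangent (d := d) m x p, Ω p ![w, w'] = 0) → w = 0

/-! ### Laurent decompositions and desingularization -/

/-- A Laurent decomposition `Ω = (dx / x^m) ∧ ∑_{i < m} x^i π^*(α̂ᵢ) + β` of a `b^m`-two-form in a
tubular neighbourhood `U = {|x| < δ}` of `Z`, with projection `π : U → Z`. The closed one-forms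
`α̂ᵢ` on `Z` are recorded through their pullbacks `αᵢ = π^* α̂ᵢ`, the closed one-forms on `U`
with `π^* αᵢ = αᵢ`. -/
structure LaurentDecomposition (Ω : BTwoForm d m x) where
  /-- the width of the tubular neighbourhood -/
  δ : ℝ
  /-- the projection of the tubular neighbourhood -/
  π : M → M
  /-- the coefficients `αᵢ = π^* α̂ᵢ` -/
  α : Fin m → Form d M 1
  /-- the smooth part -/
  β : Form d M 2
  δ_pos : 0 < δ
  π_smooth : ContMDiffOn (𝓡 d) (𝓡 d) ∞ π {p | |x p| < δ}
  π_eq_self : ∀ p, x p = 0 → π p = p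
  /-- `(π, x)` is a bijection of `U` onto `Z × (-δ, δ)` … -/
  bijOn : Set.BijOn (fun p => (π p, x p)) {p | |x p| < δ} ({z | x z = 0} ×ˢ Set.Ioo (-δ) δ)
  /-- … and an immersion, hence a diffeomorphism. -/
  immersion : ∀ p, |x p| < δ → ∀ u : TangentSpace (𝓡 d) p,
    mfderiv (𝓡 d) (𝓡 d) π p u = 0 → dFun x p u = 0 → u = 0
  α_smooth : ∀ i p, |x p| < δ → SmoothAt (α i) p
  α_closed : ∀ i p, |x p| < δ → extD (α i) p = 0
  α_pullback : ∀ i p, |x p| < δ →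
    α i p = (α i (π p)).compContinuousLinearMap (mfderiv (𝓡 d) (𝓡 d) π p)
  β_smooth : ∀ p, |x p| < δ → SmoothAt β p
  eqAt : ∀ p, |x p| < δ → Ω.EqAt p (∑ i : Fin m, x p ^ (i : ℕ) • α i p) (β p)

/-- The profile functions `f` of the desingularization for `m = 2k + 1`: `f` is smooth and even,
`f' > 0` on `(0, ∞)`, `f(t) = t² - 2` on `[-1, 1]`, and for `|t| > 2` it is the primitive of
`1 / t^(2k+1)`, namely `log |t|` if `k = 0` and `-1 / (2k t^(2k))` if `k > 0`. -/
structure IsProfile (k : ℕ) (f : ℝ → ℝ) : Prop where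
  smooth : ContDiff ℝ ∞ f
  even : ∀ t, f (-t) = f t
  deriv_pos : ∀ t, 0 < t → 0 < deriv f t
  eq_inner : ∀ t, |t| ≤ 1 → f t = t ^ 2 - 2
  eq_outer_zero : k = 0 → ∀ t, 2 < |t| → f t = Real.log |t|
  eq_outer_pos : 0 < k → ∀ t, 2 < |t| → f t = -1 / (2 * k * t ^ (2 * k))

/-- The rescaled profile `f_ε(t) = ε^(-2k) f(t / ε)`. -/
def scaledProfile (k : ℕ) (f : ℝ → ℝ) (ε : ℝ) : ℝ → ℝ := fun t => (ε ^ (2 * k))⁻¹ * f (t / ε)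

open Classical in
/-- The `f_ε`-desingularization of a `b^(2k+1)`-two-form `Ω`: the form
`df_ε ∧ ∑_{i ≤ 2k} x^i αᵢ + β` on the tubular neighbourhood, where `f_ε` stands for `f_ε ∘ x`, and
`Ω` outside it. -/
def LaurentDecomposition.desingularization {k : ℕ} {Ω : BTwoForm d (2 * k + 1) x}
    (L : LaurentDecomposition Ω) (f : ℝ → ℝ) (ε : ℝ) : Form d M 2 := fun p =>
  if |x p| < L.δ then
    wedge (dFun (fun q => scaledProfile k f ε (x q)) p)
      (∑ i : Fin (2 * k + 1), x p ^ (i : ℕ) • L.α i p) + L.β p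
  else Ω.toForm p

end Manifold

/-! ### Folded symplectic forms -/

section Folded

variable {n : ℕ} {M : Type*} [TopologicalSpace M] [ChartedSpace (Model (2 * n)) M]

/-- The coefficient of the top power `η^n` with respect to the coordinate trivialization of
`Λ^{2n} T^*M` in the preferred chart at `p`. -/
def topCoeff (η : Form (2 * n) M 2) (p : M) : Model (2 * n) → ℝ := fun y =>
  wedgePow n (inChart η p y) (EuclideanSpace.basisFun (Fin (2 * n)) ℝ)

/-- A folded symplectic form on a `2n`-dimensional manifold: a smooth closed two-form `η` such
that `η^n` is transverse to the zero section of `Λ^{2n} T^*M`, so that its zero set `S` is a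
hypersurface, and `(i^* η)^(n-1)` vanishes nowhere on `S`, where `i : S → M` is the inclusion.

At a zero `p` of `η^n`, written in the chart at `p`, transversality says that the differential of
the coefficient of `η^n` is nonzero; its kernel is then `T_p S`. -/
structure IsFoldedSymplectic (η : Form (2 * n) M 2) : Prop where
  smooth : ∀ p : M, SmoothAt η p
  closed : ∀ p : M, extD η p = 0
  transverse : ∀ p : M, topCoeff η p (extChartAt (𝓡 (2 * n)) p p) = 0 →
    fderiv ℝ (topCoeff η p) (extChartAt (𝓡 (2 * n)) p p) ≠ 0
  fold_nondegenerate : ∀ p : M, topCoeff η p (extChartAt (𝓡 (2 * n)) p p) = 0 →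
    ∃ v : Fin (2 * (n - 1)) → Model (2 * n),
      (∀ i, fderiv ℝ (topCoeff η p) (extChartAt (𝓡 (2 * n)) p p) (v i) = 0) ∧
      wedgePow (n - 1) (inChart η p (extChartAt (𝓡 (2 * n)) p p)) v ≠ 0

end Folded

end BSymp

end

noncomputable section

namespace BSymp

/-! ### Smooth families of alternating maps in finite dimension -/

section Calculus

variable {E F : Type*} [NormedAddCommGroup E] [NormedSpace ℝ E] [NormedAddCommGroup F]
  [NormedSpace ℝ F] {j : ℕ}

/-! Put A = ∑ xⁱ αᵢ. Near Z the desingularized form is g dx ∧ A + β with g = f_ε'(x), and its top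
power is affine in g: the coefficient is g μ + ν, where ν comes from βⁿ and μ from n dx ∧ A ∧ βⁿ⁻¹
(`wedgePow_wedge_add_affine`). Maximal rank of ω at a point of Z says that c ∧ A + β is
nondegenerate on ℝ × ker dx. Linear algebra extracts two facts from this: μ ≠ 0
(`BNondegenerate.wedgePow_sub_ne_zero`), and βⁿ⁻¹ is nonzero on ker dx
(`BNondegenerate.exists_wedgePow_ne_zero`).

Close to Z the top power therefore vanishes exactly where g = s := -ν/μ, which is locally bounded.
Since f_ε' is large on |x| ≥ ε when x and ε are small (`IsProfile.abs_lt_of_deriv_le`), zeros lie in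
|x| < ε, where f_ε'(t) = 2t/ε^(2k+2). There the differential of the coefficient, times ε^(2k+2)/2,
equals μ dx + (ε^(2k+2)/2)(s dμ + dν). This extends smoothly to ε = 0 with value μ dx, and at ε = 0
on Z the fold conditions are the two facts above. Both are open conditions, so they persist for
nearby points and small ε (`eventually_foldAt`). Near a point off Z the form equals ω for small ε
and is symplectic there. Compactness makes the range of ε uniform.

Closedness: f_ε'(x) xⁱ dx ∧ αᵢ is the differential of H(x) αᵢ with H' = f_ε'(t) tⁱ, so dω_ε = dβ on
U. Off Z a small enough ε makes ω_ε = ω locally, hence dβ = 0 there, and on Z by continuity.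

For the Laurent decomposition, a retraction r onto Z is built by pushing along finitely many charts
in which x is linear (`IsDefiningFunction.exists_retraction`). The coefficients of ω are normalized
to annihilate ∂/∂x, and the singular one is expanded along the fibres of r by iterating Hadamard's
lemma. Evaluating dω = 0 on ∂/∂x and two vectors tangent to Z gives ∑ tⁱ dαᵢ(u, v) = tᵐ ·
(continuous), so each dαᵢ vanishes (`extDeriv_coeff_eq_zero`). The order-m remainder is divisible by
xᵐ and moves into β. Profiles come from cutting off between t² - 2 and the outer primitive. -/

theorem finiteDimensional_continuousAlternatingMap [FiniteDimensional ℝ E] :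
    FiniteDimensional ℝ (E [⋀^Fin j]→L[ℝ] ℝ) := by
  have : Module.Finite ℝ (MultilinearMap ℝ (fun _ : Fin j => E) ℝ) := inferInstance
  let f : (E [⋀^Fin j]→L[ℝ] ℝ) →ₗ[ℝ] MultilinearMap ℝ (fun _ : Fin j => E) ℝ :=
    { toFun := fun ζ => ζ.toContinuousMultilinearMap.toMultilinearMap
      map_add' := fun _ _ => rfl
      map_smul' := fun _ _ => rfl }
  refine Module.Finite.of_injective f fun a b h => ?_
  ext v
  exact congrArg (fun g : MultilinearMap ℝ (fun _ : Fin j => E) ℝ => g v) h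

/-- A family of alternating maps on a finite-dimensional space is smooth as soon as all its
values on constant vectors are. -/
theorem contDiffAt_alternating_of_apply [FiniteDimensional ℝ E] {n : WithTop ℕ∞}
    {ζ : F → E [⋀^Fin j]→L[ℝ] ℝ} {y : F} (h : ∀ v, ContDiffAt ℝ n (fun y => ζ y v) y) :
    ContDiffAt ℝ n ζ y := by
  have : FiniteDimensional ℝ (E [⋀^Fin j]→L[ℝ] ℝ) := finiteDimensional_continuousAlternatingMap
  let e := Module.finBasis ℝ E
  let Φ : (E [⋀^Fin j]→L[ℝ] ℝ) →ₗ[ℝ] ((Fin j → Fin (Module.finrank ℝ E)) → ℝ) :=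
    { toFun := fun ζ r => ζ fun i => e (r i)
      map_add' := fun _ _ => rfl
      map_smul' := fun _ _ => rfl }
  have hΦ : Function.Injective Φ := by
    intro a b hab
    have : a.toAlternatingMap.toMultilinearMap = b.toAlternatingMap.toMultilinearMap :=
      Module.Basis.ext_multilinear (fun _ => e) fun r => congrFun hab r
    ext v
    exact congrArg (fun g : MultilinearMap ℝ (fun _ : Fin j => E) ℝ => g v) this
  obtain ⟨Ψ, hΨ⟩ := Φ.exists_leftInverse_of_injective (LinearMap.ker_eq_bot.2 hΦ)
  have key : ζ = fun y => LinearMap.toContinuousLinearMap Ψ (Φ (ζ y)) := by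
    funext y
    exact (congrArg (fun g : _ →ₗ[ℝ] _ => g (ζ y)) hΨ).symm
  rw [key]
  refine (ContinuousLinearMap.contDiff _).contDiffAt.comp y ?_
  rw [contDiffAt_pi]
  exact fun r => h _

/-- Expanding the vectors in a fixed basis turns the value into a finite sum of products of
coordinate functions and values of `ζ` on constant vectors. -/
theorem _root_.ContDiffAt.alternating_apply [FiniteDimensional ℝ E] {n : WithTop ℕ∞}
    {ζ : F → E [⋀^Fin j]→L[ℝ] ℝ} {v : Fin j → F → E} {y : F} (h : ContDiffAt ℝ n ζ y)
    (hv : ∀ i, ContDiffAt ℝ n (v i) y) : ContDiffAt ℝ n (fun y => ζ y fun i => v i y) y := by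
  let e := Module.finBasis ℝ E
  have key : (fun y => ζ y fun i => v i y) = fun y => ∑ r : Fin j → Fin (Module.finrank ℝ E),
      (∏ i, e.repr (v i y) (r i)) * ζ y fun i => e (r i) := by
    funext y
    have h1 : (fun i => v i y) = fun i => ∑ k, e.repr (v i y) k • e k := by
      funext i; exact (e.sum_repr _).symm
    conv_lhs => rw [h1]
    rw [show ∀ w, ζ y w = (ζ y).toContinuousMultilinearMap w from fun _ => rfl,
      ContinuousMultilinearMap.map_sum]
    refine Finset.sum_congr rfl fun r _ => ?_
    rw [ContinuousMultilinearMap.map_smul_univ]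
    rfl
  rw [key]
  refine ContDiffAt.sum fun r _ => ContDiffAt.mul (contDiffAt_prod fun i _ => ?_) ?_
  · have : (fun y => e.repr (v i y) (r i)) =
        fun y => LinearMap.toContinuousLinearMap (e.coord (r i)) (v i y) := rfl
    rw [this]
    exact (ContinuousLinearMap.contDiff _).contDiffAt.comp y (hv i)
  · let ev : (E [⋀^Fin j]→L[ℝ] ℝ) →ₗ[ℝ] ℝ :=
      { toFun := fun ζ => ζ fun i => e (r i)
        map_add' := fun _ _ => rfl
        map_smul' := fun _ _ => rfl }
    have : FiniteDimensional ℝ (E [⋀^Fin j]→L[ℝ] ℝ) :=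
      finiteDimensional_continuousAlternatingMap
    exact (LinearMap.toContinuousLinearMap ev).contDiff.contDiffAt.comp y h

theorem _root_.ContDiffAt.alternating_comp {G : Type*} [NormedAddCommGroup G] [NormedSpace ℝ G]
    [FiniteDimensional ℝ E] [FiniteDimensional ℝ G]
    {n : WithTop ℕ∞} {ζ : F → E [⋀^Fin j]→L[ℝ] ℝ} {A : F → G →L[ℝ] E} {y : F}
    (h : ContDiffAt ℝ n ζ y) (hA : ContDiffAt ℝ n A y) :
    ContDiffAt ℝ n (fun y => (ζ y).compContinuousLinearMap (A y)) y :=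
  contDiffAt_alternating_of_apply fun v =>
    h.alternating_apply fun i => hA.clm_apply (contDiffAt_const (c := v i))

end Calculus

/-- The regularity required by d ∘ d = 0 and by naturality of the exterior derivative. -/
theorem two_le_smooth : minSmoothness ℝ 2 ≤ (∞ : WithTop ℕ∞) := by
  rw [minSmoothness_of_isRCLikeNormedField]
  exact WithTop.coe_le_coe.2 (le_top : (2 : ℕ∞) ≤ ⊤)

/-! ### Pullback of forms, naturality of d, independence of coordinates -/

section Pullback

variable {d d' d'' : ℕ} {M N Q : Type*} [TopologicalSpace M] [ChartedSpace (Model d) M]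
  [TopologicalSpace N] [ChartedSpace (Model d') N] [TopologicalSpace Q]
  [ChartedSpace (Model d'') Q] {j : ℕ}

/-- The pullback of a differential form by a map. -/
def pullback (F : M → N) (η : Form d' N j) : Form d M j := fun p =>
  (η (F p)).compContinuousLinearMap (mfderiv (𝓡 d) (𝓡 d') F p)

theorem inChart_eq_pullback (η : Form d M j) (p : M) :
    inChart η p = pullback (d := d) (M := Model d) (extChartAt (𝓡 d) p).symm η := rfl

theorem pullback_comp {G : N → Q} {F : M → N} (η : Form d'' Q j) {p : M}
    (hG : MDifferentiableAt (𝓡 d') (𝓡 d'') G (F p)) (hF : MDifferentiableAt (𝓡 d) (𝓡 d') F p) :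
    pullback (G ∘ F) η p = pullback (d := d) F (pullback (d := d') G η) p := by
  unfold pullback
  rw [mfderiv_comp p hG hF]
  rfl

theorem pullback_congr {F F' : M → N} (η : Form d' N j) {p : M} (h : F =ᶠ[𝓝 p] F') :
    pullback (d := d) F η p = pullback F' η p := by
  -- The tangent spaces at `F p` and `F' p` are both the model space by definition; the ascriptions
  -- make the two derivatives comparable.
  have h1 : (mfderiv (𝓡 d) (𝓡 d') F p : Model d →L[ℝ] Model d') = mfderiv (𝓡 d) (𝓡 d') F' p :=
    h.mfderiv_eq
  have h0 : ∀ q q' : N, q = q' → (η q : (Model d') [⋀^Fin j]→L[ℝ] ℝ) = η q' := by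
    rintro q _ rfl; rfl
  have h2 := h0 _ _ h.eq_of_nhds
  exact congrArg₂ (fun (a : (Model d') [⋀^Fin j]→L[ℝ] ℝ) (b : Model d →L[ℝ] Model d') =>
    a.compContinuousLinearMap b) h2 h1

theorem pullback_id (η : Form d M j) (p : M) : pullback id η p = η p := by
  unfold pullback
  rw [mfderiv_id]
  rfl

theorem pullback_eq_self {F : M → M} (η : Form d M j) {p : M} (h : ∀ᶠ q in 𝓝 p, F q = q) :
    pullback F η p = η p :=
  (pullback_congr η (F' := id) h).trans (pullback_id η p)

/-- A differential form on the model space, as a function with values in a fixed space. -/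
def modelForm (ζ : Form d (Model d) j) : Model d → (Model d) [⋀^Fin j]→L[ℝ] ℝ := ζ

/-- The coordinate expression of a form in the parametrization `σ`. -/
def localForm (σ : Model d → M) (η : Form d M j) : Model d → (Model d) [⋀^Fin j]→L[ℝ] ℝ :=
  modelForm (pullback σ η)

theorem smoothAt_model_iff {ζ : Form d (Model d) j} {h : Model d} :
    SmoothAt ζ h ↔ ContDiffAt ℝ ∞ (modelForm ζ) h := by
  have : inChart ζ h = ζ := by
    rw [inChart_eq_pullback]
    funext y
    exact pullback_eq_self ζ (Filter.Eventually.of_forall fun q => rfl)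
  unfold SmoothAt
  rw [this]
  rfl

theorem extD_model (ζ : Form d (Model d) j) (h : Model d) :
    extD ζ h = extDeriv (modelForm ζ) h := by
  have h1 : inChart ζ h = ζ := by
    rw [inChart_eq_pullback]
    funext y
    exact pullback_eq_self ζ (Filter.Eventually.of_forall fun q => rfl)
  unfold extD
  rw [h1]
  have h2 : mfderiv (𝓡 d) 𝓘(ℝ, Model d) (extChartAt (𝓡 d) h) h = ContinuousLinearMap.id ℝ _ :=
    mfderiv_id
  rw [h2]
  rfl

/-- Mutually inverse smooth germs `κ : (M, p) → E` and `σ : (E, κ p) → M`. -/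
structure LocalCoord (κ : M → Model d) (σ : Model d → M) (p : M) : Prop where
  smooth : ContMDiffAt (𝓡 d) (𝓡 d) ∞ κ p
  smooth_symm : ContMDiffAt (𝓡 d) (𝓡 d) ∞ σ (κ p)
  left_inv : ∀ᶠ q in 𝓝 p, σ (κ q) = q
  right_inv : ∀ᶠ h in 𝓝 (κ p), κ (σ h) = h

theorem localCoord_extChartAt [IsManifold (𝓡 d) ∞ M] {p q : M}
    (hq : q ∈ (extChartAt (𝓡 d) p).source) :
    LocalCoord (extChartAt (𝓡 d) p) (extChartAt (𝓡 d) p).symm q where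
  smooth := contMDiffAt_extChartAt' (by simpa using hq)
  smooth_symm := (contMDiffOn_extChartAt_symm p).contMDiffAt
    ((isOpen_extChartAt_target p).mem_nhds ((extChartAt (𝓡 d) p).map_source hq))
  left_inv := Filter.eventually_of_mem ((isOpen_extChartAt_source p).mem_nhds hq)
    fun _ h => (extChartAt (𝓡 d) p).left_inv h
  right_inv := Filter.eventually_of_mem ((isOpen_extChartAt_target p).mem_nhds
    ((extChartAt (𝓡 d) p).map_source hq)) fun _ h => (extChartAt (𝓡 d) p).right_inv h

theorem _root_.ContMDiffAt.eventually_mdifferentiableAt [IsManifold (𝓡 d) ∞ M]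
    [IsManifold (𝓡 d') ∞ N] {F : M → N} {p : M}
    (hF : ContMDiffAt (𝓡 d) (𝓡 d') ∞ F p) :
    ∀ᶠ q in 𝓝 p, MDifferentiableAt (𝓡 d) (𝓡 d') F q := by
  have : IsManifold (𝓡 d) 1 M := .of_le (n := ∞) (by simp)
  have : IsManifold (𝓡 d') 1 N := .of_le (n := ∞) (by simp)
  have h1 : ContMDiffAt (𝓡 d) (𝓡 d') 1 F p := hF.of_le (by simp)
  exact (contMDiffAt_iff_contMDiffAt_nhds (by simp) |>.1 h1).mono
    fun q hq => hq.mdifferentiableAt one_ne_zero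

theorem SmoothAt.congr [IsManifold (𝓡 d) ∞ M] {η η' : Form d M j} {p : M} (h : SmoothAt η p)
    (hη : ∀ᶠ q in 𝓝 p, η q = η' q) : SmoothAt η' p := by
  have h1 := localCoord_extChartAt (d := d) (p := p) (mem_extChartAt_source p)
  refine ContDiffAt.congr_of_eventuallyEq h ?_
  have h2 := h1.smooth_symm.continuousAt
  have h3 : (extChartAt (𝓡 d) p).symm (extChartAt (𝓡 d) p p) = p := h1.left_inv.self_of_nhds
  rw [ContinuousAt, h3] at h2
  filter_upwards [h2.eventually hη] with y hy
  unfold inChart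
  rw [hy]

theorem extD_congr [IsManifold (𝓡 d) ∞ M] {η η' : Form d M j} {p : M}
    (hη : ∀ᶠ q in 𝓝 p, η q = η' q) : extD η p = extD η' p := by
  have h1 := localCoord_extChartAt (d := d) (p := p) (mem_extChartAt_source p)
  have h2 := h1.smooth_symm.continuousAt
  have h3 : (extChartAt (𝓡 d) p).symm (extChartAt (𝓡 d) p p) = p := h1.left_inv.self_of_nhds
  rw [ContinuousAt, h3] at h2
  have h4 : inChart η p =ᶠ[𝓝 (extChartAt (𝓡 d) p p)] inChart η' p := by
    filter_upwards [h2.eventually hη] with y hy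
    unfold inChart
    rw [hy]
  unfold extD
  rw [h4.extDeriv_eq]

/-- In charts, a pullback of forms is the pullback by the map expressed in the charts. -/
theorem inChart_pullback [IsManifold (𝓡 d) ∞ M] [IsManifold (𝓡 d') ∞ N] {F : M → N} {p : M}
    (hF : ContMDiffAt (𝓡 d) (𝓡 d') ∞ F p) (η : Form d' N j) :
    ∃ g : Model d → Model d', ContDiffAt ℝ ∞ g (extChartAt (𝓡 d) p p) ∧
      g (extChartAt (𝓡 d) p p) = extChartAt (𝓡 d') (F p) (F p) ∧
      (∀ᶠ q in 𝓝 p, g (extChartAt (𝓡 d) p q) = extChartAt (𝓡 d') (F p) (F q)) ∧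
      inChart (pullback F η) p =ᶠ[𝓝 (extChartAt (𝓡 d) p p)]
        fun y => (inChart η (F p) (g y)).compContinuousLinearMap (fderiv ℝ g y) := by
  have h1 := localCoord_extChartAt (d := d) (p := p) (mem_extChartAt_source p)
  have h2 := localCoord_extChartAt (d := d') (p := F p) (mem_extChartAt_source (F p))
  set φ := extChartAt (𝓡 d) p
  set ψ := extChartAt (𝓡 d') (F p)
  have h3 : φ.symm (φ p) = p := h1.left_inv.self_of_nhds
  have hF' : ContMDiffAt (𝓡 d) (𝓡 d') ∞ F (φ.symm (φ p)) := by rwa [h3]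
  have hFφ : ContMDiffAt (𝓡 d) (𝓡 d') ∞ (F ∘ φ.symm) (φ p) := hF'.comp _ h1.smooth_symm
  have h5 : (F ∘ φ.symm) (φ p) = F p := by simp [h3]
  have hg : ContMDiffAt (𝓡 d) (𝓡 d') ∞ (ψ ∘ F ∘ φ.symm) (φ p) := by
    refine ContMDiffAt.comp _ ?_ hFφ
    rw [h5]; exact h2.smooth
  have hψ : ContMDiffAt (𝓡 d') (𝓡 d') ∞ ψ.symm ((ψ ∘ F ∘ φ.symm) (φ p)) := by
    simpa [h3] using h2.smooth_symm
  have hcF := hFφ.continuousAt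
  have hcφ := h1.smooth_symm.continuousAt
  refine ⟨ψ ∘ F ∘ φ.symm, hg.contDiffAt, by simp [h3], ?_, ?_⟩
  · filter_upwards [h1.left_inv] with q hq
    simp [hq]
  · rw [ContinuousAt, h5] at hcF
    rw [ContinuousAt, h3] at hcφ
    filter_upwards [hcφ.eventually hF.eventually_mdifferentiableAt,
      h1.smooth_symm.eventually_mdifferentiableAt, hg.eventually_mdifferentiableAt,
      hg.continuousAt.eventually hψ.eventually_mdifferentiableAt,
      (hcF.eventually h2.left_inv).eventually_nhds] with y e1 e2 e3 e4 e5
    have c1 : inChart (pullback F η) p y = pullback (d := d) (F ∘ φ.symm) η y :=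
      (pullback_comp (d := d) η e1 e2).symm
    have c2 : pullback (d := d) (F ∘ φ.symm) η y =
        pullback (d := d) (ψ.symm ∘ ψ ∘ F ∘ φ.symm) η y :=
      pullback_congr η (e5.mono fun w hw => hw.symm)
    rw [c1, c2, pullback_comp (d := d) (d' := d') η e4 e3, pullback, mfderiv_eq_fderiv]
    rfl

theorem SmoothAt.pullback [IsManifold (𝓡 d) ∞ M] [IsManifold (𝓡 d') ∞ N] {F : M → N} {p : M}
    {η : Form d' N j} (hη : SmoothAt η (F p)) (hF : ContMDiffAt (𝓡 d) (𝓡 d') ∞ F p) :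
    SmoothAt (BSymp.pullback F η : Form d M j) p := by
  obtain ⟨g, hg, hgp, -, he⟩ := inChart_pullback hF η
  refine ContDiffAt.congr_of_eventuallyEq ?_ he
  refine ContDiffAt.alternating_comp ?_ (hg.fderiv_right (by simp))
  exact ContDiffAt.comp _ (by rw [hgp]; exact hη) hg

/-- Naturality of `extDeriv` on the model space, carried through the charts: the chain rule, applied
to the two ways round the square formed by `F`, `g` and the charts, identifies the outer
derivatives. -/
theorem extD_pullback [IsManifold (𝓡 d) ∞ M] [IsManifold (𝓡 d') ∞ N] {F : M → N} {p : M}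
    {η : Form d' N j} (hη : SmoothAt η (F p)) (hF : ContMDiffAt (𝓡 d) (𝓡 d') ∞ F p) :
    extD (BSymp.pullback F η : Form d M j) p = BSymp.pullback F (extD η) p := by
  obtain ⟨g, hg, hgp, hgF, he⟩ := inChart_pullback hF η
  have h1 := localCoord_extChartAt (d := d) (p := p) (mem_extChartAt_source p)
  have h2 := localCoord_extChartAt (d := d') (p := F p) (mem_extChartAt_source (F p))
  have hd : DifferentiableAt ℝ (inChart η (F p)) (g (extChartAt (𝓡 d) p p)) := by
    rw [hgp]; exact ContDiffAt.differentiableAt hη (by simp)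
  have key : (fderiv ℝ g (extChartAt (𝓡 d) p p)).comp
      (mfderiv (𝓡 d) (𝓡 d) (extChartAt (𝓡 d) p) p) =
      (mfderiv (𝓡 d') (𝓡 d') (extChartAt (𝓡 d') (F p)) (F p)).comp
        (mfderiv (𝓡 d) (𝓡 d') F p) := by
    have e1 := mfderiv_comp p (h2.smooth.mdifferentiableAt (by simp))
      (hF.mdifferentiableAt (by simp))
    have e2 := mfderiv_comp p (I' := 𝓡 d) (g := g)
      ((hg.differentiableAt (by simp)).mdifferentiableAt)
      (h1.smooth.mdifferentiableAt (by simp))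
    rw [mfderiv_eq_fderiv] at e2
    exact e2.symm.trans ((Filter.EventuallyEq.mfderiv_eq hgF).trans e1)
  unfold extD
  rw [he.extDeriv_eq, extDeriv_pullback hd hg two_le_smooth, hgp]
  ext v
  exact congrArg (extDeriv (inChart η (F p)) (extChartAt (𝓡 d') (F p) (F p)))
    (funext fun i => congrArg (fun A : Model d →L[ℝ] Model d' => A (v i)) key)

namespace LocalCoord

variable {κ : M → Model d} {σ : Model d → M} {p : M}

theorem apply_self (h : LocalCoord κ σ p) : σ (κ p) = p := h.left_inv.self_of_nhds

variable [IsManifold (𝓡 d) ∞ M]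

/-- A form is recovered from its coordinate expression. -/
theorem pullback_pullback (h : LocalCoord κ σ p) (η : Form d M j) :
    ∀ᶠ q in 𝓝 p, pullback κ (pullback (d := d) σ η) q = η q := by
  filter_upwards [h.left_inv.eventually_nhds, h.smooth.eventually_mdifferentiableAt,
    h.smooth.continuousAt.eventually h.smooth_symm.eventually_mdifferentiableAt] with q h1 h2 h3
  rw [← pullback_comp η h3 h2]
  exact pullback_eq_self η h1

theorem pullback_pullback_symm (h : LocalCoord κ σ p) (ζ : Form d (Model d) j) :
    ∀ᶠ y in 𝓝 (κ p), pullback σ (pullback (d := d) κ ζ) y = ζ y := by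
  have h3 := h.smooth_symm.continuousAt
  rw [ContinuousAt, h.apply_self] at h3
  filter_upwards [h.right_inv.eventually_nhds, h.smooth_symm.eventually_mdifferentiableAt,
    h3.eventually h.smooth.eventually_mdifferentiableAt] with q h1 h2 h3
  rw [← pullback_comp ζ h3 h2]
  exact pullback_eq_self ζ h1

/-- Pullback by either of the inverse germs preserves smoothness, so smoothness, defined through the
preferred chart at `p`, may be tested in any coordinates. -/
theorem smoothAt_iff (h : LocalCoord κ σ p) (η : Form d M j) :
    SmoothAt η p ↔ ContDiffAt ℝ ∞ (localForm σ η)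
      (κ p) := by
  refine Iff.trans ?_ smoothAt_model_iff
  constructor
  · intro h1
    exact SmoothAt.pullback (by rwa [h.apply_self]) h.smooth_symm
  · intro h1
    exact (SmoothAt.pullback h1 h.smooth).congr (h.pullback_pullback η)

theorem extDeriv_pullback (h : LocalCoord κ σ p) {η : Form d M j} (hη : SmoothAt η p) :
    extDeriv (localForm σ η) (κ p) =
      localForm σ (extD η) (κ p) := by
  refine (extD_model _ _).symm.trans ?_
  exact extD_pullback (by rwa [h.apply_self]) h.smooth_symm

theorem eq_zero_of_pullback (h : LocalCoord κ σ p) {η : Form d M j}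
    (hη : localForm σ η (κ p) = 0) : η p = 0 := by
  have h1 : BSymp.pullback (d := d) σ η (κ p) = 0 := hη
  rw [← (h.pullback_pullback η).self_of_nhds, BSymp.pullback, h1]
  rfl

theorem extD_eq_zero_iff (h : LocalCoord κ σ p) {η : Form d M j} (hη : SmoothAt η p) :
    extD η p = 0 ↔
      extDeriv (localForm σ η) (κ p) = 0 := by
  rw [h.extDeriv_pullback hη]
  refine ⟨fun h0 => ?_, h.eq_zero_of_pullback⟩
  have e : ∀ q, q = p → extD η q = 0 := by rintro q rfl; exact h0
  change (extD η (σ (κ p))).compContinuousLinearMap _ = 0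
  rw [e _ h.apply_self]
  rfl

end LocalCoord

end Pullback

/-! ### Wedge powers of two-forms as alternating maps -/

section WedgePow

variable {V : Type*} [AddCommGroup V] [Module ℝ V]

theorem update_pair_zero {α : Type*} (u v x : α) : Function.update ![u, v] 0 x = ![x, v] := by
  ext i; fin_cases i <;> rfl

theorem update_pair_one {α : Type*} (u v x : α) : Function.update ![u, v] 1 x = ![u, x] := by
  ext i; fin_cases i <;> rfl

/-- The index `2 i`. -/
def evenIdx {r : ℕ} (i : Fin r) : Fin (2 * r) := ⟨2 * i.1, by omega⟩

/-- The index `2 i + 1`. -/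
def oddIdx {r : ℕ} (i : Fin r) : Fin (2 * r) := ⟨2 * i.1 + 1, by omega⟩

theorem evenIdx_or_oddIdx {r : ℕ} (j : Fin (2 * r)) : ∃ i : Fin r, j = evenIdx i ∨ j = oddIdx i := by
  refine ⟨⟨j.1 / 2, by omega⟩, ?_⟩
  simp only [evenIdx, oddIdx, Fin.ext_iff]
  omega

theorem evenIdx_injective {r : ℕ} : Function.Injective (evenIdx (r := r)) := fun i j h => by
  simpa [evenIdx, Fin.ext_iff] using h

theorem oddIdx_injective {r : ℕ} : Function.Injective (oddIdx (r := r)) := fun i j h => by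
  simpa [oddIdx, Fin.ext_iff] using h

theorem evenIdx_ne_oddIdx {r : ℕ} (i j : Fin r) : evenIdx i ≠ oddIdx j := by
  simp only [evenIdx, oddIdx, ne_eq, Fin.ext_iff]
  omega

/-- Splitting off from a product over pairs of indices the factor that sees a given index. -/
theorem prod_update_eq {r : ℕ} (B : V →ₗ[ℝ] V →ₗ[ℝ] ℝ) (v : Fin (2 * r) → V) (j : Fin (2 * r)) :
    ∃ l : V →ₗ[ℝ] ℝ, ∀ x, ∏ i, B (Function.update v j x (evenIdx i))
      (Function.update v j x (oddIdx i)) = l x := by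
  obtain ⟨i₀, hi₀⟩ := evenIdx_or_oddIdx j
  set c := ∏ i ∈ Finset.univ.erase i₀, B (v (evenIdx i)) (v (oddIdx i))
  have hne : ∀ i ∈ Finset.univ.erase i₀, evenIdx i ≠ j ∧ oddIdx i ≠ j := by
    intro i hi
    have hi' : i ≠ i₀ := Finset.ne_of_mem_erase hi
    rcases hi₀ with rfl | rfl
    · exact ⟨fun h => hi' (evenIdx_injective h), (evenIdx_ne_oddIdx _ _).symm⟩
    · exact ⟨evenIdx_ne_oddIdx _ _, fun h => hi' (oddIdx_injective h)⟩
  have hc : ∀ x, ∏ i ∈ Finset.univ.erase i₀, B (Function.update v j x (evenIdx i))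
      (Function.update v j x (oddIdx i)) = c := by
    intro x
    refine Finset.prod_congr rfl fun i hi => ?_
    rw [Function.update_of_ne (hne i hi).1, Function.update_of_ne (hne i hi).2]
  have hs : ∀ x, ∏ i, B (Function.update v j x (evenIdx i)) (Function.update v j x (oddIdx i)) =
      B (Function.update v j x (evenIdx i₀)) (Function.update v j x (oddIdx i₀)) * c := by
    intro x
    rw [← Finset.mul_prod_erase _ _ (Finset.mem_univ i₀), hc]
  rcases hi₀ with h | h
  · refine ⟨c • B.flip (v (oddIdx i₀)), fun x => ?_⟩
    rw [hs, h, Function.update_self, Function.update_of_ne (evenIdx_ne_oddIdx _ _).symm]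
    simp [mul_comm]
  · refine ⟨c • B (v (evenIdx i₀)), fun x => ?_⟩
    rw [hs, h, Function.update_self, Function.update_of_ne (evenIdx_ne_oddIdx _ _)]
    simp [mul_comm]

variable [TopologicalSpace V]

/-- The bilinear form underlying an alternating two-form. -/
def toBilin (Ω : V [⋀^Fin 2]→L[ℝ] ℝ) : V →ₗ[ℝ] V →ₗ[ℝ] ℝ :=
  LinearMap.mk₂ ℝ (fun u v => Ω ![u, v])
    (fun u u' v => by
      have := Ω.map_update_add ![u, v] 0 u u'
      rwa [update_pair_zero, update_pair_zero, update_pair_zero] at this)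
    (fun c u v => by
      have := Ω.map_update_smul ![u, v] 0 c u
      rwa [update_pair_zero, update_pair_zero] at this)
    (fun u v v' => by
      have := Ω.map_update_add ![u, v] 1 v v'
      rwa [update_pair_one, update_pair_one, update_pair_one] at this)
    (fun c u v => by
      have := Ω.map_update_smul ![u, v] 1 c v
      rwa [update_pair_one, update_pair_one] at this)

theorem toBilin_apply (Ω : V [⋀^Fin 2]→L[ℝ] ℝ) (u v : V) : toBilin Ω u v = Ω ![u, v] := rfl

theorem toBilin_self (Ω : V [⋀^Fin 2]→L[ℝ] ℝ) (u : V) : toBilin Ω u u = 0 :=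
  Ω.map_eq_zero_of_eq (v := ![u, u]) (i := 0) (j := 1) rfl (by simp)

theorem isAlt_toBilin (Ω : V [⋀^Fin 2]→L[ℝ] ℝ) : (toBilin Ω).IsAlt := toBilin_self Ω

/-- The multilinear map `v ↦ ∏ᵢ Ω (v₂ᵢ, v₂ᵢ₊₁)`. -/
def pairProd (r : ℕ) (Ω : V [⋀^Fin 2]→L[ℝ] ℝ) : MultilinearMap ℝ (fun _ : Fin (2 * r) => V) ℝ where
  toFun v := ∏ i : Fin r, toBilin Ω (v (evenIdx i)) (v (oddIdx i))
  map_update_add' := by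
    intro hd v j x y
    obtain rfl : hd = instDecidableEqFin _ := Subsingleton.elim _ _
    obtain ⟨l, hl⟩ := prod_update_eq (toBilin Ω) v j
    rw [hl, hl, hl, map_add]
  map_update_smul' := by
    intro hd v j c x
    obtain rfl : hd = instDecidableEqFin _ := Subsingleton.elim _ _
    obtain ⟨l, hl⟩ := prod_update_eq (toBilin Ω) v j
    rw [hl, hl, map_smul]

/-- The wedge power as an alternating map. -/
def wedgePowAlt (r : ℕ) (Ω : V [⋀^Fin 2]→L[ℝ] ℝ) : V [⋀^Fin (2 * r)]→ₗ[ℝ] ℝ :=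
  (2 ^ r : ℝ)⁻¹ • (MultilinearMap.alternatization (pairProd r Ω))

theorem wedgePow_eq_sum (r : ℕ) (Ω : V [⋀^Fin 2]→L[ℝ] ℝ) (v : Fin (2 * r) → V) :
    wedgePow r Ω v = (2 ^ r : ℝ)⁻¹ * ∑ σ : Equiv.Perm (Fin (2 * r)),
      ((Equiv.Perm.sign σ : ℤ) : ℝ) *
        ∏ i : Fin r, toBilin Ω (v (σ (evenIdx i))) (v (σ (oddIdx i))) := rfl

theorem wedgePowAlt_apply (r : ℕ) (Ω : V [⋀^Fin 2]→L[ℝ] ℝ) (v : Fin (2 * r) → V) :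
    wedgePowAlt r Ω v = wedgePow r Ω v := by
  rw [wedgePow_eq_sum, wedgePowAlt, AlternatingMap.smul_apply,
    MultilinearMap.alternatization_apply, smul_eq_mul]
  congr 1
  refine Finset.sum_congr rfl fun σ _ => ?_
  change Equiv.Perm.sign σ • (MultilinearMap.domDomCongr σ (pairProd r Ω)) v = _
  rw [Units.smul_def, zsmul_eq_mul]
  rfl

theorem wedgePow_comp {W : Type*} [AddCommGroup W] [Module ℝ W] [TopologicalSpace W] (r : ℕ)
    (Ω : V [⋀^Fin 2]→L[ℝ] ℝ) (A : W →L[ℝ] V) (v : Fin (2 * r) → W) :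
    wedgePow r (Ω.compContinuousLinearMap A) v = wedgePow r Ω (fun i => A (v i)) := by
  rw [wedgePow_eq_sum, wedgePow_eq_sum]
  congr 1
  refine Finset.sum_congr rfl fun σ _ => ?_
  congr 1
  refine Finset.prod_congr rfl fun i _ => ?_
  rw [toBilin_apply, toBilin_apply, ContinuousAlternatingMap.compContinuousLinearMap_apply]
  congr 1
  funext k
  fin_cases k <;> rfl

/-- Alternating maps of top degree form a line spanned by the determinant. -/
theorem wedgePow_eq_det_mul {r : ℕ} (e : Module.Basis (Fin (2 * r)) ℝ V)
    (Ω : V [⋀^Fin 2]→L[ℝ] ℝ) (v : Fin (2 * r) → V) :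
    wedgePow r Ω v = wedgePow r Ω e * e.det v := by
  rw [← wedgePowAlt_apply, ← wedgePowAlt_apply, AlternatingMap.eq_smul_basis_det e (wedgePowAlt r Ω),
    AlternatingMap.smul_apply, smul_eq_mul, AlternatingMap.smul_apply, Module.Basis.det_self]
  simp

theorem wedgePow_basis_comp {r : ℕ} (e : Module.Basis (Fin (2 * r)) ℝ V)
    (Ω : V [⋀^Fin 2]→L[ℝ] ℝ) (A : V →L[ℝ] V) :
    wedgePow r (Ω.compContinuousLinearMap A) e = LinearMap.det (A : V →ₗ[ℝ] V) * wedgePow r Ω e := by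
  rw [wedgePow_comp, wedgePow_eq_det_mul e, mul_comm]
  congr 1
  have := e.det_comp (A : V →ₗ[ℝ] V) e
  rw [e.det_self, mul_one] at this
  exact this

end WedgePow

/-! ### Symplectic families and nonvanishing of top powers -/

section Symplectic

/-- A permutation of `Fin r × Fin 2` that respects the pairs has the sign of its action inside
the pairs. -/
theorem sign_eq_prod_of_fst_eq {r : ℕ} (σ : Equiv.Perm (Fin r × Fin 2))
    (h : ∀ i, (σ (i, 0)).1 = (σ (i, 1)).1) :
    ((Equiv.Perm.sign σ : ℤ) : ℝ) =
      ∏ i : Fin r, if (σ (i, 0)).2 = 0 ∧ (σ (i, 1)).2 = 1 then (1 : ℝ) else -1 := by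
  have h' : ∀ i a, (σ (i, a)).1 = (σ (i, 0)).1 := by
    intro i a
    fin_cases a
    · rfl
    · exact (h i).symm
  let ρ₀ : Fin r → Fin r := fun i => (σ (i, 0)).1
  have hρ : Function.Surjective ρ₀ := by
    intro j
    refine ⟨(σ.symm (j, 0)).1, ?_⟩
    change (σ ((σ.symm (j, 0)).1, 0)).1 = j
    rw [← h' _ (σ.symm (j, 0)).2]
    simp
  let ρ : Equiv.Perm (Fin r) := Equiv.ofBijective ρ₀ (Finite.surjective_iff_bijective.1 hρ)
  have hf : ∀ i, Function.Injective fun a => (σ (i, a)).2 := by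
    intro i a b hab
    have : σ (i, a) = σ (i, b) := Prod.ext ((h' i a).trans (h' i b).symm) hab
    simpa using σ.injective this
  let f : Fin r → Equiv.Perm (Fin 2) := fun i =>
    Equiv.ofBijective _ (Finite.injective_iff_bijective.1 (hf i))
  have hσ : σ = (Equiv.prodCongrLeft fun _ : Fin 2 => ρ) * Equiv.prodCongrRight f := by
    ext1 ⟨i, a⟩
    exact Prod.ext (h' i a) rfl
  have hsign : Equiv.Perm.sign σ = ∏ i, Equiv.Perm.sign (f i) := by
    rw [hσ, Equiv.Perm.sign_mul, Equiv.Perm.sign_prodCongrLeft, Equiv.Perm.sign_prodCongrRight]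
    simp
  have hfi : ∀ g : Equiv.Perm (Fin 2), (Equiv.Perm.sign g : ℤ) =
      if g 0 = 0 ∧ g 1 = 1 then 1 else -1 := by decide
  rw [hsign]
  push_cast
  refine Finset.prod_congr rfl fun i _ => ?_
  rw [hfi (f i)]
  change (((if (σ (i, 0)).2 = 0 ∧ (σ (i, 1)).2 = 1 then 1 else -1 : ℤ)) : ℝ) = _
  split_ifs <;> simp

/-- The pairing of indices `(i, a) ↦ 2 i + a`. -/
def pairEquiv (r : ℕ) : Fin r × Fin 2 ≃ Fin (2 * r) :=
  finProdFinEquiv.trans (finCongr (mul_comm r 2))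

theorem pairEquiv_zero {r : ℕ} (i : Fin r) : pairEquiv r (i, 0) = evenIdx i := by
  simp [pairEquiv, evenIdx, Fin.ext_iff]

theorem pairEquiv_one {r : ℕ} (i : Fin r) : pairEquiv r (i, 1) = oddIdx i := by
  simp [pairEquiv, oddIdx, Fin.ext_iff, add_comm]

variable {V : Type*} [AddCommGroup V] [Module ℝ V]

/-- A family of pairs of vectors that is symplectic for `B`. -/
structure IsSymplecticFamily {r : ℕ} (B : V →ₗ[ℝ] V →ₗ[ℝ] ℝ) (w : Fin r × Fin 2 → V) : Prop where
  pair : ∀ i, B (w (i, 0)) (w (i, 1)) = 1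
  ortho : ∀ s t, s.1 ≠ t.1 → B (w s) (w t) = 0

/-- Orthogonality kills every permutation that does not carry pairs to pairs. For the others the
sign is the product of the flips inside the pairs, which cancels the signs of the factors, so every
term is nonnegative. The identity contributes 1. -/
theorem wedgePow_pos_of_isSymplecticFamily [TopologicalSpace V] {r : ℕ} {Ω : V [⋀^Fin 2]→L[ℝ] ℝ}
    {w : Fin r × Fin 2 → V} (hw : IsSymplecticFamily (toBilin Ω) w) :
    0 < wedgePow r Ω (w ∘ (pairEquiv r).symm) := by
  have hterm : ∀ σ : Equiv.Perm (Fin r × Fin 2),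
      0 ≤ ((Equiv.Perm.sign σ : ℤ) : ℝ) *
        ∏ i, toBilin Ω (w (σ (i, 0))) (w (σ (i, 1))) := by
    intro σ
    by_cases h : ∀ i, (σ (i, 0)).1 = (σ (i, 1)).1
    · rw [sign_eq_prod_of_fst_eq σ h, ← Finset.prod_mul_distrib]
      refine Finset.prod_nonneg fun i _ => ?_
      have hne : σ (i, 0) ≠ σ (i, 1) := fun he => by simpa using σ.injective he
      generalize hs : σ (i, 0) = s at *
      generalize ht : σ (i, 1) = t at *
      obtain ⟨a, b⟩ := s
      obtain ⟨a', b'⟩ := t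
      have haa : a = a' := by have := h i; rwa [hs, ht] at this
      subst haa
      have hp := hw.pair a
      have hp' : toBilin Ω (w (a, 1)) (w (a, 0)) = -1 := by
        rw [← hp, (isAlt_toBilin Ω).neg]
      fin_cases b <;> fin_cases b' <;> simp_all
    · push Not at h
      obtain ⟨i, hi⟩ := h
      rw [Finset.prod_eq_zero (Finset.mem_univ i) (hw.ortho _ _ hi), mul_zero]
  rw [wedgePow_eq_sum]
  refine mul_pos (by positivity) ?_
  have hsum : ∑ σ : Equiv.Perm (Fin (2 * r)), ((Equiv.Perm.sign σ : ℤ) : ℝ) *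
      ∏ i : Fin r, toBilin Ω ((w ∘ (pairEquiv r).symm) (σ (evenIdx i)))
        ((w ∘ (pairEquiv r).symm) (σ (oddIdx i))) =
      ∑ σ : Equiv.Perm (Fin r × Fin 2), ((Equiv.Perm.sign σ : ℤ) : ℝ) *
        ∏ i, toBilin Ω (w (σ (i, 0))) (w (σ (i, 1))) := by
    symm
    refine Fintype.sum_equiv (pairEquiv r).permCongr _ _ fun σ => ?_
    rw [Equiv.Perm.sign_permCongr]
    congr 1
    refine Finset.prod_congr rfl fun i _ => ?_
    simp [← pairEquiv_zero, ← pairEquiv_one, Equiv.permCongr_apply]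
  rw [hsum]
  refine Finset.sum_pos' (fun σ _ => hterm σ) ⟨1, Finset.mem_univ _, ?_⟩
  simp [hw.pair]

/-- The symplectic complement, inside a symplectic subspace `W`, of a pair of vectors of `W`. -/
theorem exists_symplectic_complement (B : V →ₗ[ℝ] V →ₗ[ℝ] ℝ) (hB : B.IsAlt) {W : Submodule ℝ V}
    (hW : FiniteDimensional ℝ W) (hnd : ∀ u ∈ W, (∀ u' ∈ W, B u u' = 0) → u = 0) {w w' : V}
    (hw : w ∈ W) (hw' : w' ∈ W) (hww : B w w' = 1) :
    ∃ W' : Submodule ℝ V, W' ≤ W ∧ FiniteDimensional ℝ W' ∧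
      Module.finrank ℝ W' + 2 = Module.finrank ℝ W ∧
      (∀ u ∈ W', B w u = 0 ∧ B w' u = 0) ∧ (∀ u ∈ W', (∀ u' ∈ W', B u u' = 0) → u = 0) := by
  -- The complement is the kernel of this map, of codimension two in `W` because `Φ` is already onto
  -- on the span of `w` and `w'`.
  let Φ : W →ₗ[ℝ] ℝ × ℝ := ((B w).prod (B w')).comp W.subtype
  have hΦ : ∀ u : W, Φ u = (B w u, B w' u) := fun u => rfl
  have hw'w : B w' w = -1 := by rw [← hww, hB.neg]
  have hsurj : Function.Surjective Φ := by
    intro ⟨s, t⟩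
    refine ⟨⟨s • w' - t • w, W.sub_mem (W.smul_mem _ hw') (W.smul_mem _ hw)⟩, ?_⟩
    rw [hΦ]
    simp [hww, hw'w, hB.self_eq_zero]
  have hmem : ∀ u, u ∈ (LinearMap.ker Φ).map W.subtype ↔ u ∈ W ∧ B w u = 0 ∧ B w' u = 0 := by
    intro u
    simp only [Submodule.mem_map, LinearMap.mem_ker, hΦ, Prod.mk_eq_zero, Submodule.subtype_apply,
      Subtype.exists, exists_and_right, exists_eq_right]
    exact ⟨fun ⟨⟨h1, h2⟩, h3⟩ => ⟨h1, h2, h3⟩, fun ⟨h1, h2, h3⟩ => ⟨⟨h1, h2⟩, h3⟩⟩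
  refine ⟨(LinearMap.ker Φ).map W.subtype, Submodule.map_subtype_le _ _, inferInstance, ?_,
    fun u hu => ((hmem u).1 hu).2, fun u hu h => ?_⟩
  · have h1 := Φ.finrank_range_add_finrank_ker
    rw [LinearMap.range_eq_top.2 hsurj, finrank_top, Module.finrank_prod, Module.finrank_self] at h1
    rw [Submodule.finrank_map_subtype_eq]
    omega
  · obtain ⟨huW, hu1, hu2⟩ := (hmem u).1 hu
    refine hnd u huW fun t ht => ?_
    -- Removing from `t` its component in the hyperbolic plane lands in the complement; that
    -- component does not pair with `u`.
    have ht' : t - (B w t • w' - B w' t • w) ∈ (LinearMap.ker Φ).map W.subtype := by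
      rw [hmem]
      refine ⟨W.sub_mem ht (W.sub_mem (W.smul_mem _ hw') (W.smul_mem _ hw)), ?_, ?_⟩ <;>
        simp [hww, hw'w, hB.self_eq_zero]
    have h0 := h _ ht'
    have e1 : B u w = 0 := by rw [← hB.neg, hu1, neg_zero]
    have e2 : B u w' = 0 := by rw [← hB.neg, hu2, neg_zero]
    simpa [e1, e2] using h0

/-- A nondegenerate alternating form on a `2r`-dimensional subspace has a symplectic basis. -/
theorem exists_isSymplecticFamily (B : V →ₗ[ℝ] V →ₗ[ℝ] ℝ) (hB : B.IsAlt) (r : ℕ) :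
    ∀ W : Submodule ℝ V, FiniteDimensional ℝ W → Module.finrank ℝ W = 2 * r →
      (∀ u ∈ W, (∀ u' ∈ W, B u u' = 0) → u = 0) →
      ∃ w : Fin r × Fin 2 → V, IsSymplecticFamily B w ∧ ∀ s, w s ∈ W := by
  induction r with
  | zero =>
    intro W _ _ _
    exact ⟨fun s => s.1.elim0, ⟨fun i => i.elim0, fun s => s.1.elim0⟩, fun s => s.1.elim0⟩
  | succ r ih =>
    intro W _ hd hnd
    have : Nontrivial W := Module.nontrivial_of_finrank_pos (R := ℝ) (by omega)
    obtain ⟨⟨w, hw⟩, hw0⟩ := exists_ne (0 : W)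
    have hw0' : w ≠ 0 := fun h => hw0 (Subtype.ext h)
    obtain ⟨t, ht, htn⟩ : ∃ t ∈ W, B w t ≠ 0 := by
      by_contra! hcon
      exact hw0' (hnd w hw hcon)
    have hww : B w ((B w t)⁻¹ • t) = 1 := by simp [htn]
    obtain ⟨W', hW'le, hW'f, hW'd, hW'o, hW'n⟩ :=
      exists_symplectic_complement B hB ‹_› hnd hw (W.smul_mem _ ht) hww
    obtain ⟨f, hf, hfW⟩ := ih W' hW'f (by omega) hW'n
    set w' := (B w t)⁻¹ • t
    refine ⟨fun s => Fin.cases (if s.2 = 0 then w else w') (fun i => f (i, s.2)) s.1,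
      ⟨fun i => ?_, fun s t hst => ?_⟩, fun s => ?_⟩
    · induction i using Fin.cases with
      | zero => simpa using hww
      | succ i => simpa using hf.pair i
    · obtain ⟨i, a⟩ := s
      obtain ⟨j, b⟩ := t
      have o1 : ∀ s (a : Fin 2), B (if a = 0 then w else w') (f s) = 0 := by
        intro s a
        split_ifs
        · exact (hW'o _ (hfW s)).1
        · exact (hW'o _ (hfW s)).2
      induction i using Fin.cases with
      | zero =>
        induction j using Fin.cases with
        | zero => exact absurd rfl hst
        | succ j => simpa using o1 _ a
      | succ i =>
        induction j using Fin.cases with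
        | zero =>
          have := o1 (i, a) b
          rw [← hB.neg, neg_eq_zero] at this
          simpa using this
        | succ j =>
          refine hf.ortho (i, a) (j, b) fun h => hst ?_
          exact congrArg Fin.succ h
    · obtain ⟨i, a⟩ := s
      induction i using Fin.cases with
      | zero =>
        change (if a = 0 then w else w') ∈ W
        split_ifs
        · exact hw
        · exact W.smul_mem _ ht
      | succ i => exact hW'le (hfW _)

/-- The top wedge power of a nondegenerate two-form does not vanish. -/
theorem wedgePow_ne_zero_of_nondegenerate [TopologicalSpace V] {r : ℕ}
    (e : Module.Basis (Fin (2 * r)) ℝ V) {Ω : V [⋀^Fin 2]→L[ℝ] ℝ}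
    (h : ∀ u, (∀ u', Ω ![u, u'] = 0) → u = 0) : wedgePow r Ω e ≠ 0 := by
  have : FiniteDimensional ℝ V := e.finiteDimensional_of_finite
  obtain ⟨w, hw, -⟩ := exists_isSymplecticFamily (toBilin Ω) (isAlt_toBilin Ω) r ⊤ inferInstance
    (by rw [finrank_top, Module.finrank_eq_card_basis e, Fintype.card_fin])
    (fun u _ hu => h u fun u' => hu u' trivial)
  have h1 := (wedgePow_pos_of_isSymplecticFamily hw).ne'
  rw [wedgePow_eq_det_mul e] at h1
  exact left_ne_zero_of_mul h1

end Symplectic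

/-! ### The top power of θ ∧ a + b as a function of a -/

section Affine

variable {V : Type*} [AddCommGroup V] [Module ℝ V]

/-- A vector `v₀` with `θ v₀ = 1` is completed to a basis by vectors of `ker θ`. -/
theorem exists_basis_adapted {N : ℕ} (e : Module.Basis (Fin N) ℝ V) (θ : V →ₗ[ℝ] ℝ) {v₀ : V}
    (h : θ v₀ = 1) : ∃ (e' : Module.Basis (Fin N) ℝ V) (i₀ : Fin N),
      e' i₀ = v₀ ∧ ∀ j, j ≠ i₀ → θ (e' j) = 0 := by
  have : FiniteDimensional ℝ V := e.finiteDimensional_of_finite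
  let K := LinearMap.ker θ
  have hN : Module.finrank ℝ V = N := by
    rw [Module.finrank_eq_card_basis e, Fintype.card_fin]
  have hK : Module.finrank ℝ K + 1 = N := by
    have h1 := θ.finrank_range_add_finrank_ker
    have hs : Function.Surjective θ := fun t => ⟨t • v₀, by simp [h]⟩
    change _ + Module.finrank ℝ K = _ at h1
    rw [LinearMap.range_eq_top.2 hs, finrank_top, Module.finrank_self] at h1
    omega
  let bK := Module.finBasis ℝ K
  let E₁ := Module.Basis.mkFinCons v₀ bK
    (fun c x hx hc => by
      have := congrArg θ hc
      rw [map_add, map_smul, h, LinearMap.mem_ker.1 hx] at this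
      simpa using this)
    (fun z => ⟨-θ z, by
      change θ (z + -θ z • v₀) = 0
      simp [h]⟩)
  have h0 : E₁ 0 = v₀ := by simp [E₁]
  have hs : ∀ i, θ (E₁ (Fin.succ i)) = 0 := by
    intro i
    have : E₁ (Fin.succ i) = bK i := by simp [E₁]
    rw [this]
    exact LinearMap.mem_ker.1 (bK i).2
  refine ⟨E₁.reindex (finCongr hK), finCongr hK 0, ?_, fun j hj => ?_⟩
  · simp [h0]
  · rw [Module.Basis.reindex_apply]
    have : (finCongr hK).symm j ≠ 0 := fun h' => hj (by rw [← h']; simp)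
    obtain ⟨i, hi⟩ := Fin.exists_succ_eq.2 this
    rw [← hi]
    exact hs i

variable [TopologicalSpace V]

theorem toBilin_wedge_add (θ : V →L[ℝ] ℝ) (a : V [⋀^Fin 1]→L[ℝ] ℝ) (b : V [⋀^Fin 2]→L[ℝ] ℝ)
    (u v : V) : toBilin (wedge θ a + b) u v = (θ u * a ![v] - θ v * a ![u]) + toBilin b u v := by
  rw [← wedge_apply]
  rfl

/-- The pair of indices that a permutation sends onto a pair containing `i₀`. -/
theorem exists_pair_of_perm {r : ℕ} (σ : Equiv.Perm (Fin (2 * r))) (i₀ : Fin (2 * r)) :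
    ∃ i₁ : Fin r, (σ (evenIdx i₁) = i₀ ∨ σ (oddIdx i₁) = i₀) ∧
      ∀ i, i ≠ i₁ → σ (evenIdx i) ≠ i₀ ∧ σ (oddIdx i) ≠ i₀ := by
  obtain ⟨i₁, hi₁⟩ := evenIdx_or_oddIdx (σ.symm i₀)
  refine ⟨i₁, ?_, fun i hi => ⟨fun h => hi ?_, fun h => hi ?_⟩⟩
  · rcases hi₁ with h | h
    · left; rw [← h]; simp
    · right; rw [← h]; simp
  · rw [← h, Equiv.symm_apply_apply] at hi₁
    rcases hi₁ with h' | h'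
    · exact evenIdx_injective h'
    · exact absurd h' (evenIdx_ne_oddIdx _ _)
  · rw [← h, Equiv.symm_apply_apply] at hi₁
    rcases hi₁ with h' | h'
    · exact absurd h'.symm (evenIdx_ne_oddIdx _ _)
    · exact oddIdx_injective h'

/-- The top wedge power of `θ ∧ a + b` is an affine function of `a`. -/
theorem wedgePow_wedge_add_affine {r : ℕ} (e : Module.Basis (Fin (2 * r)) ℝ V) (θ : V →L[ℝ] ℝ)
    {v₀ : V} (hθ : θ v₀ = 1) (b : V [⋀^Fin 2]→L[ℝ] ℝ) (a a₁ a₂ : V [⋀^Fin 1]→L[ℝ] ℝ) (s t : ℝ)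
    (ha : ∀ v, a v = s * a₁ v + t * a₂ v) :
    wedgePow r (wedge θ a + b) e = s * wedgePow r (wedge θ a₁ + b) e +
      t * wedgePow r (wedge θ a₂ + b) e + (1 - s - t) * wedgePow r b e := by
  obtain ⟨e', i₀, -, he'⟩ := exists_basis_adapted e (θ : V →ₗ[ℝ] ℝ) hθ
  have he'' : ∀ j, j ≠ i₀ → θ (e' j) = 0 := he'
  suffices h : wedgePow r (wedge θ a + b) e' = s * wedgePow r (wedge θ a₁ + b) e' +
      t * wedgePow r (wedge θ a₂ + b) e' + (1 - s - t) * wedgePow r b e' by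
    rw [wedgePow_eq_det_mul e' _ e, wedgePow_eq_det_mul e' _ e, wedgePow_eq_det_mul e' _ e,
      wedgePow_eq_det_mul e' _ e, h]
    ring
  -- All basis vectors but the one at `i₀` lie in ker θ, so only the factor whose pair contains `i₀`
  -- depends on `a`, and it does so affinely.
  have hterm : ∀ σ : Equiv.Perm (Fin (2 * r)),
      ∏ i : Fin r, toBilin (wedge θ a + b) (e' (σ (evenIdx i))) (e' (σ (oddIdx i))) =
      s * ∏ i : Fin r, toBilin (wedge θ a₁ + b) (e' (σ (evenIdx i))) (e' (σ (oddIdx i))) +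
      t * ∏ i : Fin r, toBilin (wedge θ a₂ + b) (e' (σ (evenIdx i))) (e' (σ (oddIdx i))) +
      (1 - s - t) * ∏ i : Fin r, toBilin b (e' (σ (evenIdx i))) (e' (σ (oddIdx i))) := by
    intro σ
    obtain ⟨i₁, -, hi₁⟩ := exists_pair_of_perm σ i₀
    have hc : ∀ a : V [⋀^Fin 1]→L[ℝ] ℝ, ∏ i ∈ Finset.univ.erase i₁,
        toBilin (wedge θ a + b) (e' (σ (evenIdx i))) (e' (σ (oddIdx i))) =
        ∏ i ∈ Finset.univ.erase i₁, toBilin b (e' (σ (evenIdx i))) (e' (σ (oddIdx i))) := by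
      intro a
      refine Finset.prod_congr rfl fun i hi => ?_
      obtain ⟨h1, h2⟩ := hi₁ i (Finset.ne_of_mem_erase hi)
      rw [toBilin_wedge_add, he'' _ h1, he'' _ h2]
      ring
    simp only [← Finset.mul_prod_erase Finset.univ _ (Finset.mem_univ i₁), hc]
    simp only [toBilin_wedge_add, ha]
    ring
  simp only [wedgePow_eq_sum, hterm, Finset.mul_sum, ← Finset.sum_add_distrib]
  exact Finset.sum_congr rfl fun σ _ => by ring

/-- In a basis containing `v₀`, each product in the sum has a factor with `v₀` in one slot. The
functional `θ` only serves to complete `v₀` to a basis. -/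
theorem wedgePow_eq_zero_of_kernel {r : ℕ} (e : Module.Basis (Fin (2 * r)) ℝ V) (θ : V →L[ℝ] ℝ)
    {v₀ : V} (hθ : θ v₀ = 1) (b : V [⋀^Fin 2]→L[ℝ] ℝ) (hb : ∀ u, b ![v₀, u] = 0) :
    wedgePow r b e = 0 := by
  obtain ⟨e', i₀, hi₀, he'⟩ := exists_basis_adapted e (θ : V →ₗ[ℝ] ℝ) hθ
  rw [wedgePow_eq_det_mul e', wedgePow_eq_sum]
  have h1 : ∀ u, toBilin b v₀ u = 0 := hb
  have h2 : ∀ u, toBilin b u v₀ = 0 := fun u => by rw [← (isAlt_toBilin b).neg, h1, neg_zero]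
  rw [Finset.sum_eq_zero, mul_zero, zero_mul]
  intro σ _
  obtain ⟨i₁, h, -⟩ := exists_pair_of_perm σ i₀
  rw [Finset.prod_eq_zero (Finset.mem_univ i₁), mul_zero]
  rcases h with h | h
  · rw [h, hi₀, h1]
  · rw [h, hi₀, h2]

/-- The form `(c, u) ↦ c ∧ a + b` on `ℝ × ker θ` is nondegenerate. -/
def BNondegenerate (θ : V →L[ℝ] ℝ) (a : V [⋀^Fin 1]→L[ℝ] ℝ) (b : V [⋀^Fin 2]→L[ℝ] ℝ) : Prop :=
  ∀ u c, θ u = 0 → (∀ u' c', θ u' = 0 → (c * a ![u'] - c' * a ![u]) + b ![u, u'] = 0) →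
    u = 0 ∧ c = 0

theorem apply_vec_add (a : V [⋀^Fin 1]→L[ℝ] ℝ) (u v : V) : a ![u + v] = a ![u] + a ![v] := by
  have h := a.map_update_add ![u] 0 u v
  have e : ∀ x, Function.update ![u] 0 x = ![x] := fun x => by ext i; fin_cases i; rfl
  rwa [e, e, e] at h

theorem apply_vec_smul (a : V [⋀^Fin 1]→L[ℝ] ℝ) (c : ℝ) (u : V) : a ![c • u] = c * a ![u] := by
  have h := a.map_update_smul ![u] 0 c u
  have e : ∀ x, Function.update ![u] 0 x = ![x] := fun x => by ext i; fin_cases i; rfl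
  rwa [e, e] at h

end Affine

/-! ### Linear consequences of maximal rank on the hypersurface -/

section BNondegenerate

variable {V : Type*} [NormedAddCommGroup V] [NormedSpace ℝ V] {θ : V →L[ℝ] ℝ}
  {a : V [⋀^Fin 1]→L[ℝ] ℝ} {b : V [⋀^Fin 2]→L[ℝ] ℝ}

/-- The difference is the coefficient μ of θ ∧ a ∧ bʳ⁻¹. With P the projection onto ker θ along v₀,
write b = θ ∧ c + b', where c contracts b with v₀ and b' = P*b. Since b'ʳ = 0, affinity reduces the
difference to (θ ∧ a + b')ʳ. The isomorphism w ↦ (P w, θ w) of V with ker θ × ℝ identifies θ ∧ a +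
b' with the form assumed nondegenerate. -/
theorem BNondegenerate.wedgePow_sub_ne_zero {r : ℕ}
    (e : Module.Basis (Fin (2 * r)) ℝ V) {v₀ : V} (hθ : θ v₀ = 1) (h : BNondegenerate θ a b) :
    wedgePow r (wedge θ a + b) e - wedgePow r b e ≠ 0 := by
  let P : V →L[ℝ] V := ContinuousLinearMap.id ℝ V - θ.smulRight v₀
  have hP : ∀ u, P u = u - θ u • v₀ := fun u => rfl
  have hθP : ∀ u, θ (P u) = 0 := fun u => by simp [hP, hθ]
  let b' := b.compContinuousLinearMap P
  have hb' : ∀ u v, toBilin b' u v = toBilin b (P u) (P v) := by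
    intro u v
    change b (P ∘ ![u, v]) = b ![P u, P v]
    congr 1
    ext i; fin_cases i <;> rfl
  let c : V [⋀^Fin 1]→L[ℝ] ℝ := b.curryLeft v₀
  have hc : ∀ u, c ![u] = toBilin b v₀ u := fun u => rfl
  have hext : ∀ {Ω Ω' : V [⋀^Fin 2]→L[ℝ] ℝ}, (∀ u v, toBilin Ω u v = toBilin Ω' u v) → Ω = Ω' := by
    intro Ω Ω' hΩ
    ext w
    have : w = ![w 0, w 1] := by ext i; fin_cases i <;> rfl
    rw [this]
    exact hΩ _ _
  have hbc : b = wedge θ c + b' := by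
    refine hext fun u v => ?_
    rw [toBilin_wedge_add, hb', hc, hc, hP, hP]
    have e1 : toBilin b u v₀ = - toBilin b v₀ u := ((isAlt_toBilin b).neg _ _).symm
    simp only [map_sub, map_smul, LinearMap.sub_apply, LinearMap.smul_apply, smul_eq_mul, e1,
      toBilin_self]
    ring
  have hac : wedge θ a + b = wedge θ (a + c) + b' := by
    refine hext fun u v => ?_
    rw [toBilin_wedge_add, toBilin_wedge_add, hbc, toBilin_wedge_add]
    simp only [ContinuousAlternatingMap.add_apply]
    ring
  have h0 : wedgePow r b' e = 0 := by
    refine wedgePow_eq_zero_of_kernel e θ hθ b' fun u => ?_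
    have : P v₀ = 0 := by simp [hP, hθ]
    rw [← toBilin_apply, hb', this, map_zero, LinearMap.zero_apply]
  have hne : wedgePow r (wedge θ a + b') e ≠ 0 := by
    refine wedgePow_ne_zero_of_nondegenerate e fun w hw => ?_
    obtain ⟨h1, h2⟩ := h (P w) (θ w) (hθP w) fun u' c' hu' => by
      have h3 := hw (u' + c' • v₀)
      have hPu : P (u' + c' • v₀) = u' := by simp [hP, hθ, hu']
      have hw' : w = P w + θ w • v₀ := by simp [hP]
      have hθu : θ (u' + c' • v₀) = c' := by simp [hθ, hu']
      rw [← toBilin_apply, toBilin_wedge_add, hb', hPu, hθu, apply_vec_add, apply_vec_smul] at h3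
      have h4 : a ![w] = a ![P w] + θ w * a ![v₀] := by
        conv_lhs => rw [hw', apply_vec_add, apply_vec_smul]
      rw [h4] at h3
      rw [← toBilin_apply]
      linarith
    have hw' : w = P w + θ w • v₀ := by simp [hP]
    rw [hw', h1, h2]
    simp
  have h1 := wedgePow_wedge_add_affine e θ hθ b' (a + c) a c 1 1 (fun v => by simp)
  rw [hac]
  conv in wedgePow r b e => rw [hbc]
  rw [h1, h0]
  simpa using hne

/-- Symplectic reduction along (0, 1), the vector xᵐ∂/∂x of the b-fibre: on the complement of a
hyperbolic plane containing it the functional `a` vanishes, so the symplectic form there is `b`, and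
a symplectic family of r - 1 pairs in it projects to ker θ. -/
theorem BNondegenerate.exists_wedgePow_ne_zero {r : ℕ}
    (e : Module.Basis (Fin (2 * r)) ℝ V) {v₀ : V} (hθ : θ v₀ = 1) (h : BNondegenerate θ a b) :
    ∃ u : Fin (2 * (r - 1)) → V, (∀ i, θ (u i) = 0) ∧ wedgePow (r - 1) b u ≠ 0 := by
  have : FiniteDimensional ℝ V := e.finiteDimensional_of_finite
  let T : Submodule ℝ (V × ℝ) := LinearMap.ker ((θ : V →ₗ[ℝ] ℝ).comp (LinearMap.fst ℝ V ℝ))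
  have hT : ∀ w, w ∈ T ↔ θ w.1 = 0 := fun w => LinearMap.mem_ker
  have hd : Module.finrank ℝ T = 2 * r := by
    have h1 := ((θ : V →ₗ[ℝ] ℝ).comp (LinearMap.fst ℝ V ℝ)).finrank_range_add_finrank_ker
    have hs : Function.Surjective ((θ : V →ₗ[ℝ] ℝ).comp (LinearMap.fst ℝ V ℝ)) :=
      fun t => ⟨(t • v₀, 0), by simp [hθ]⟩
    rw [LinearMap.range_eq_top.2 hs, finrank_top, Module.finrank_self, Module.finrank_prod,
      Module.finrank_self, Module.finrank_eq_card_basis e, Fintype.card_fin] at h1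
    change 1 + Module.finrank ℝ T = _ at h1
    omega
  let B : (V × ℝ) →ₗ[ℝ] (V × ℝ) →ₗ[ℝ] ℝ := LinearMap.mk₂ ℝ
    (fun w w' => (w.2 * a ![w'.1] - w'.2 * a ![w.1]) + toBilin b w.1 w'.1)
    (fun _ _ _ => by simp [apply_vec_add]; ring)
    (fun _ _ _ => by simp [apply_vec_smul]; ring)
    (fun _ _ _ => by simp [apply_vec_add]; ring)
    (fun _ _ _ => by simp [apply_vec_smul]; ring)
  have hB : ∀ w w', B w w' = (w.2 * a ![w'.1] - w'.2 * a ![w.1]) + toBilin b w.1 w'.1 :=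
    fun _ _ => rfl
  have hBalt : B.IsAlt := fun w => by rw [hB, toBilin_self]; ring
  have hnd : ∀ u ∈ T, (∀ u' ∈ T, B u u' = 0) → u = 0 := by
    intro u hu hu'
    obtain ⟨h1, h2⟩ := h u.1 u.2 ((hT u).1 hu) fun u' c' hu'' => hu' (u', c') ((hT _).2 hu'')
    exact Prod.ext h1 h2
  have hw0 : ((0, 1) : V × ℝ) ∈ T := by simp [hT]
  obtain ⟨t, ht, htn⟩ : ∃ t ∈ T, B (0, 1) t ≠ 0 := by
    by_contra! hcon
    simpa using hnd _ hw0 hcon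
  have hww : B (0, 1) ((B (0, 1) t)⁻¹ • t) = 1 := by rw [map_smul, smul_eq_mul, inv_mul_cancel₀ htn]
  obtain ⟨W', hW'le, hW'f, hW'd, hW'o, hW'n⟩ :=
    exists_symplectic_complement B hBalt inferInstance hnd hw0 (T.smul_mem _ ht) hww
  obtain ⟨f, hf, hfW⟩ := exists_isSymplecticFamily B hBalt (r - 1) W' hW'f (by omega) hW'n
  have ha : ∀ s, a ![(f s).1] = 0 := by
    intro s
    have h1 := (hW'o _ (hfW s)).1
    rw [hB] at h1
    have h2 : a ![(0 : V)] = 0 := by simpa using apply_vec_smul a 0 0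
    simpa [h2] using h1
  have hfam : IsSymplecticFamily (toBilin b) fun s => (f s).1 := by
    constructor
    · intro i
      have := hf.pair i
      rw [hB, ha, ha] at this
      simpa using this
    · intro s t hst
      have := hf.ortho s t hst
      rw [hB, ha, ha] at this
      simpa using this
  exact ⟨_, fun i => (hT _).1 (hW'le (hfW _)), (wedgePow_pos_of_isSymplecticFamily hfam).ne'⟩

end BNondegenerate

/-! ### Smooth dependence of wedge products and wedge powers -/

section SmoothWedge

variable {E F : Type*} [NormedAddCommGroup E] [NormedSpace ℝ E] [NormedAddCommGroup F]
  [NormedSpace ℝ F] [FiniteDimensional ℝ E] {n : WithTop ℕ∞}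

theorem eq_vec_two {α : Type*} (v : Fin 2 → α) : v = ![v 0, v 1] := by
  ext i; fin_cases i <;> rfl

theorem eq_vec_one {α : Type*} (v : Fin 1 → α) : v = ![v 0] := by
  ext i; fin_cases i; rfl

theorem _root_.ContDiffAt.alternating_apply_one {a : F → E [⋀^Fin 1]→L[ℝ] ℝ} {u : F → E} {y : F}
    (ha : ContDiffAt ℝ n a y) (hu : ContDiffAt ℝ n u y) :
    ContDiffAt ℝ n (fun y => a y ![u y]) y := by
  have := ha.alternating_apply (v := fun _ => u) (fun _ => hu)
  refine this.congr_of_eventuallyEq (Filter.Eventually.of_forall fun z => ?_)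
  exact congrArg (a z) ((eq_vec_one (fun _ : Fin 1 => u z)).symm)

theorem _root_.ContDiffAt.alternating_apply_two {b : F → E [⋀^Fin 2]→L[ℝ] ℝ} {u v : F → E} {y : F}
    (hb : ContDiffAt ℝ n b y) (hu : ContDiffAt ℝ n u y) (hv : ContDiffAt ℝ n v y) :
    ContDiffAt ℝ n (fun y => b y ![u y, v y]) y := by
  have := hb.alternating_apply (v := ![u, v]) (by
    intro i; fin_cases i
    · exact hu
    · exact hv)
  refine this.congr_of_eventuallyEq (Filter.Eventually.of_forall fun z => ?_)
  exact congrArg (b z) (eq_vec_two fun i => (![u, v] : Fin 2 → F → E) i z).symm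

theorem _root_.ContDiffAt.wedge {θ : F → E →L[ℝ] ℝ} {a : F → E [⋀^Fin 1]→L[ℝ] ℝ} {y : F}
    (hθ : ContDiffAt ℝ n θ y) (ha : ContDiffAt ℝ n a y) :
    ContDiffAt ℝ n (fun y => BSymp.wedge (θ y) (a y)) y := by
  refine contDiffAt_alternating_of_apply fun v => ?_
  have h : (fun y => BSymp.wedge (θ y) (a y) v) =
      fun y => θ y (v 0) * a y ![v 1] - θ y (v 1) * a y ![v 0] := by
    funext y
    conv_lhs => rw [eq_vec_two v]
    exact wedge_apply _ _ _ _
  rw [h]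
  exact ((hθ.clm_apply contDiffAt_const).mul (ha.alternating_apply_one contDiffAt_const)).sub
    ((hθ.clm_apply contDiffAt_const).mul (ha.alternating_apply_one contDiffAt_const))

theorem _root_.ContDiffAt.wedgePow {r : ℕ} {b : F → E [⋀^Fin 2]→L[ℝ] ℝ}
    {v : Fin (2 * r) → F → E} {y : F} (hb : ContDiffAt ℝ n b y) (hv : ∀ i, ContDiffAt ℝ n (v i) y) :
    ContDiffAt ℝ n (fun y => BSymp.wedgePow r (b y) fun i => v i y) y := by
  simp only [wedgePow_eq_sum, toBilin_apply]
  exact contDiffAt_const.mul (ContDiffAt.sum fun σ _ => contDiffAt_const.mul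
    (contDiffAt_prod fun i _ => hb.alternating_apply_two (hv _) (hv _)))

end SmoothWedge

/-! ### The fold condition on the model space -/

section Fold

variable {n : ℕ}

/-- The coefficient of the top power of a two-form on the model space. -/
def topPower (ζ : Model (2 * n) → (Model (2 * n)) [⋀^Fin 2]→L[ℝ] ℝ) (y : Model (2 * n)) : ℝ :=
  wedgePow n (ζ y) (EuclideanSpace.basisFun (Fin (2 * n)) ℝ)

/-- The fold condition for a two-form on the model space at a point. -/
def FoldAt (ζ : Model (2 * n) → (Model (2 * n)) [⋀^Fin 2]→L[ℝ] ℝ) (y : Model (2 * n)) : Prop :=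
  topPower ζ y = 0 → fderiv ℝ (topPower ζ) y ≠ 0 ∧ ∃ v : Fin (2 * (n - 1)) → Model (2 * n),
    (∀ i, fderiv ℝ (topPower ζ) y (v i) = 0) ∧ wedgePow (n - 1) (ζ y) v ≠ 0

theorem _root_.ContDiffAt.topPower {m : WithTop ℕ∞} {y : Model (2 * n)}
    {ζ : Model (2 * n) → (Model (2 * n)) [⋀^Fin 2]→L[ℝ] ℝ} (h : ContDiffAt ℝ m ζ y) :
    ContDiffAt ℝ m (topPower ζ) y :=
  h.wedgePow fun _ => contDiffAt_const

variable {ζ ζ' : Model (2 * n) → (Model (2 * n)) [⋀^Fin 2]→L[ℝ] ℝ} {y : Model (2 * n)}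

theorem FoldAt.congr (h : FoldAt ζ y) (he : ζ =ᶠ[𝓝 y] ζ') : FoldAt ζ' y := by
  have h1 : topPower ζ =ᶠ[𝓝 y] topPower ζ' := he.mono fun z hz => by unfold topPower; rw [hz]
  unfold FoldAt at *
  rwa [← h1.fderiv_eq, ← h1.eq_of_nhds, ← he.eq_of_nhds]

/-- The top coefficient is multiplied by the Jacobian determinant `D`. Where the coefficient
vanishes, the product rule leaves `D` times the pulled-back differential, so kernel vectors are
transported by the right inverse `A`, which also forces `D y ≠ 0`. -/
theorem FoldAt.pullback {g : Model (2 * n) → Model (2 * n)} (h : FoldAt ζ (g y))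
    (hζ : ContDiffAt ℝ 1 ζ (g y)) (hg : ContDiffAt ℝ 2 g y)
    {A : Model (2 * n) →L[ℝ] Model (2 * n)} (hA : ∀ v, fderiv ℝ g y (A v) = v) :
    FoldAt (fun z => (ζ (g z)).compContinuousLinearMap (fderiv ℝ g z)) y := by
  let e := (EuclideanSpace.basisFun (Fin (2 * n)) ℝ).toBasis
  have he : ⇑e = EuclideanSpace.basisFun (Fin (2 * n)) ℝ := OrthonormalBasis.coe_toBasis _
  let D : Model (2 * n) → ℝ := fun z => LinearMap.det (fderiv ℝ g z : Model (2 * n) →ₗ[ℝ] _)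
  have htop : topPower (fun z => (ζ (g z)).compContinuousLinearMap (fderiv ℝ g z)) =
      fun z => D z * topPower ζ (g z) := by
    funext z
    unfold topPower
    rw [← he]
    exact wedgePow_basis_comp e _ _
  have hD : D y ≠ 0 := by
    intro h0
    have h1 : (fderiv ℝ g y : Model (2 * n) →ₗ[ℝ] Model (2 * n)) ∘ₗ (A : _ →ₗ[ℝ] _) =
        LinearMap.id := LinearMap.ext hA
    have h2 := congrArg LinearMap.det h1
    rw [LinearMap.det_comp, LinearMap.det_id, show LinearMap.det (fderiv ℝ g y : Model (2 * n) →ₗ[ℝ]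
      Model (2 * n)) = 0 from h0, zero_mul] at h2
    exact zero_ne_one h2
  have hgd : DifferentiableAt ℝ g y := hg.differentiableAt (by simp)
  have hTd : DifferentiableAt ℝ (topPower ζ) (g y) := hζ.topPower.differentiableAt one_ne_zero
  have hDd : DifferentiableAt ℝ D y := by
    have h1 : ContDiffAt ℝ 1 (fderiv ℝ g) y := hg.fderiv_right (by norm_num)
    have h2 : D = fun z => e.det fun i => fderiv ℝ g z (e i) := by
      funext z
      have := e.det_comp (fderiv ℝ g z : Model (2 * n) →ₗ[ℝ] Model (2 * n)) e
      rw [e.det_self, mul_one] at this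
      exact this.symm
    rw [h2]
    simp only [Module.Basis.det_apply, Matrix.det_apply]
    have : ∀ i j, ContDiffAt ℝ 1 (fun z => e.toMatrix (fun i => fderiv ℝ g z (e i)) i j) y := by
      intro i j
      have h3 : (fun z => e.toMatrix (fun i => fderiv ℝ g z (e i)) i j) =
        fun z => LinearMap.toContinuousLinearMap (e.coord i) (fderiv ℝ g z (e j)) := rfl
      rw [h3]
      exact (ContinuousLinearMap.contDiff _).contDiffAt.comp y (h1.clm_apply contDiffAt_const)
    refine ContDiffAt.differentiableAt (n := 1) (ContDiffAt.sum fun σ _ => ?_) one_ne_zero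
    exact ContDiffAt.const_smul _ (contDiffAt_prod fun i _ => this _ _)
  intro h0
  rw [htop] at h0 ⊢
  have h0' : topPower ζ (g y) = 0 := (mul_eq_zero.1 h0).resolve_left hD
  have hfd : fderiv ℝ (fun z => D z * topPower ζ (g z)) y =
      D y • (fderiv ℝ (topPower ζ) (g y)).comp (fderiv ℝ g y) := by
    have h1 : DifferentiableAt ℝ (fun z => topPower ζ (g z)) y := hTd.comp y hgd
    rw [fderiv_fun_mul hDd h1, h0', zero_smul, add_zero]
    congr 1
    exact fderiv_comp y hTd hgd
  obtain ⟨h1, v, hv1, hv2⟩ := h h0'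
  rw [hfd]
  refine ⟨fun hz => h1 ?_, fun i => A (v i), fun i => ?_, ?_⟩
  · ext u
    have := congrArg (fun L : Model (2 * n) →L[ℝ] ℝ => L (A u)) hz
    simpa [hA, hD] using this
  · simp [hA, hv1]
  · rw [wedgePow_comp]
    simpa [hA] using hv2

end Fold

/-! ### Profile functions: derivative estimates and existence -/

section Profile

variable {k : ℕ} {f : ℝ → ℝ}

theorem IsProfile.differentiable (hf : IsProfile k f) : Differentiable ℝ f :=
  hf.smooth.differentiable (by simp)

theorem IsProfile.continuous_deriv (hf : IsProfile k f) : Continuous (deriv f) :=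
  hf.smooth.continuous_deriv (by simp)

theorem IsProfile.deriv_neg (hf : IsProfile k f) (s : ℝ) : deriv f (-s) = -deriv f s := by
  have h1 : (fun t => f (-t)) = f := funext hf.even
  have h2 := deriv_comp_neg f s
  rw [h1] at h2
  linarith

theorem IsProfile.deriv_inner (hf : IsProfile k f) {s : ℝ} (hs : |s| < 1) :
    deriv f s = 2 * s := by
  have h1 : f =ᶠ[𝓝 s] fun t => t ^ 2 - 2 :=
    (continuous_abs.continuousAt.eventually (gt_mem_nhds hs)).mono fun t ht => hf.eq_inner t ht.le
  rw [h1.deriv_eq]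
  simp

theorem IsProfile.deriv_outer_of_lt (hf : IsProfile k f) {s : ℝ} (hs : 2 < s) :
    deriv f s = (s ^ (2 * k + 1))⁻¹ := by
  have hs0 : s ≠ 0 := by linarith
  have hev : ∀ᶠ t in 𝓝 s, 2 < |t| := continuous_abs.continuousAt.eventually
    (lt_mem_nhds (by rwa [abs_of_pos (by linarith)]))
  rcases Nat.eq_zero_or_pos k with rfl | hk
  · have h1 : f =ᶠ[𝓝 s] Real.log := hev.mono fun t ht => by
      rw [hf.eq_outer_zero rfl t ht, Real.log_abs]
    rw [h1.deriv_eq]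
    simp
  · have h1 : f =ᶠ[𝓝 s] fun t => -1 / (2 * k * t ^ (2 * k)) :=
      hev.mono fun t ht => hf.eq_outer_pos hk t ht
    have hk0 : (k : ℝ) ≠ 0 := by positivity
    rw [h1.deriv_eq]
    have h2 : HasDerivAt (fun t : ℝ => 2 * k * t ^ (2 * k)) (2 * k * ((2 * k : ℕ) * s ^ (2 * k - 1))) s :=
      (hasDerivAt_pow (2 * k) s).const_mul _
    have h3 := (hasDerivAt_const s (-1 : ℝ)).div h2 (by positivity)
    refine h3.deriv.trans ?_
    obtain ⟨j, rfl⟩ : ∃ j, k = j + 1 := ⟨k - 1, by omega⟩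
    rw [show 2 * (j + 1) - 1 = 2 * j + 1 by omega]
    push_cast
    field_simp
    ring

/-- Continuity of `deriv f` includes the endpoint |s| = 2, which makes the form unchanged on the
closed region |x| ≥ 2ε. Negative arguments follow because both sides are odd. -/
theorem IsProfile.deriv_outer (hf : IsProfile k f) {s : ℝ} (hs : 2 ≤ |s|) :
    deriv f s = (s ^ (2 * k + 1))⁻¹ := by
  have hpos : ∀ s : ℝ, 2 ≤ s → deriv f s = (s ^ (2 * k + 1))⁻¹ := by
    intro s hs
    have h1 : s ∈ closure (Set.Ioi (2 : ℝ)) := by rwa [closure_Ioi]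
    refine Set.EqOn.of_subset_closure (s := Set.Ioi (2 : ℝ)) (t := Set.Ici 2)
      (f := deriv f) (g := fun s => (s ^ (2 * k + 1))⁻¹) (fun t ht => hf.deriv_outer_of_lt ht)
      hf.continuous_deriv.continuousOn ?_ Set.Ioi_subset_Ici_self (by rw [closure_Ioi]) hs
    refine ContinuousOn.inv₀ (by fun_prop) fun t (ht : 2 ≤ t) => pow_ne_zero _ (by linarith)
  rcases le_abs'.1 hs with h | h
  · have h1 := hpos (-s) (by linarith)
    rw [hf.deriv_neg, Odd.neg_pow ⟨k, rfl⟩, inv_neg] at h1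
    linarith
  · exact hpos s h

theorem IsProfile.contDiff_scaledProfile (hf : IsProfile k f) (ε : ℝ) :
    ContDiff ℝ ∞ (scaledProfile k f ε) :=
  contDiff_const.mul (hf.smooth.comp (contDiff_id.div_const ε))

theorem IsProfile.hasDerivAt_scaledProfile (hf : IsProfile k f) (ε t : ℝ) :
    HasDerivAt (scaledProfile k f ε) ((ε ^ (2 * k))⁻¹ * (deriv f (t / ε) * (1 / ε))) t := by
  have h1 : HasDerivAt f (deriv f (t / ε)) (t / ε) := (hf.differentiable _).hasDerivAt
  exact (h1.comp t ((hasDerivAt_id t).div_const ε)).const_mul _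

theorem IsProfile.deriv_scaledProfile_outer (hf : IsProfile k f) {ε t : ℝ} (hε : 0 < ε)
    (ht : 2 * ε ≤ |t|) : deriv (scaledProfile k f ε) t = (t ^ (2 * k + 1))⁻¹ := by
  have ht0 : t ≠ 0 := by
    rintro rfl
    rw [abs_zero] at ht
    linarith
  rw [(hf.hasDerivAt_scaledProfile ε t).deriv, hf.deriv_outer (by
    rw [abs_div, abs_of_pos hε, le_div_iff₀ hε]; exact ht), div_pow]
  field_simp
  ring

theorem IsProfile.deriv_scaledProfile_inner (hf : IsProfile k f) {ε t : ℝ} (hε : 0 < ε)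
    (ht : |t| < ε) : deriv (scaledProfile k f ε) t = 2 * (ε ^ (2 * k + 2))⁻¹ * t := by
  rw [(hf.hasDerivAt_scaledProfile ε t).deriv, hf.deriv_inner (by
    rw [abs_div, abs_of_pos hε, div_lt_one hε]; exact ht)]
  field_simp
  ring

/-- The derivative of the scaled profile is bounded at small arguments only inside `(-ε, ε)`. -/
theorem IsProfile.abs_lt_of_deriv_le (hf : IsProfile k f) (C : ℝ) :
    ∃ ρ > 0, ∀ t ε, |t| < ρ → 0 < ε → ε < ρ → |deriv (scaledProfile k f ε) t| ≤ C → |t| < ε := by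
  -- The minimum `c` of f' on [1, 2] controls the transition zone ε ≤ |t| ≤ 2ε.
  obtain ⟨s₀, hs₀, hmin⟩ := (isCompact_Icc (a := (1 : ℝ)) (b := 2)).exists_isMinOn
    ⟨1, by norm_num⟩ hf.continuous_deriv.continuousOn
  set c := deriv f s₀
  have hc : 0 < c := hf.deriv_pos s₀ (by linarith [hs₀.1])
  have habs : ∀ s, |deriv f s| = |deriv f (|s|)| := by
    intro s
    rcases abs_choice s with h | h
    · rw [h]
    · rw [h, hf.deriv_neg, abs_neg]
  have hC : 0 < |C| + 1 := by positivity
  -- The bound 1 lets powers of |t| and ε be dropped. The bound on ε makes |f_ε'| ≥ c/ε exceed |C| +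
  -- 1 in the transition zone, and the one on |t| makes |f_ε'| ≥ 1/|t| exceed it on |t| ≥ 2ε.
  refine ⟨min 1 (min (c / (|C| + 1)) (1 / (|C| + 1))), by positivity, fun t ε ht hε hερ hb => ?_⟩
  by_contra! hcon
  have ht1 : |t| < 1 := ht.trans_le (min_le_left _ _)
  have ht2 : |t| < 1 / (|C| + 1) := ht.trans_le ((min_le_right _ _).trans (min_le_right _ _))
  have hε1 : ε < 1 := hερ.trans_le (min_le_left _ _)
  have hε2 : ε < c / (|C| + 1) := hερ.trans_le ((min_le_right _ _).trans (min_le_left _ _))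
  have htpos : 0 < |t| := hε.trans_le hcon
  have hb' : |deriv (scaledProfile k f ε) t| < |C| + 1 := by linarith [le_abs_self C]
  by_cases h2 : 2 * ε ≤ |t|
  · rw [hf.deriv_scaledProfile_outer hε h2, abs_inv, abs_pow] at hb'
    have h3 : |t| ^ (2 * k + 1) ≤ |t| := by
      rw [pow_succ]
      exact mul_le_of_le_one_left htpos.le (pow_le_one₀ htpos.le ht1.le)
    have h4 : |t|⁻¹ ≤ (|t| ^ (2 * k + 1))⁻¹ := inv_anti₀ (by positivity) h3
    rw [lt_div_iff₀ hC] at ht2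
    have h5 : |t|⁻¹ < |C| + 1 := h4.trans_lt hb'
    rw [inv_lt_iff_one_lt_mul₀ htpos] at h5
    linarith
  · have hmem : |t / ε| ∈ Set.Icc (1 : ℝ) 2 := by
      rw [abs_div, abs_of_pos hε]
      exact ⟨(one_le_div hε).2 hcon, (div_le_iff₀ hε).2 (not_le.1 h2).le⟩
    have h3 : c ≤ |deriv f (t / ε)| := by
      rw [habs]
      exact (hmin hmem).trans (le_abs_self _)
    rw [(hf.hasDerivAt_scaledProfile ε t).deriv, abs_mul, abs_mul, abs_inv, abs_pow, abs_div,
      abs_one, abs_of_pos hε] at hb'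
    have h4 : 1 ≤ (ε ^ (2 * k))⁻¹ := (one_le_inv₀ (by positivity)).2 (pow_le_one₀ hε.le hε1.le)
    have h5 : c * (1 / ε) ≤ (ε ^ (2 * k))⁻¹ * (|deriv f (t / ε)| * (1 / ε)) :=
      (mul_le_mul_of_nonneg_right h3 (by positivity)).trans
        (le_mul_of_one_le_left (by positivity) h4)
    have h6 : c * (1 / ε) < |C| + 1 := h5.trans_lt hb'
    rw [mul_one_div, div_lt_iff₀ hε] at h6
    rw [lt_div_iff₀ hC] at hε2
    linarith

/-- The part of a profile function outside `[-2, 2]`. -/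
def outerProfile (k : ℕ) (t : ℝ) : ℝ :=
  if k = 0 then Real.log t else -1 / (2 * k * t ^ (2 * k))

theorem contDiffAt_outerProfile (k : ℕ) {t : ℝ} (ht : t ≠ 0) :
    ContDiffAt ℝ ∞ (outerProfile k) t := by
  unfold outerProfile
  split_ifs with hk
  · exact Real.contDiffAt_log.2 ht
  · have hk0 : (k : ℝ) ≠ 0 := by exact_mod_cast hk
    exact contDiffAt_const.div (contDiffAt_const.mul (contDiffAt_id.pow _)) (by positivity)

/-- A lower bound independent of k, above the value of t² - 2 as long as t² ≤ 3/2; it keeps the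
interpolation between the two profiles increasing. -/
theorem neg_half_le_outerProfile (k : ℕ) {t : ℝ} (ht : 1 ≤ t) : -(1 / 2) ≤ outerProfile k t := by
  unfold outerProfile
  split_ifs with hk
  · linarith [Real.log_nonneg ht]
  · have hk1 : (1 : ℝ) ≤ k := by exact_mod_cast Nat.one_le_iff_ne_zero.2 hk
    have h1 : 1 ≤ t ^ (2 * k) := one_le_pow₀ ht
    have h2 : 1 ≤ k * t ^ (2 * k) := one_le_mul_of_one_le_of_one_le hk1 h1
    rw [neg_div, neg_le_neg_iff]
    exact one_div_le_one_div_of_le two_pos (by linarith)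

theorem deriv_outerProfile_pos (k : ℕ) {t : ℝ} (ht : 0 < t) : 0 < deriv (outerProfile k) t := by
  rcases Nat.eq_zero_or_pos k with rfl | hk
  · have h1 : outerProfile 0 = Real.log := funext fun t => if_pos rfl
    rw [h1, Real.deriv_log]
    positivity
  · have h1 : outerProfile k = fun t : ℝ => -1 / (2 * k * t ^ (2 * k)) :=
      funext fun t => if_neg hk.ne'
    have hk0 : (0 : ℝ) < k := by exact_mod_cast hk
    have h2 : HasDerivAt (fun t : ℝ => 2 * k * t ^ (2 * k)) (2 * k * ((2 * k : ℕ) * t ^ (2 * k - 1))) t :=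
      (hasDerivAt_pow (2 * k) t).const_mul _
    have h3 := (hasDerivAt_const t (-1 : ℝ)).div h2 (by positivity)
    rw [h1, show deriv (fun t : ℝ => -1 / (2 * (k : ℝ) * t ^ (2 * k))) t = _ from h3.deriv]
    refine div_pos ?_ (by positivity)
    have : (0 : ℝ) < 2 * k * ((2 * k : ℕ) * t ^ (2 * k - 1)) := by positivity
    linarith

/-- Existence of profile functions. -/
theorem exists_isProfile (k : ℕ) : ∃ f : ℝ → ℝ, IsProfile k f := by
  -- The cutoff rises from 0 at t² = 1 to 1 at t² = 7/5, so the transition ends while t² - 2 ≤ -3/5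
  -- is still below the outer profile.
  let χ : ℝ → ℝ := fun t => Real.smoothTransition (5 / 2 * (t ^ 2 - 1))
  let f : ℝ → ℝ := fun t => (1 - χ t) * (t ^ 2 - 2) + χ t * outerProfile k t
  have hχ : ContDiff ℝ ∞ χ := Real.smoothTransition.contDiff.comp (by fun_prop)
  have hinner : ∀ t, |t| ≤ 1 → f t = t ^ 2 - 2 := by
    intro t ht
    have h0 : χ t = 0 := Real.smoothTransition.zero_of_nonpos (by
      have := (sq_le_one_iff_abs_le_one t).2 ht
      linarith)
    simp [f, h0]
  have houter : ∀ t, 2 < |t| → f t = outerProfile k t := by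
    intro t ht
    have h0 : χ t = 1 := Real.smoothTransition.one_of_one_le (by
      have : (2 : ℝ) ^ 2 < t ^ 2 := sq_lt_sq' (by linarith [abs_nonneg t]) ht |>.trans_eq (sq_abs t)
      linarith)
    simp [f, h0]
  have hev : ∀ t, |t| < 1 → f =ᶠ[𝓝 t] fun t => t ^ 2 - 2 := fun t ht =>
    (continuous_abs.continuousAt.eventually (gt_mem_nhds ht)).mono fun s hs => hinner s hs.le
  refine ⟨f, ?_, ?_, ?_, hinner, ?_, ?_⟩
  · rw [contDiff_iff_contDiffAt]
    intro t
    by_cases ht : |t| < 1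
    · exact ContDiffAt.congr_of_eventuallyEq (by fun_prop) (hev t ht)
    · have ht0 : t ≠ 0 := by rintro rfl; simp at ht
      have h1 : ContDiffAt ℝ ∞ (fun t : ℝ => t ^ 2 - 2) t := by fun_prop
      exact ((contDiffAt_const.sub hχ.contDiffAt).mul h1).add
        (hχ.contDiffAt.mul (contDiffAt_outerProfile k ht0))
  · intro t
    have h1 : outerProfile k (-t) = outerProfile k t := by
      unfold outerProfile
      rw [Real.log_neg_eq_log, Even.neg_pow ⟨k, two_mul k⟩]
    simp only [f, χ, neg_sq, h1]
  · intro t ht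
    by_cases ht1 : t < 1
    · rw [(hev t (by rwa [abs_of_pos ht])).deriv_eq]
      simpa using ht
    · push Not at ht1
      have hA : HasDerivAt (fun t : ℝ => t ^ 2 - 2) (2 * t) t := by
        simpa using (hasDerivAt_pow 2 t).sub_const 2
      have hB := ((contDiffAt_outerProfile k ht.ne').differentiableAt (by simp)).hasDerivAt
      have hX := ((hχ.differentiable (by simp)) t).hasDerivAt
      have hF := ((hX.const_sub 1).mul hA).add (hX.mul hB)
      rw [show deriv f t = _ from hF.deriv]
      have hBp := deriv_outerProfile_pos k ht
      have hχ0 : 0 ≤ χ t := Real.smoothTransition.nonneg _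
      have hχ1 : χ t ≤ 1 := Real.smoothTransition.le_one _
      have hp : 0 < (1 - χ t) * (2 * t) + χ t * deriv (outerProfile k) t := by
        rcases hχ0.eq_or_lt with h | h
        · rw [← h]; linarith
        · have := mul_pos h hBp
          have : 0 ≤ (1 - χ t) * (2 * t) := mul_nonneg (by linarith) (by linarith)
          linarith
      -- The cross term in the derivative of the interpolation: during the transition both factors
      -- are nonnegative, and afterwards χ is locally constant.
      have hq : 0 ≤ deriv χ t * (outerProfile k t - (t ^ 2 - 2)) := by
        by_cases h7 : t ^ 2 ≤ 7 / 5
        · refine mul_nonneg ?_ (by linarith [neg_half_le_outerProfile k ht1])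
          have hin : HasDerivAt (fun t : ℝ => 5 / 2 * (t ^ 2 - 1)) (5 / 2 * (2 * t)) t := by
            simpa using ((hasDerivAt_pow 2 t).sub_const 1).const_mul (5 / 2)
          have hst : DifferentiableAt ℝ Real.smoothTransition (5 / 2 * (t ^ 2 - 1)) :=
            (Real.smoothTransition.contDiffAt (n := 1)).differentiableAt (by simp)
          have hc := hst.hasDerivAt.comp t hin
          rw [show deriv χ t = _ from hc.deriv]
          exact mul_nonneg Real.smoothTransition.monotone.deriv_nonneg (by positivity)
        · have hc : χ =ᶠ[𝓝 t] fun _ => 1 := by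
            have : ∀ᶠ s : ℝ in 𝓝 t, 7 / 5 < s ^ 2 :=
              (continuous_pow 2).continuousAt.eventually (lt_mem_nhds (not_le.1 h7))
            filter_upwards [this] with s hs
            exact Real.smoothTransition.one_of_one_le (by linarith)
          rw [hc.deriv_eq]
          simp
      linarith
  · rintro rfl t ht
    rw [houter t ht, Real.log_abs]
    exact if_pos rfl
  · intro hk t ht
    rw [houter t ht]
    exact if_neg hk.ne'

end Profile

/-! ### The fold condition near the critical hypersurface, uniformly in ε -/

section LocalFold

variable {n : ℕ}

theorem wedge_smul_left {V : Type*} [AddCommGroup V] [Module ℝ V] [TopologicalSpace V]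
    [ContinuousConstSMul ℝ V] (c : ℝ) (θ : V →L[ℝ] ℝ) (a : V [⋀^Fin 1]→L[ℝ] ℝ) :
    wedge (c • θ) a = wedge θ (c • a) := by
  ext v
  rw [eq_vec_two v, wedge_apply, wedge_apply]
  simp only [_root_.smul_apply, ContinuousAlternatingMap.smul_apply, smul_eq_mul]
  ring

theorem wedgePow_congr {V : Type*} [AddCommGroup V] [Module ℝ V] [TopologicalSpace V] {r : ℕ}
    {Ω Ω' : V [⋀^Fin 2]→L[ℝ] ℝ} {v : Fin (2 * r) → V}
    (h : ∀ i j, Ω ![v i, v j] = Ω' ![v i, v j]) : wedgePow r Ω v = wedgePow r Ω' v := by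
  simp only [wedgePow_eq_sum, toBilin_apply, h]

/-- Near a point of the critical hypersurface the desingularized form satisfies the fold
condition, uniformly in the parameter. -/
theorem eventually_foldAt {k : ℕ} {f : ℝ → ℝ} (hf : IsProfile k f) {X : Model (2 * n) → ℝ}
    {a : Model (2 * n) → (Model (2 * n)) [⋀^Fin 1]→L[ℝ] ℝ}
    {b : Model (2 * n) → (Model (2 * n)) [⋀^Fin 2]→L[ℝ] ℝ} {y₀ : Model (2 * n)}
    (hX : ContDiffAt ℝ ∞ X y₀) (ha : ContDiffAt ℝ ∞ a y₀) (hb : ContDiffAt ℝ ∞ b y₀)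
    (hX0 : X y₀ = 0) (hθ : fderiv ℝ X y₀ ≠ 0)
    (hnd : BNondegenerate (fderiv ℝ X y₀) (a y₀) (b y₀)) :
    ∀ᶠ q : Model (2 * n) × ℝ in 𝓝 y₀ ×ˢ 𝓝[>] 0, FoldAt (fun y =>
      wedge (fderiv ℝ (fun z => scaledProfile k f q.2 (X z)) y) (a y) + b y) q.1 := by
  let e := (EuclideanSpace.basisFun (Fin (2 * n)) ℝ).toBasis
  have he : ⇑e = EuclideanSpace.basisFun (Fin (2 * n)) ℝ := OrthonormalBasis.coe_toBasis _
  obtain ⟨v₀, hv₀⟩ : ∃ v₀, fderiv ℝ X y₀ v₀ = 1 := by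
    obtain ⟨v, hv⟩ : ∃ v, fderiv ℝ X y₀ v ≠ 0 := by
      by_contra! hcon
      exact hθ (ContinuousLinearMap.ext hcon)
    exact ⟨(fderiv ℝ X y₀ v)⁻¹ • v, by simp [hv]⟩
  obtain ⟨u, hu, huw⟩ := hnd.exists_wedgePow_ne_zero e hv₀
  have hdX : ContDiffAt ℝ ∞ (fderiv ℝ X) y₀ := hX.fderiv_right (by simp)
  let ν : Model (2 * n) → ℝ := topPower b
  let μ : Model (2 * n) → ℝ := fun y => topPower (fun y => wedge (fderiv ℝ X y) (a y) + b y) y - ν y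
  have hν : ContDiffAt ℝ ∞ ν y₀ := hb.topPower
  have hμ : ContDiffAt ℝ ∞ μ y₀ := ((hdX.wedge ha).add hb).topPower.sub hν
  have hμ0 : μ y₀ ≠ 0 := by
    have := hnd.wedgePow_sub_ne_zero e hv₀
    rwa [he] at this
  -- The only value of f_ε' for which the top power at `y` vanishes; it does not depend on ε.
  let s : Model (2 * n) → ℝ := fun y => -ν y / μ y
  have hs : ContDiffAt ℝ ∞ s y₀ := hν.neg.div hμ hμ0
  -- the coefficient of the top power
  have hgood : ∀ᶠ y in 𝓝 y₀, DifferentiableAt ℝ X y ∧ DifferentiableAt ℝ μ y ∧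
      DifferentiableAt ℝ ν y ∧ fderiv ℝ X y v₀ ≠ 0 := by
    have h1 : ∀ {g : Model (2 * n) → ℝ}, ContDiffAt ℝ ∞ g y₀ → ∀ᶠ y in 𝓝 y₀, DifferentiableAt ℝ g y :=
      fun {g} hg => ((hg.of_le (m := 1) (by simp)).eventually (by simp)).mono
        fun y hy => hy.differentiableAt one_ne_zero
    have h2 : ContinuousAt (fun y => fderiv ℝ X y v₀) y₀ :=
      (hdX.clm_apply contDiffAt_const).continuousAt
    filter_upwards [h1 hX, h1 hμ, h1 hν, h2.eventually_ne (by rw [hv₀]; exact one_ne_zero)]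
      with y e1 e2 e3 e4
    exact ⟨e1, e2, e3, e4⟩
  have hfd : ∀ ε y, DifferentiableAt ℝ X y → fderiv ℝ (fun z => scaledProfile k f ε (X z)) y =
      deriv (scaledProfile k f ε) (X y) • fderiv ℝ X y := by
    intro ε y hy
    have h1 := (hf.hasDerivAt_scaledProfile ε (X y)).differentiableAt
    exact (h1.hasDerivAt.comp_hasFDerivAt y hy.hasFDerivAt).fderiv
  have htop : ∀ ε y, DifferentiableAt ℝ X y → fderiv ℝ X y v₀ ≠ 0 →
      topPower (fun y => wedge (fderiv ℝ (fun z => scaledProfile k f ε (X z)) y) (a y) + b y) y =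
      deriv (scaledProfile k f ε) (X y) * μ y + ν y := by
    intro ε y hy hy0
    simp only [topPower, μ, ν]
    rw [hfd ε y hy, wedge_smul_left, ← he]
    have h1 : fderiv ℝ X y ((fderiv ℝ X y v₀)⁻¹ • v₀) = 1 := by simp [hy0]
    rw [wedgePow_wedge_add_affine e (fderiv ℝ X y) h1 (b y) _ (a y) (a y)
      (deriv (scaledProfile k f ε) (X y)) 0 (fun v => by simp)]
    ring
  -- the rescaled differential of this coefficient
  let l : ℝ × Model (2 * n) → Model (2 * n) →L[ℝ] ℝ := fun q =>
    μ q.2 • fderiv ℝ X q.2 + q.1 • (s q.2 • fderiv ℝ μ q.2 + fderiv ℝ ν q.2)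
  have hsnd : ContDiffAt ℝ ∞ (Prod.snd : ℝ × Model (2 * n) → _) ((0 : ℝ), y₀) := contDiffAt_snd
  have lift : ∀ {G : Type} [NormedAddCommGroup G] [NormedSpace ℝ G] {g : Model (2 * n) → G},
      ContDiffAt ℝ ∞ g y₀ → ContDiffAt ℝ ∞ (fun q : ℝ × Model (2 * n) => g q.2) ((0 : ℝ), y₀) :=
    fun {G} _ _ {g} hg => ContDiffAt.comp (f := Prod.snd) ((0 : ℝ), y₀) hg hsnd
  have hl : ContDiffAt ℝ ∞ l (0, y₀) :=
    ((lift hμ).smul (lift hdX)).add (contDiffAt_fst.smul (((lift hs).smul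
      (lift (hμ.fderiv_right (by simp)))).add (lift (hν.fderiv_right (by simp)))))
  have hl0 : l (0, y₀) = μ y₀ • fderiv ℝ X y₀ := by simp [l]
  have hlv : ContDiffAt ℝ ∞ (fun q => l q v₀) (0, y₀) := hl.clm_apply contDiffAt_const
  have hlv0 : l (0, y₀) v₀ ≠ 0 := by rw [hl0]; simpa [hv₀] using hμ0
  -- The vectors `u i`, tangent to the hypersurface at `y₀`, are corrected along `v₀` so as to lie
  -- in the kernel of `l q`. At the limit point (0, y₀) no correction is needed.
  let w : Fin (2 * (n - 1)) → ℝ × Model (2 * n) → Model (2 * n) := fun i q =>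
    u i - (l q (u i) / l q v₀) • v₀
  have hw : ∀ i, ContDiffAt ℝ ∞ (w i) (0, y₀) := fun i =>
    contDiffAt_const.sub (((hl.clm_apply contDiffAt_const).div hlv hlv0).smul contDiffAt_const)
  have hw0 : ∀ i, w i (0, y₀) = u i := fun i => by simp [w, hl0, hu]
  -- At zeros of the top power f_ε' = s, so there the desingularized form coincides with this form,
  -- which is free of ε.
  let Ξ : Model (2 * n) → (Model (2 * n)) [⋀^Fin 2]→L[ℝ] ℝ := fun y =>
    wedge (s y • fderiv ℝ X y) (a y) + b y
  have hΞ : ContDiffAt ℝ ∞ Ξ y₀ := ((hs.smul hdX).wedge ha).add hb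
  have hN : ContDiffAt ℝ ∞ (fun q : ℝ × Model (2 * n) => wedgePow (n - 1) (Ξ q.2) fun i => w i q)
      (0, y₀) := (lift hΞ).wedgePow hw
  have hN0 : wedgePow (n - 1) (Ξ y₀) (fun i => w i (0, y₀)) ≠ 0 := by
    simp only [hw0]
    rwa [wedgePow_congr (Ω' := b y₀)]
    intro i j
    change toBilin (wedge (s y₀ • fderiv ℝ X y₀) (a y₀) + b y₀) (u i) (u j) = _
    rw [toBilin_wedge_add]
    simp [hu, toBilin_apply]
  have hlim : ∀ᶠ q : ℝ × Model (2 * n) in 𝓝 (0, y₀), l q v₀ ≠ 0 ∧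
      wedgePow (n - 1) (Ξ q.2) (fun i => w i q) ≠ 0 :=
    (hlv.continuousAt.eventually_ne hlv0).and (hN.continuousAt.eventually_ne hN0)
  -- The parameter of `l` is the inverse slope ε^(2k+2)/2 of f_ε' near 0. As it tends to 0, the open
  -- conditions at (0, y₀) apply.
  have htend : Filter.Tendsto (fun q : Model (2 * n) × ℝ => (q.2 ^ (2 * k + 2) / 2, q.1))
      (𝓝 y₀ ×ˢ 𝓝[>] 0) (𝓝 (0, y₀)) := by
    rw [nhds_prod_eq]
    refine Filter.Tendsto.prodMk ?_ Filter.tendsto_fst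
    have h1 : Filter.Tendsto (fun ε : ℝ => ε ^ (2 * k + 2) / 2) (𝓝[>] 0) (𝓝 0) := by
      have h2 : Continuous fun ε : ℝ => ε ^ (2 * k + 2) / 2 := by fun_prop
      have h3 := h2.tendsto 0
      simp only [ne_eq, Nat.add_eq_zero_iff, OfNat.ofNat_ne_zero, and_false, not_false_eq_true,
        zero_pow, zero_div] at h3
      exact h3.mono_left nhdsWithin_le_nhds
    exact h1.comp Filter.tendsto_snd
  obtain ⟨ρ, hρ, hin⟩ := hf.abs_lt_of_deriv_le (|s y₀| + 1)
  have hsb : ∀ᶠ y in 𝓝 y₀, |s y| < |s y₀| + 1 :=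
    hs.continuousAt.abs.eventually (gt_mem_nhds (by linarith))
  have hXb : ∀ᶠ y in 𝓝 y₀, |X y| < ρ :=
    hX.continuousAt.abs.eventually (gt_mem_nhds (by simpa [hX0] using hρ))
  have hεb : ∀ᶠ ε : ℝ in 𝓝[>] 0, 0 < ε ∧ ε < ρ := by
    filter_upwards [Ioo_mem_nhdsGT hρ] with ε hε using hε
  filter_upwards [htend.eventually hlim,
    (hgood.eventually_nhds.and (hsb.and (hXb.and (hμ.continuousAt.eventually_ne hμ0)))).prod_mk hεb]
    with q hq1 hq2
  obtain ⟨y, ε⟩ := q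
  obtain ⟨⟨hg, hsy, hXy, hμy⟩, hε, hερ⟩ := hq2
  obtain ⟨hl1, hN1⟩ := hq1
  simp only at hg hsy hXy hμy hε hερ hl1 hN1
  obtain ⟨hXd, hμd, hνd, hyv⟩ := hg.self_of_nhds
  intro hz
  have htopev : topPower (fun y => wedge (fderiv ℝ (fun z => scaledProfile k f ε (X z)) y) (a y) + b y)
      =ᶠ[𝓝 y] fun y => deriv (scaledProfile k f ε) (X y) * μ y + ν y :=
    hg.mono fun y' hy' => htop ε y' hy'.1 hy'.2.2.2
  rw [htop ε y hXd hyv] at hz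
  have hgs : deriv (scaledProfile k f ε) (X y) = s y := by
    simp only [s]
    rw [eq_div_iff hμy]
    linarith
  -- At a zero f_ε' = s is bounded, which confines the zero to the zone where f_ε' is linear.
  have hXε : |X y| < ε := hin _ _ hXy hε hερ (by rw [hgs]; exact hsy.le)
  have hG : HasDerivAt (deriv (scaledProfile k f ε)) (2 * (ε ^ (2 * k + 2))⁻¹) (X y) := by
    have h1 : deriv (scaledProfile k f ε) =ᶠ[𝓝 (X y)] fun t => 2 * (ε ^ (2 * k + 2))⁻¹ * t :=
      (continuous_abs.continuousAt.eventually (gt_mem_nhds hXε)).mono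
        fun t ht => hf.deriv_scaledProfile_inner hε ht
    refine HasDerivAt.congr_of_eventuallyEq ?_ h1
    simpa using (hasDerivAt_id (X y)).const_mul (2 * (ε ^ (2 * k + 2))⁻¹)
  have hderiv : fderiv ℝ (topPower (fun y =>
      wedge (fderiv ℝ (fun z => scaledProfile k f ε (X z)) y) (a y) + b y)) y =
      (2 * (ε ^ (2 * k + 2))⁻¹) • l (ε ^ (2 * k + 2) / 2, y) := by
    rw [htopev.fderiv_eq]
    have h1 := hG.comp_hasFDerivAt y hXd.hasFDerivAt
    have h2 := (h1.mul hμd.hasFDerivAt).add hνd.hasFDerivAt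
    refine h2.fderiv.trans ?_
    have hε' : ε ^ (2 * k + 2) ≠ 0 := by positivity
    simp only [l, Function.comp_apply, hgs]
    ext v
    simp only [_root_.add_apply, _root_.smul_apply, smul_eq_mul]
    field_simp
    ring
  have hGne : 2 * (ε ^ (2 * k + 2))⁻¹ ≠ 0 := by positivity
  refine ⟨fun h0 => ?_, fun i => w i (ε ^ (2 * k + 2) / 2, y), fun i => ?_, ?_⟩
  · have h1 := congrArg (fun L : Model (2 * n) →L[ℝ] ℝ => L v₀) (hderiv.symm.trans h0)
    simp only [_root_.smul_apply, smul_eq_mul, _root_.zero_apply] at h1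
    exact (mul_ne_zero hGne hl1) h1
  · rw [hderiv]
    simp only [_root_.smul_apply, w, map_sub, map_smul, smul_eq_mul]
    field_simp
    ring
  · change wedgePow (n - 1) (wedge (fderiv ℝ (fun z => scaledProfile k f ε (X z)) y) (a y) + b y) _ ≠ 0
    rw [hfd ε y hXd, hgs]
    exact hN1

end LocalFold

/-! ### Exterior derivatives of products and closedness of g(X) dX ∧ a -/

section ExtDeriv

variable {E : Type*} [NormedAddCommGroup E] [NormedSpace ℝ E]

theorem extDeriv_smul_one_form {H : E → ℝ} {a : E → E [⋀^Fin 1]→L[ℝ] ℝ} {y : E}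
    (hH : DifferentiableAt ℝ H y) (ha : DifferentiableAt ℝ a y) :
    extDeriv (fun z => H z • a z) y = wedge (fderiv ℝ H y) (a y) + H y • extDeriv a y := by
  have h1 : ∀ v, fderiv ℝ (fun z => (H z • a z) v) y =
      H y • fderiv ℝ (fun z => a z v) y + a y v • fderiv ℝ H y := fun v =>
    fderiv_fun_mul hH (ha.continuousAlternatingMap_apply_const v)
  have hs : DifferentiableAt ℝ (fun z => H z • a z) y := hH.smul ha
  ext v
  rw [extDeriv_apply hs, ContinuousAlternatingMap.add_apply,
    ContinuousAlternatingMap.smul_apply, extDeriv_apply ha]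
  rw [eq_vec_two v, wedge_apply, Fin.sum_univ_two, Fin.sum_univ_two, h1, h1]
  have e0 : Fin.removeNth 0 ![v 0, v 1] = ![v 1] := by ext i; fin_cases i; rfl
  have e1 : Fin.removeNth 1 ![v 0, v 1] = ![v 0] := by ext i; fin_cases i; rfl
  simp [e0, e1]
  ring

theorem extDeriv_finset_sum {j : ℕ} {ι : Type*} (s : Finset ι) {η : ι → E → E [⋀^Fin j]→L[ℝ] ℝ}
    {y : E} (h : ∀ i ∈ s, DifferentiableAt ℝ (η i) y) :
    extDeriv (fun z => ∑ i ∈ s, η i z) y = ∑ i ∈ s, extDeriv (η i) y := by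
  classical
  induction s using Finset.induction_on with
  | empty =>
    ext v
    simp [extDeriv, ContinuousAlternatingMap.alternatizeUncurryFin_apply]
  | insert i s hi ih =>
    simp only [Finset.sum_insert hi]
    rw [extDeriv_fun_add (h i (Finset.mem_insert_self i s))
      (DifferentiableAt.fun_sum fun j hj => h j (Finset.mem_insert_of_mem hj)),
      ih fun j hj => h j (Finset.mem_insert_of_mem hj)]

theorem exists_smooth_primitive {g : ℝ → ℝ} (hg : ContDiff ℝ ∞ g) :
    ∃ H : ℝ → ℝ, ContDiff ℝ ∞ H ∧ ∀ t, HasDerivAt H (g t) t := by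
  have h1 : ∀ t, HasDerivAt (fun t => ∫ s in (0 : ℝ)..t, g s) (g t) t := fun t =>
    (hg.continuous.integral_hasStrictDerivAt 0 t).hasDerivAt
  refine ⟨_, ?_, h1⟩
  rw [contDiff_infty_iff_deriv]
  refine ⟨fun t => (h1 t).differentiableAt, ?_⟩
  rwa [show deriv (fun t => ∫ s in (0 : ℝ)..t, g s) = g from funext fun t => (h1 t).deriv]

/-- The form `g(X) dX ∧ a` is closed if `a` is. -/
theorem extDeriv_wedge_closed [FiniteDimensional ℝ E] {g : ℝ → ℝ} (hg : ContDiff ℝ ∞ g) {X : E → ℝ}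
    {a : E → E [⋀^Fin 1]→L[ℝ] ℝ} {y : E} (hX : ContDiffAt ℝ ∞ X y) (ha : ContDiffAt ℝ ∞ a y)
    (hda : ∀ᶠ z in 𝓝 y, extDeriv a z = 0) :
    extDeriv (fun z => wedge (g (X z) • fderiv ℝ X z) (a z)) y = 0 := by
  -- With H' = g, the form is d(H(X) a) near `y`, because a is closed there.
  obtain ⟨H, hH, hHd⟩ := exists_smooth_primitive hg
  have h1 : ∀ᶠ z in 𝓝 y, DifferentiableAt ℝ X z := ((hX.of_le (m := 1) (by simp)).eventually
    (by simp)).mono fun z hz => hz.differentiableAt one_ne_zero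
  have h2 : ∀ᶠ z in 𝓝 y, DifferentiableAt ℝ a z := ((ha.of_le (m := 1) (by simp)).eventually
    (by simp)).mono fun z hz => hz.differentiableAt one_ne_zero
  have h3 : (fun z => wedge (g (X z) • fderiv ℝ X z) (a z)) =ᶠ[𝓝 y]
      extDeriv (fun z => H (X z) • a z) := by
    filter_upwards [h1, h2, hda] with z e1 e2 e3
    have e4 := (hHd (X z)).comp_hasFDerivAt z e1.hasFDerivAt
    have e5 : HasFDerivAt (fun z => H (X z)) (g (X z) • fderiv ℝ X z) z := e4
    rw [extDeriv_smul_one_form e5.differentiableAt e2, e3, e5.fderiv, smul_zero, add_zero]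
  rw [h3.extDeriv_eq]
  exact extDeriv_extDeriv_apply ((hH.contDiffAt.comp y hX).smul ha) two_le_smooth

end ExtDeriv

/-! ### Behaviour of wedge products under linear maps -/

section Wedge

variable {V W : Type*} [AddCommGroup V] [Module ℝ V] [TopologicalSpace V] [AddCommGroup W]
  [Module ℝ W] [TopologicalSpace W]

theorem form_two_ext {Ω Ω' : V [⋀^Fin 2]→L[ℝ] ℝ} (h : ∀ u v, Ω ![u, v] = Ω' ![u, v]) : Ω = Ω' := by
  ext w
  rw [eq_vec_two w]
  exact h _ _

theorem comp_apply_one (a : V [⋀^Fin 1]→L[ℝ] ℝ) (A : W →L[ℝ] V) (u : W) :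
    a.compContinuousLinearMap A ![u] = a ![A u] := by
  rw [ContinuousAlternatingMap.compContinuousLinearMap_apply]
  congr 1
  ext i; fin_cases i; rfl

theorem comp_apply_two (b : V [⋀^Fin 2]→L[ℝ] ℝ) (A : W →L[ℝ] V) (u v : W) :
    b.compContinuousLinearMap A ![u, v] = b ![A u, A v] := by
  rw [ContinuousAlternatingMap.compContinuousLinearMap_apply]
  congr 1
  ext i; fin_cases i <;> rfl

theorem wedge_comp (θ : V →L[ℝ] ℝ) (a : V [⋀^Fin 1]→L[ℝ] ℝ) (A : W →L[ℝ] V) :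
    (wedge θ a).compContinuousLinearMap A = wedge (θ.comp A) (a.compContinuousLinearMap A) := by
  refine form_two_ext fun u v => ?_
  rw [comp_apply_two, wedge_apply, wedge_apply, comp_apply_one, comp_apply_one]
  rfl

theorem wedge_sum_smul [ContinuousConstSMul ℝ V] [IsTopologicalAddGroup V] {ι : Type*}
    (s : Finset ι) (c : ℝ) (r : ι → ℝ)
    (θ : V →L[ℝ] ℝ) (a : ι → V [⋀^Fin 1]→L[ℝ] ℝ) :
    wedge (c • θ) (∑ i ∈ s, r i • a i) = ∑ i ∈ s, wedge ((c * r i) • θ) (a i) := by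
  refine form_two_ext fun u v => ?_
  rw [wedge_apply]
  simp only [ContinuousAlternatingMap.sum_apply, wedge_apply, _root_.smul_apply,
    ContinuousAlternatingMap.smul_apply, smul_eq_mul, Finset.mul_sum, ← Finset.sum_sub_distrib]
  exact Finset.sum_congr rfl fun i _ => by ring

theorem BNondegenerate.comp {θ : V →L[ℝ] ℝ} {a : V [⋀^Fin 1]→L[ℝ] ℝ} {b : V [⋀^Fin 2]→L[ℝ] ℝ}
    (h : BNondegenerate θ a b) {A : W →L[ℝ] V} {A' : V →L[ℝ] W} (hA : ∀ w, A' (A w) = w)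
    (hA' : ∀ v, A (A' v) = v) :
    BNondegenerate (θ.comp A) (a.compContinuousLinearMap A) (b.compContinuousLinearMap A) := by
  intro u c hu huc
  have h1 := h (A u) c hu fun u' c' hu' => by
    have h2 := huc (A' u') c' (by simpa [hA'] using hu')
    rwa [comp_apply_one, comp_apply_one, comp_apply_two, hA'] at h2
  refine ⟨?_, h1.2⟩
  rw [← hA u, h1.1, map_zero]

end Wedge

/-! ### Changes of local coordinates -/

section LocalForms

variable {d : ℕ} {M : Type*} [TopologicalSpace M] [ChartedSpace (Model d) M] {j : ℕ}
  {κ κ' : M → Model d} {σ σ' : Model d → M} {p : M}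

theorem localForm_def (σ : Model d → M) (η : Form d M j) (y : Model d) :
    localForm σ η y = (η (σ y)).compContinuousLinearMap (mfderiv (𝓡 d) (𝓡 d) σ y) := rfl

theorem fderiv_comp_eq_dFun {x : M → ℝ} {y : Model d}
    (hx : MDifferentiableAt (𝓡 d) 𝓘(ℝ, ℝ) x (σ y)) (hσ : MDifferentiableAt (𝓡 d) (𝓡 d) σ y) :
    fderiv ℝ (fun z => x (σ z)) y = (dFun (d := d) x (σ y)).comp (mfderiv (𝓡 d) (𝓡 d) σ y) := by
  rw [← mfderiv_eq_fderiv]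
  exact mfderiv_comp y hx hσ

namespace LocalCoord

theorem contDiffAt_comp_symm (h : LocalCoord κ σ p) {x : M → ℝ}
    (hx : ContMDiffAt (𝓡 d) 𝓘(ℝ, ℝ) ∞ x p) : ContDiffAt ℝ ∞ (fun y => x (σ y)) (κ p) := by
  rw [← contMDiffAt_iff_contDiffAt]
  exact ContMDiffAt.comp (κ p) (by rwa [h.apply_self]) h.smooth_symm

theorem tendsto_symm (h : LocalCoord κ σ p) : Filter.Tendsto σ (𝓝 (κ p)) (𝓝 p) := by
  have := h.smooth_symm.continuousAt
  rwa [ContinuousAt, h.apply_self] at this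

theorem mfderiv_mfderiv_symm (h : LocalCoord κ σ p) (v : Model d) :
    (mfderiv (𝓡 d) (𝓡 d) κ (σ (κ p)) (mfderiv (𝓡 d) (𝓡 d) σ (κ p) v) : Model d) = v := by
  have h1 : MDifferentiableAt (𝓡 d) (𝓡 d) κ (σ (κ p)) := by
    rw [h.apply_self]; exact h.smooth.mdifferentiableAt (by simp)
  have h2 := h.smooth_symm.mdifferentiableAt (by simp)
  have h3 : (mfderiv (𝓡 d) (𝓡 d) (κ ∘ σ) (κ p) : Model d →L[ℝ] Model d) =
      mfderiv (𝓡 d) (𝓡 d) id (κ p) := Filter.EventuallyEq.mfderiv_eq h.right_inv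
  rw [mfderiv_id] at h3
  exact (mfderiv_comp_apply (κ p) h1 h2 v).symm.trans
    (congrArg (fun L : Model d →L[ℝ] Model d => L v) h3)

theorem mfderiv_symm_mfderiv (h : LocalCoord κ σ p) (v : TangentSpace (𝓡 d) p) :
    mfderiv (𝓡 d) (𝓡 d) σ (κ p) (mfderiv (𝓡 d) (𝓡 d) κ p v) = v := by
  have h1 := h.smooth.mdifferentiableAt (by simp)
  have h2 := h.smooth_symm.mdifferentiableAt (by simp)
  rw [← mfderiv_comp_apply p h2 h1]
  have h3 : mfderiv (𝓡 d) (𝓡 d) (σ ∘ κ) p = mfderiv (𝓡 d) (𝓡 d) id p :=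
    Filter.EventuallyEq.mfderiv_eq h.left_inv
  rw [h3, mfderiv_id]
  rfl

theorem mfderiv_symm_mfderiv_base (h : LocalCoord κ σ p) (v : Model d) :
    (mfderiv (𝓡 d) (𝓡 d) σ (κ p) (mfderiv (𝓡 d) (𝓡 d) κ (σ (κ p)) v) : Model d) = v := by
  have : ∀ q, q = p → (mfderiv (𝓡 d) (𝓡 d) σ (κ p) (mfderiv (𝓡 d) (𝓡 d) κ q v) : Model d) = v := by
    rintro q rfl
    exact h.mfderiv_symm_mfderiv v
  exact this _ h.apply_self

/-- The chain rule for the two transition germs, whose composite is the identity near `κ p`. -/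
theorem exists_right_inverse_fderiv (h : LocalCoord κ σ p) (h' : LocalCoord κ' σ' p) :
    ∃ A : Model d →L[ℝ] Model d, ∀ v, fderiv ℝ (κ ∘ σ') (κ' p) (A v) = v := by
  have hc : ContMDiffAt (𝓡 d) (𝓡 d) ∞ (κ ∘ σ') (κ' p) :=
    ContMDiffAt.comp _ (by rw [h'.apply_self]; exact h.smooth) h'.smooth_symm
  have hc' : ContMDiffAt (𝓡 d) (𝓡 d) ∞ (κ' ∘ σ) (κ p) :=
    ContMDiffAt.comp _ (by rw [h.apply_self]; exact h'.smooth) h.smooth_symm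
  have e0 : (κ' ∘ σ) (κ p) = κ' p := by simp [h.apply_self]
  have h1 : DifferentiableAt ℝ (κ ∘ σ') ((κ' ∘ σ) (κ p)) := by
    rw [e0]; exact hc.contDiffAt.differentiableAt (by simp)
  have h2 : DifferentiableAt ℝ (κ' ∘ σ) (κ p) := hc'.contDiffAt.differentiableAt (by simp)
  have h3 : (κ ∘ σ') ∘ (κ' ∘ σ) =ᶠ[𝓝 (κ p)] id := by
    filter_upwards [h.tendsto_symm.eventually h'.left_inv, h.right_inv] with y e1 e2
    simp [e1, e2]
  refine ⟨fderiv ℝ (κ' ∘ σ) (κ p), fun v => ?_⟩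
  have h4 := fderiv_comp (κ p) h1 h2
  rw [h3.fderiv_eq, fderiv_id, e0] at h4
  exact (congrArg (fun L : Model d →L[ℝ] Model d => L v) h4).symm

variable [IsManifold (𝓡 d) ∞ M]

/-- Change of coordinates for forms. -/
theorem localForm_change (h : LocalCoord κ σ p) (h' : LocalCoord κ' σ' p) (η : Form d M j) :
    localForm σ' η =ᶠ[𝓝 (κ' p)] fun y =>
      (localForm σ η (κ (σ' y))).compContinuousLinearMap (fderiv ℝ (κ ∘ σ') y) := by
  have hc : ContMDiffAt (𝓡 d) (𝓡 d) ∞ (κ ∘ σ') (κ' p) :=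
    ContMDiffAt.comp _ (by rw [h'.apply_self]; exact h.smooth) h'.smooth_symm
  have ht : Filter.Tendsto (fun y => κ (σ' y)) (𝓝 (κ' p)) (𝓝 (κ p)) :=
    h.smooth.continuousAt.tendsto.comp h'.tendsto_symm
  filter_upwards [h'.tendsto_symm.eventually h.left_inv.eventually_nhds,
    h'.smooth_symm.eventually_mdifferentiableAt, hc.eventually_mdifferentiableAt,
    ht.eventually h.smooth_symm.eventually_mdifferentiableAt] with y e1 e2 e3 e4
  have e5 : pullback (d := d) σ' η y = pullback (d := d) (σ ∘ κ ∘ σ') η y :=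
    pullback_congr η ((e2.continuousAt.eventually e1).mono fun z hz => hz.symm)
  refine e5.trans ?_
  rw [pullback_comp (G := σ) (F := κ ∘ σ') η e4 e3, pullback, mfderiv_eq_fderiv]
  rfl

end LocalCoord

end LocalForms

/-- `IsFoldedSymplectic` uses a different chart at each point; this moves the uniform estimate made
in one chart to the preferred charts of all nearby points. -/
theorem LocalCoord.foldAt_change {n : ℕ} {M : Type*} [TopologicalSpace M]
    [ChartedSpace (Model (2 * n)) M] [IsManifold (𝓡 (2 * n)) ∞ M]
    {κ κ' : M → Model (2 * n)} {σ σ' : Model (2 * n) → M} {p : M}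
    (h : LocalCoord κ σ p) (h' : LocalCoord κ' σ' p) {η : Form (2 * n) M 2} (hη : SmoothAt η p)
    (hf : FoldAt (localForm σ η) (κ p)) : FoldAt (localForm σ' η) (κ' p) := by
  obtain ⟨A, hA⟩ := h.exists_right_inverse_fderiv h'
  have hc : ContMDiffAt (𝓡 (2 * n)) (𝓡 (2 * n)) ∞ (κ ∘ σ') (κ' p) :=
    ContMDiffAt.comp _ (by rw [h'.apply_self]; exact h.smooth) h'.smooth_symm
  have e0 : (κ ∘ σ') (κ' p) = κ p := by simp [h'.apply_self]
  have h1 := (h.smoothAt_iff η).1 hη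
  refine FoldAt.congr ?_ (h.localForm_change h' η).symm
  exact FoldAt.pullback (g := κ ∘ σ') (by rwa [e0]) (by rw [e0]; exact h1.of_le (by simp))
    (hc.contDiffAt.of_le (by exact WithTop.coe_le_coe.2 (le_top : (2 : ℕ∞) ≤ ⊤))) hA

/-- A form with the fold condition in all preferred charts is folded symplectic. -/
theorem isFoldedSymplectic_of_foldAt {n : ℕ} {M : Type*} [TopologicalSpace M]
    [ChartedSpace (Model (2 * n)) M] {η : Form (2 * n) M 2} (hs : ∀ p, SmoothAt η p)
    (hc : ∀ p, extD η p = 0)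
    (hf : ∀ p, FoldAt (inChart η p) (extChartAt (𝓡 (2 * n)) p p)) : IsFoldedSymplectic η where
  smooth := hs
  closed := hc
  transverse p h := (hf p h).1
  fold_nondegenerate p h := (hf p h).2

section Comp

variable {V W : Type*} [AddCommGroup V] [Module ℝ V] [TopologicalSpace V] [AddCommGroup W]
  [Module ℝ W] [TopologicalSpace W]

theorem comp_finset_sum {ι : Type*} {j : ℕ} (s : Finset ι) (η : ι → V [⋀^Fin j]→L[ℝ] ℝ)
    (A : W →L[ℝ] V) : (∑ i ∈ s, η i).compContinuousLinearMap A =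
      ∑ i ∈ s, (η i).compContinuousLinearMap A := by
  ext v
  simp [ContinuousAlternatingMap.sum_apply]

theorem comp_wedge_add (θ : V →L[ℝ] ℝ) (a : V [⋀^Fin 1]→L[ℝ] ℝ) (b : V [⋀^Fin 2]→L[ℝ] ℝ)
    (A : W →L[ℝ] V) : (wedge θ a + b).compContinuousLinearMap A =
      wedge (θ.comp A) (a.compContinuousLinearMap A) + b.compContinuousLinearMap A := by
  rw [← wedge_comp]
  rfl

end Comp

/-! ### Forms associated with b^m-two-forms -/

section Desingularization

variable {d m : ℕ} {M : Type*} [TopologicalSpace M] [ChartedSpace (Model d) M] {x : M → ℝ}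
  {Ω : BTwoForm d m x} {p : M}

theorem EqAt.toForm_eq {a : TangentSpace (𝓡 d) p [⋀^Fin 1]→L[ℝ] ℝ}
    {b : TangentSpace (𝓡 d) p [⋀^Fin 2]→L[ℝ] ℝ} (h : Ω.EqAt p a b) (hp : x p ≠ 0) :
    Ω.toForm p = wedge ((x p ^ m)⁻¹ • dFun x p) a + b := by
  refine form_two_ext fun u v => ?_
  have h1 : Ω.toForm p = (Ω p).compContinuousLinearMap (bLift m x p hp) := dif_pos hp
  rw [h1, comp_apply_two, h, ContinuousAlternatingMap.add_apply, wedge_apply]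
  rfl

/-- Off Z the second coordinate in the b^m-fibre is determined by the first, so `bLift` is onto and
maximal rank passes to the tangent space. -/
theorem IsBSymplectic.toForm_nondegenerate (hΩ : IsBSymplectic Ω) (hp : x p ≠ 0)
    (u : TangentSpace (𝓡 d) p) (hu : ∀ v, Ω.toForm p ![u, v] = 0) : u = 0 := by
  have h1 : Ω.toForm p = (Ω p).compContinuousLinearMap (bLift m x p hp) := dif_pos hp
  have h2 := hΩ.nondegenerate p (bLift m x p hp u) fun w' => by
    have h3 := hu w'.1.1
    rw [h1, comp_apply_two] at h3
    have h4 : bLift m x p hp w'.1.1 = w' := by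
      refine Subtype.ext (Prod.ext rfl ?_)
      have h5 : dFun x p w'.1.1 = x p ^ m * w'.1.2 := w'.2
      change (x p ^ m)⁻¹ * dFun x p w'.1.1 = w'.1.2
      rw [h5, inv_mul_cancel_left₀ (pow_ne_zero m hp)]
    rwa [h4] at h3
  exact congrArg (fun w : bTangent (d := d) m x p => w.1.1) h2

/-- On Z the equation of the b^m-fibre becomes dx(u) = 0 with c free, since 0ᵐ = 0 for m ≠ 0; the
fibre is ker dx × ℝ. -/
theorem IsBSymplectic.bNondegenerate (hΩ : IsBSymplectic Ω) (hm : m ≠ 0) (hp : x p = 0)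
    {a : TangentSpace (𝓡 d) p [⋀^Fin 1]→L[ℝ] ℝ}
    {b : TangentSpace (𝓡 d) p [⋀^Fin 2]→L[ℝ] ℝ} (h : Ω.EqAt p a b) :
    BNondegenerate (dFun x p) a b := by
  have hmem : ∀ (u : TangentSpace (𝓡 d) p) (c : ℝ), dFun x p u = 0 → (u, c) ∈ bTangent (d := d) m x p := by
    intro u c hu
    change dFun x p u = x p ^ m * c
    rw [hu, hp, zero_pow hm, zero_mul]
  intro u c hu huc
  have h1 := hΩ.nondegenerate p ⟨(u, c), hmem u c hu⟩ fun w' => by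
    rw [h]
    refine huc w'.1.1 w'.1.2 ?_
    have h5 : dFun x p w'.1.1 = x p ^ m * w'.1.2 := w'.2
    rw [h5, hp, zero_pow hm, zero_mul]
  have h2 := congrArg Subtype.val h1
  exact ⟨congrArg Prod.fst h2, congrArg Prod.snd h2⟩

theorem dFun_comp {F : ℝ → ℝ} (hF : DifferentiableAt ℝ F (x p))
    (hx : MDifferentiableAt (𝓡 d) 𝓘(ℝ, ℝ) x p) :
    dFun (d := d) (fun q => F (x q)) p = deriv F (x p) • dFun x p := by
  have h1 := mfderiv_comp p (I' := 𝓘(ℝ, ℝ)) (I'' := 𝓘(ℝ, ℝ)) hF.mdifferentiableAt hx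
  refine ContinuousLinearMap.ext fun v => ?_
  refine (congrArg (fun L : TangentSpace (𝓡 d) p →L[ℝ] ℝ => L v) h1).trans ?_
  change mfderiv 𝓘(ℝ, ℝ) 𝓘(ℝ, ℝ) F (x p) (dFun x p v) = deriv F (x p) * dFun x p v
  rw [mfderiv_eq_fderiv]
  exact (fderiv_eq_smul_deriv (f := F) (x := x p) _).trans (by rw [smul_eq_mul, mul_comm])

theorem IsDefiningFunction.mdifferentiable (hx : IsDefiningFunction (d := d) x) :
    MDifferentiable (𝓡 d) 𝓘(ℝ, ℝ) x := hx.smooth.mdifferentiable (by simp)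

variable [IsManifold (𝓡 d) ∞ M] {κ : M → Model d} {σ : Model d → M}

/-- The coordinate expression of `d(F ∘ x) ∧ a + b`. -/
theorem LocalCoord.localForm_wedge_add (h : LocalCoord κ σ p) (hx : IsDefiningFunction (d := d) x)
    {F : ℝ → ℝ} (hF : Differentiable ℝ F) (a : Form d M 1) (b : Form d M 2) :
    ∀ᶠ y in 𝓝 (κ p), localForm σ (fun q => wedge (dFun (fun q => F (x q)) q) (a q) + b q) y =
      wedge (fderiv ℝ (fun z => F (x (σ z))) y) (localForm σ a y) + localForm σ b y := by
  filter_upwards [h.smooth_symm.eventually_mdifferentiableAt] with y hy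
  have h1 : MDifferentiableAt (𝓡 d) 𝓘(ℝ, ℝ) (fun q => F (x q)) (σ y) :=
    ((hF _).mdifferentiableAt).comp (σ y) (hx.mdifferentiable _)
  rw [fderiv_comp_eq_dFun h1 hy]
  exact comp_wedge_add _ _ _ _

theorem SmoothAt.add {j : ℕ} {η η' : Form d M j} (h : SmoothAt η p) (h' : SmoothAt η' p) :
    SmoothAt (fun q => η q + η' q) p := by
  have hc := localCoord_extChartAt (d := d) (p := p) (mem_extChartAt_source p)
  rw [hc.smoothAt_iff] at *
  exact ContDiffAt.add h h'

theorem SmoothAt.smul {j : ℕ} {η : Form d M j} {c : M → ℝ} (hc : ContMDiffAt (𝓡 d) 𝓘(ℝ, ℝ) ∞ c p)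
    (h : SmoothAt η p) : SmoothAt (fun q => c q • η q) p := by
  have hl := localCoord_extChartAt (d := d) (p := p) (mem_extChartAt_source p)
  rw [hl.smoothAt_iff] at *
  exact ContDiffAt.smul (hl.contDiffAt_comp_symm hc) h

theorem SmoothAt.sum {j : ℕ} {ι : Type*} {s : Finset ι} {η : ι → Form d M j}
    (h : ∀ i ∈ s, SmoothAt (η i) p) : SmoothAt (fun q => ∑ i ∈ s, η i q) p := by
  have hl := localCoord_extChartAt (d := d) (p := p) (mem_extChartAt_source p)
  rw [hl.smoothAt_iff]
  have h1 : localForm (extChartAt (𝓡 d) p).symm (fun q => ∑ i ∈ s, η i q) =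
      fun y => ∑ i ∈ s, localForm (extChartAt (𝓡 d) p).symm (η i) y := by
    funext y
    exact comp_finset_sum _ _ _
  rw [h1]
  exact ContDiffAt.sum fun i hi => (hl.smoothAt_iff _).1 (h i hi)

theorem SmoothAt.dFun_wedge (hx : IsDefiningFunction (d := d) x) {F : ℝ → ℝ} (hF : ContDiff ℝ ∞ F)
    {a : Form d M 1} {b : Form d M 2} (ha : SmoothAt a p) (hb : SmoothAt b p) :
    SmoothAt (fun q => wedge (dFun (fun q => F (x q)) q) (a q) + b q) p := by
  have hl := localCoord_extChartAt (d := d) (p := p) (mem_extChartAt_source p)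
  rw [hl.smoothAt_iff] at *
  refine ContDiffAt.congr_of_eventuallyEq ?_
    (hl.localForm_wedge_add hx (hF.differentiable (by simp)) a b)
  have h1 := hF.contDiffAt.comp _ (hl.contDiffAt_comp_symm hx.smooth.contMDiffAt)
  exact ((h1.fderiv_right (by simp)).wedge ha).add hb

end Desingularization

/-! ### Smoothness and closedness of the desingularization -/

section Odd

variable {d k : ℕ} {M : Type*} [TopologicalSpace M] [ChartedSpace (Model d) M] {x : M → ℝ} {Ω : BTwoForm d (2 * k + 1) x} {p : M} {f : ℝ → ℝ}

/-- The singular coefficient `∑ xⁱ αᵢ` of a Laurent decomposition. -/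
def LaurentDecomposition.coeff (L : LaurentDecomposition Ω) : Form d M 1 := fun p =>
  ∑ i : Fin (2 * k + 1), x p ^ (i : ℕ) • L.α i p

theorem LaurentDecomposition.eventually_lt (L : LaurentDecomposition Ω)
    (hx : IsDefiningFunction (d := d) x) (hp : |x p| < L.δ) : ∀ᶠ q in 𝓝 p, |x q| < L.δ :=
  hx.smooth.continuous.abs.continuousAt.eventually (gt_mem_nhds hp)

theorem LaurentDecomposition.desingularization_eq (L : LaurentDecomposition Ω) (ε : ℝ)
    (hp : |x p| < L.δ) : L.desingularization f ε p =
      wedge (dFun (fun q => scaledProfile k f ε (x q)) p) (L.coeff p) + L.β p :=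
  if_pos hp

/-- Away from the hypersurface the desingularization does not change the form. -/
theorem LaurentDecomposition.desingularization_eq_toForm (L : LaurentDecomposition Ω)
    (hx : IsDefiningFunction (d := d) x) (hf : IsProfile k f) {ε : ℝ} (hε : 0 < ε)
    (hp : 2 * ε ≤ |x p|) : L.desingularization f ε p = Ω.toForm p := by
  by_cases h : |x p| < L.δ
  · have hp0 : x p ≠ 0 := by
      intro h0
      rw [h0, abs_zero] at hp
      linarith
    rw [L.desingularization_eq ε h, EqAt.toForm_eq (L.eqAt p h) hp0,
      dFun_comp ((hf.hasDerivAt_scaledProfile ε _).differentiableAt) (hx.mdifferentiable p),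
      hf.deriv_scaledProfile_outer hε hp]
    rfl
  · exact if_neg h

/-- The defining function has nonzero differential in coordinates. -/
theorem IsDefiningFunction.fderiv_ne_zero (hx : IsDefiningFunction (d := d) x) {κ : M → Model d}
    {σ : Model d → M} (h : LocalCoord κ σ p) (hp : x p = 0) :
    fderiv ℝ (fun y => x (σ y)) (κ p) ≠ 0 := by
  intro h0
  have h1 : (fun y => x (σ y)) ∘ κ =ᶠ[𝓝 p] x := h.left_inv.mono fun q hq => by simp [hq]
  have h2 := mfderiv_comp p (I' := 𝓡 d) (I'' := 𝓘(ℝ, ℝ)) (g := fun y => x (σ y)) (f := κ)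
    ((h.contDiffAt_comp_symm hx.smooth.contMDiffAt).differentiableAt (by simp)).mdifferentiableAt
    (h.smooth.mdifferentiableAt (by simp))
  refine hx.regular p hp (ContinuousLinearMap.ext fun v => ?_)
  have h3 : (mfderiv (𝓡 d) 𝓘(ℝ, ℝ) ((fun y => x (σ y)) ∘ κ) p : Model d →L[ℝ] ℝ) =
    mfderiv (𝓡 d) 𝓘(ℝ, ℝ) x p := h1.mfderiv_eq
  have h4 := congrArg (fun L : Model d →L[ℝ] ℝ => L v) (h3.symm.trans h2)
  refine h4.trans ?_
  rw [mfderiv_eq_fderiv, h0]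
  rfl

/-- Points off the hypersurface accumulate at each of its points. -/
theorem IsDefiningFunction.frequently_ne (hx : IsDefiningFunction (d := d) x) {κ : M → Model d}
    {σ : Model d → M} (h : LocalCoord κ σ p) : ∃ᶠ y in 𝓝 (κ p), x (σ y) ≠ 0 := by
  intro hcon
  simp only [not_not] at hcon
  have hp : x p = 0 := by simpa [h.apply_self] using hcon.self_of_nhds
  have h1 : (fun y => x (σ y)) =ᶠ[𝓝 (κ p)] fun _ => 0 := hcon
  exact hx.fderiv_ne_zero h hp (by rw [h1.fderiv_eq]; simp)

variable [IsManifold (𝓡 d) ∞ M]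

theorem LaurentDecomposition.smoothAt_coeff (L : LaurentDecomposition Ω)
    (hx : IsDefiningFunction (d := d) x) (hp : |x p| < L.δ) : SmoothAt L.coeff p :=
  SmoothAt.sum fun i _ => SmoothAt.smul (hx.smooth.contMDiffAt.pow _) (L.α_smooth i p hp)

theorem IsBSymplectic.smoothAt_toForm {m : ℕ} {Ω : BTwoForm d m x} (hΩ : IsBSymplectic Ω)
    (hx : IsDefiningFunction (d := d) x) (hp : x p ≠ 0) : SmoothAt Ω.toForm p := by
  obtain ⟨α, β, h⟩ := hΩ.smooth p
  have hne : ∀ᶠ q in 𝓝 p, x q ≠ 0 := hx.smooth.continuous.continuousAt.eventually_ne hp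
  -- The identity profile gives smoothness of dx ∧ α, which is then multiplied by the smooth
  -- function 1/xᵐ.
  have h1 : SmoothAt (fun q => wedge (dFun (fun q => id (x q)) q) (α q) + (fun _ => 0 : Form d M 2) q) p := by
    refine SmoothAt.dFun_wedge hx contDiff_id h.self_of_nhds.1 ?_
    have hl := localCoord_extChartAt (d := d) (p := p) (mem_extChartAt_source p)
    rw [hl.smoothAt_iff]
    exact contDiffAt_const (c := 0)
  have h2 : ContMDiffAt (𝓡 d) 𝓘(ℝ, ℝ) ∞ (fun q => (x q ^ m)⁻¹) p := by
    have h3 : ContDiffAt ℝ ∞ (fun t : ℝ => (t ^ m)⁻¹) (x p) :=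
      (contDiffAt_id.pow m).inv (pow_ne_zero m hp)
    exact h3.contMDiffAt.comp p hx.smooth.contMDiffAt
  refine ((SmoothAt.smul h2 h1).add h.self_of_nhds.2.1).congr ?_
  filter_upwards [h, hne] with q hq hq0
  rw [EqAt.toForm_eq hq.2.2 hq0]
  refine form_two_ext fun u v => ?_
  simp only [ContinuousAlternatingMap.add_apply, ContinuousAlternatingMap.smul_apply, wedge_apply,
    _root_.smul_apply, smul_eq_mul, id, show (0 : TangentSpace (𝓡 d) q [⋀^Fin 2]→L[ℝ] ℝ) ![u, v] = 0 from rfl]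
  ring

/-- The condition 2ε < δ makes the two formulas overlap: a point with |x| ≥ δ has a neighbourhood in
|x| > 2ε, where the form is ω by either formula. -/
theorem LaurentDecomposition.smoothAt_desingularization (L : LaurentDecomposition Ω)
    (hx : IsDefiningFunction (d := d) x) (hΩ : IsBSymplectic Ω) (hf : IsProfile k f) {ε : ℝ}
    (hε : 0 < ε) (hεδ : 2 * ε < L.δ) (p : M) : SmoothAt (L.desingularization f ε) p := by
  by_cases h : |x p| < L.δ
  · refine (SmoothAt.dFun_wedge hx (hf.contDiff_scaledProfile ε) (L.smoothAt_coeff hx h)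
      (L.β_smooth p h)).congr ?_
    filter_upwards [L.eventually_lt hx h] with q hq
    exact (L.desingularization_eq ε hq).symm
  · have h2 : 2 * ε < |x p| := hεδ.trans_le (not_lt.1 h)
    have hp : x p ≠ 0 := by
      intro h0
      rw [h0, abs_zero] at h2
      linarith
    refine (hΩ.smoothAt_toForm hx hp).congr ?_
    filter_upwards [hx.smooth.continuous.abs.continuousAt.eventually (lt_mem_nhds h2)] with q hq
    exact (L.desingularization_eq_toForm hx hf hε hq.le).symm

theorem LaurentDecomposition.localForm_desingularization (L : LaurentDecomposition Ω)
    (hx : IsDefiningFunction (d := d) x) (hf : IsProfile k f) (ε : ℝ) {κ : M → Model d}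
    {σ : Model d → M} (h : LocalCoord κ σ p) (hp : |x p| < L.δ) :
    localForm σ (L.desingularization f ε) =ᶠ[𝓝 (κ p)] fun y =>
      wedge (fderiv ℝ (fun z => scaledProfile k f ε (x (σ z))) y) (localForm σ L.coeff y) +
        localForm σ L.β y := by
  filter_upwards [h.localForm_wedge_add hx ((hf.contDiff_scaledProfile ε).differentiable (by simp))
    L.coeff L.β, h.tendsto_symm.eventually (L.eventually_lt hx hp)] with y h1 h2
  rw [← h1, localForm_def, localForm_def, L.desingularization_eq ε h2]

/-- The exterior derivative of the desingularization is that of the smooth part. -/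
theorem LaurentDecomposition.extDeriv_desingularization (L : LaurentDecomposition Ω)
    (hx : IsDefiningFunction (d := d) x) (hf : IsProfile k f) (ε : ℝ) {κ : M → Model d}
    {σ : Model d → M} (h : LocalCoord κ σ p) (hl : ∀ᶠ q in 𝓝 p, LocalCoord κ σ q)
    (hp : |x p| < L.δ) :
    extDeriv (localForm σ (L.desingularization f ε)) (κ p) = extDeriv (localForm σ L.β) (κ p) := by
  have hX := h.contDiffAt_comp_symm hx.smooth.contMDiffAt
  have hXd : ∀ᶠ z in 𝓝 (κ p), DifferentiableAt ℝ (fun y => x (σ y)) z :=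
    ((hX.of_le (m := 1) (by simp)).eventually (by simp)).mono
      fun z hz => hz.differentiableAt one_ne_zero
  have hα : ∀ i, ContDiffAt ℝ ∞ (localForm σ (L.α i)) (κ p) := fun i =>
    (h.smoothAt_iff _).1 (L.α_smooth i p hp)
  have hβ := ((h.smoothAt_iff _).1 (L.β_smooth p hp)).differentiableAt (by simp)
  have hg : ∀ i : ℕ, ContDiff ℝ ∞ fun t => deriv (scaledProfile k f ε) t * t ^ i := fun i =>
    ((contDiff_infty_iff_deriv.1 (hf.contDiff_scaledProfile ε)).2).mul (contDiff_id.pow i)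
  let Θ : Fin (2 * k + 1) → Model d → (Model d) [⋀^Fin 2]→L[ℝ] ℝ := fun i y =>
    wedge ((deriv (scaledProfile k f ε) (x (σ y)) * x (σ y) ^ (i : ℕ)) •
      fderiv ℝ (fun z => x (σ z)) y) (localForm σ (L.α i) y)
  have hev : localForm σ (L.desingularization f ε) =ᶠ[𝓝 (κ p)]
      fun y => ∑ i, Θ i y + localForm σ L.β y := by
    filter_upwards [L.localForm_desingularization hx hf ε h hp, hXd] with y h1 h2
    rw [h1]
    congr 1
    have h3 := ((hf.hasDerivAt_scaledProfile ε (x (σ y))).differentiableAt.hasDerivAt).comp_hasFDerivAt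
      y h2.hasFDerivAt
    rw [show fderiv ℝ (fun z => scaledProfile k f ε (x (σ z))) y = _ from h3.fderiv]
    rw [show localForm σ L.coeff y = ∑ i : Fin (2 * k + 1), x (σ y) ^ (i : ℕ) • localForm σ (L.α i) y from
      comp_finset_sum _ _ _]
    exact wedge_sum_smul _ _ _ _ _
  have hΘs : ∀ i, ContDiffAt ℝ ∞ (Θ i) (κ p) := fun i =>
    (((hg i).contDiffAt.comp _ hX).smul (hX.fderiv_right (by simp))).wedge (hα i)
  have hΘd : ∀ i, DifferentiableAt ℝ (Θ i) (κ p) := fun i => (hΘs i).differentiableAt (by simp)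
  rw [hev.extDeriv_eq, extDeriv_fun_add (DifferentiableAt.fun_sum fun i _ => hΘd i) hβ,
    extDeriv_finset_sum _ fun i _ => hΘd i, Finset.sum_eq_zero, zero_add]
  intro i _
  refine extDeriv_wedge_closed (hg i) hX (hα i) ?_
  filter_upwards [h.tendsto_symm.eventually (hl.and (L.eventually_lt hx hp)), h.right_inv] with z h1 h2
  have h3 := (h1.1.extD_eq_zero_iff (L.α_smooth i _ h1.2)).1 (L.α_closed i _ h1.2)
  rwa [h2] at h3

/-- The desingularization has the same exterior derivative as β, and for ε = |x p|/4 it equals the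
closed form ω near `p`. -/
theorem LaurentDecomposition.extD_β_of_ne (L : LaurentDecomposition Ω)
    (hx : IsDefiningFunction (d := d) x) (hΩ : IsBSymplectic Ω) (hf : IsProfile k f)
    (hp : |x p| < L.δ) (hp0 : x p ≠ 0) : extD L.β p = 0 := by
  have hl := localCoord_extChartAt (d := d) (p := p) (mem_extChartAt_source p)
  have hle : ∀ᶠ q in 𝓝 p, LocalCoord (extChartAt (𝓡 d) p) (extChartAt (𝓡 d) p).symm q :=
    Filter.eventually_of_mem ((isOpen_extChartAt_source p).mem_nhds (mem_extChartAt_source p))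
      fun q hq => localCoord_extChartAt hq
  have hpos : 0 < |x p| := abs_pos.2 hp0
  have hε : 0 < |x p| / 4 := by positivity
  rw [hl.extD_eq_zero_iff (L.β_smooth p hp), ← L.extDeriv_desingularization hx hf (|x p| / 4) hl hle hp,
    ← hl.extD_eq_zero_iff (L.smoothAt_desingularization hx hΩ hf hε (by linarith) p),
    ← hΩ.closed p hp0]
  refine extD_congr ?_
  filter_upwards [hx.smooth.continuous.abs.continuousAt.eventually
    (lt_mem_nhds (show 2 * (|x p| / 4) < |x p| by linarith))] with q hq
  exact L.desingularization_eq_toForm hx hf hε hq.le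

theorem localCoord_extChartAt_eventually (p : M) :
    ∀ᶠ q in 𝓝 p, LocalCoord (extChartAt (𝓡 d) p) (extChartAt (𝓡 d) p).symm q :=
  Filter.eventually_of_mem ((isOpen_extChartAt_source p).mem_nhds (mem_extChartAt_source p))
    fun _ hq => localCoord_extChartAt hq

/-- The exterior derivative of β is continuous in coordinates and vanishes at points off Z, which
accumulate at every point of Z. -/
theorem LaurentDecomposition.extD_β (L : LaurentDecomposition Ω)
    (hx : IsDefiningFunction (d := d) x) (hΩ : IsBSymplectic Ω) (hf : IsProfile k f)
    (hp : |x p| < L.δ) : extD L.β p = 0 := by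
  have hl := localCoord_extChartAt (d := d) (p := p) (mem_extChartAt_source p)
  have hle := localCoord_extChartAt_eventually (d := d) p
  have hs := (hl.smoothAt_iff _).1 (L.β_smooth p hp)
  rw [hl.extD_eq_zero_iff (L.β_smooth p hp)]
  have hc : ContinuousAt (extDeriv (localForm (extChartAt (𝓡 d) p).symm L.β)) (extChartAt (𝓡 d) p p) := by
    have h1 : ContDiffAt ℝ ∞ (fderiv ℝ (localForm (extChartAt (𝓡 d) p).symm L.β))
      (extChartAt (𝓡 d) p p) := hs.fderiv_right (by simp)
    exact (ContinuousAlternatingMap.alternatizeUncurryFinCLM ℝ (Model d) ℝ).continuous.continuousAt.comp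
      h1.continuousAt
  refine Set.mem_singleton_iff.1 (IsClosed.mem_of_frequently_of_tendsto isClosed_singleton ?_ hc)
  refine ((hx.frequently_ne hl).and_eventually (hl.right_inv.and
    (hl.tendsto_symm.eventually (hle.and (L.eventually_lt hx hp))))).mono ?_
  rintro y ⟨h1, h2, h3, h4⟩
  have h5 := (h3.extD_eq_zero_iff (L.β_smooth _ h4)).1 (L.extD_β_of_ne hx hΩ hf h4 h1)
  rw [h2] at h5
  exact h5

theorem LaurentDecomposition.extD_desingularization (L : LaurentDecomposition Ω)
    (hx : IsDefiningFunction (d := d) x) (hΩ : IsBSymplectic Ω) (hf : IsProfile k f) {ε : ℝ}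
    (hε : 0 < ε) (hεδ : 2 * ε < L.δ) (p : M) : extD (L.desingularization f ε) p = 0 := by
  have hl := localCoord_extChartAt (d := d) (p := p) (mem_extChartAt_source p)
  by_cases h : |x p| < L.δ
  · rw [hl.extD_eq_zero_iff (L.smoothAt_desingularization hx hΩ hf hε hεδ p),
      L.extDeriv_desingularization hx hf ε hl (localCoord_extChartAt_eventually p) h,
      ← hl.extD_eq_zero_iff (L.β_smooth p h)]
    exact L.extD_β hx hΩ hf h
  · have h2 : 2 * ε < |x p| := hεδ.trans_le (not_lt.1 h)
    have hp : x p ≠ 0 := by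
      intro h0
      rw [h0, abs_zero] at h2
      linarith
    rw [← hΩ.closed p hp]
    refine extD_congr ?_
    filter_upwards [hx.smooth.continuous.abs.continuousAt.eventually (lt_mem_nhds h2)] with q hq
    exact L.desingularization_eq_toForm hx hf hε hq.le

end Odd

/-! ### Uniformity over the compact manifold -/

section Main

/-- The tube lemma in filter form: a property that holds locally in `y`, jointly with the parameter,
holds eventually for all `y` at once. -/
theorem eventually_forall_of_compactSpace {X Y : Type*} [TopologicalSpace Y] [CompactSpace Y]
    {l : Filter X} {P : Y → X → Prop} (h : ∀ y, ∀ᶠ q : Y × X in 𝓝 y ×ˢ l, P q.1 q.2) :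
    ∀ᶠ x in l, ∀ y, P y x := by
  have h1 : {q : Y × X | P q.1 q.2} ∈ 𝓝ˢ Set.univ ×ˢ l :=
    isCompact_univ.mem_nhdsSet_prod_of_forall fun y _ => h y
  rw [nhdsSet_univ] at h1
  have h2 : ∀ᶠ q : Y × X in ⊤ ×ˢ l, P q.1 q.2 := h1
  rw [Filter.eventually_prod_iff] at h2
  obtain ⟨pa, ha, pb, hb, h3⟩ := h2
  exact hb.mono fun x hx y => h3 (Filter.eventually_top.1 ha y) hx

variable {n k : ℕ} {M : Type*} [TopologicalSpace M] [ChartedSpace (Model (2 * n)) M]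
  [IsManifold (𝓡 (2 * n)) ∞ M] {x : M → ℝ} {Ω : BTwoForm (2 * n) (2 * k + 1) x} {p : M} {f : ℝ → ℝ}

/-- A form that is nondegenerate at a point satisfies the fold condition there. -/
theorem foldAt_of_nondegenerate {η : Form (2 * n) M 2}
    (h : ∀ u, (∀ v, η p ![u, v] = 0) → u = 0) :
    FoldAt (inChart η p) (extChartAt (𝓡 (2 * n)) p p) := by
  have hl := localCoord_extChartAt (d := 2 * n) (p := p) (mem_extChartAt_source p)
  intro h0
  exfalso
  let e := (EuclideanSpace.basisFun (Fin (2 * n)) ℝ).toBasis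
  have he : ⇑e = EuclideanSpace.basisFun (Fin (2 * n)) ℝ := OrthonormalBasis.coe_toBasis _
  refine wedgePow_ne_zero_of_nondegenerate e (Ω := inChart η p (extChartAt (𝓡 (2 * n)) p p))
    (fun u hu => ?_) (by rw [he]; exact h0)
  have h1 : ∀ q, q = p → ∀ u, (∀ v, η q ![u, v] = 0) → u = 0 := by rintro q rfl; exact h
  have h2 : (mfderiv (𝓡 (2 * n)) (𝓡 (2 * n)) (extChartAt (𝓡 (2 * n)) p).symm
      (extChartAt (𝓡 (2 * n)) p p) u : Model (2 * n)) = 0 := by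
    refine h1 _ hl.apply_self _ fun v => ?_
    have h3 := hu (mfderiv (𝓡 (2 * n)) (𝓡 (2 * n)) (extChartAt (𝓡 (2 * n)) p)
        ((extChartAt (𝓡 (2 * n)) p).symm (extChartAt (𝓡 (2 * n)) p p)) v)
    refine (Eq.trans ?_ (comp_apply_two _ _ _ _).symm).trans h3
    congr 2
    exact congrArg (fun w : Model (2 * n) => ![w]) (hl.mfderiv_symm_mfderiv_base v).symm
  have h3 := hl.mfderiv_mfderiv_symm u
  rw [← h3]
  exact (congrArg (mfderiv (𝓡 (2 * n)) (𝓡 (2 * n)) (extChartAt (𝓡 (2 * n)) p)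
    ((extChartAt (𝓡 (2 * n)) p).symm (extChartAt (𝓡 (2 * n)) p p))) h2).trans (map_zero _)

/-- On Z this is the local statement in the chart at `z`, carried to the preferred charts of nearby
points. Off Z, |x| stays away from 0 near `z`, so for small ε the form is the nondegenerate ω. -/
theorem LaurentDecomposition.eventually_foldAt (L : LaurentDecomposition Ω)
    (hx : IsDefiningFunction (d := 2 * n) x) (hΩ : IsBSymplectic Ω) (hf : IsProfile k f) (z : M) :
    ∀ᶠ q : M × ℝ in 𝓝 z ×ˢ 𝓝[>] 0, FoldAt (inChart (L.desingularization f q.2) q.1)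
      (extChartAt (𝓡 (2 * n)) q.1 q.1) := by
  have hδ : ∀ᶠ ε : ℝ in 𝓝[>] 0, 0 < ε ∧ 2 * ε < L.δ := by
    have := L.δ_pos
    filter_upwards [Ioo_mem_nhdsGT (show (0 : ℝ) < L.δ / 2 by linarith)] with ε hε
    exact ⟨hε.1, by linarith [hε.2]⟩
  by_cases hz : x z = 0
  · have hzδ : |x z| < L.δ := by rw [hz, abs_zero]; exact L.δ_pos
    have hl := localCoord_extChartAt (d := 2 * n) (p := z) (mem_extChartAt_source z)
    set κ := extChartAt (𝓡 (2 * n)) z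
    have hX := hl.contDiffAt_comp_symm hx.smooth.contMDiffAt
    have ha := (hl.smoothAt_iff _).1 (L.smoothAt_coeff hx hzδ)
    have hb := (hl.smoothAt_iff _).1 (L.β_smooth z hzδ)
    have hnd : BNondegenerate (fderiv ℝ (fun y => x (κ.symm y)) (κ z))
        (localForm κ.symm L.coeff (κ z)) (localForm κ.symm L.β (κ z)) := by
      rw [fderiv_comp_eq_dFun (hx.mdifferentiable _) (hl.smooth_symm.mdifferentiableAt (by simp))]
      have h1 : ∀ q, q = z → BNondegenerate (dFun x q) (L.coeff q) (L.β q) := by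
        rintro q rfl
        exact hΩ.bNondegenerate (by omega) hz (L.eqAt _ hzδ)
      exact BNondegenerate.comp (h1 _ hl.apply_self)
        (A' := mfderiv (𝓡 (2 * n)) (𝓡 (2 * n)) κ (κ.symm (κ z)))
        hl.mfderiv_mfderiv_symm hl.mfderiv_symm_mfderiv_base
    have hfold := BSymp.eventually_foldAt hf hX ha hb (by rw [hl.apply_self]; exact hz)
      (hx.fderiv_ne_zero hl hz) hnd
    have ht : Filter.Tendsto (fun q : M × ℝ => (κ q.1, q.2)) (𝓝 z ×ˢ 𝓝[>] 0) (𝓝 (κ z) ×ˢ 𝓝[>] 0) :=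
      hl.smooth.continuousAt.tendsto.prodMap Filter.tendsto_id
    filter_upwards [ht.eventually hfold,
      ((localCoord_extChartAt_eventually (d := 2 * n) z).and (L.eventually_lt hx hzδ)).prod_mk hδ]
      with q h1 h2
    obtain ⟨q, ε⟩ := q
    obtain ⟨⟨hq, hqδ⟩, hε, hεδ⟩ := h2
    simp only at h1 hq hqδ hε hεδ ⊢
    exact hq.foldAt_change (localCoord_extChartAt (mem_extChartAt_source q))
      (L.smoothAt_desingularization hx hΩ hf hε hεδ q)
      (h1.congr (L.localForm_desingularization hx hf ε hq hqδ).symm)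
  · have hpos : 0 < |x z| := abs_pos.2 hz
    have h1 : ∀ᶠ q in 𝓝 z, |x z| / 2 < |x q| :=
      hx.smooth.continuous.abs.continuousAt.eventually (lt_mem_nhds (by linarith))
    have h2 : ∀ᶠ ε : ℝ in 𝓝[>] 0, 0 < ε ∧ 2 * ε < |x z| / 2 := by
      filter_upwards [Ioo_mem_nhdsGT (show (0 : ℝ) < |x z| / 4 by linarith)] with ε hε
      exact ⟨hε.1, by linarith [hε.2]⟩
    filter_upwards [h1.prod_mk h2] with q hq
    obtain ⟨q, ε⟩ := q
    obtain ⟨hq1, hε, hq2⟩ := hq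
    simp only at hq1 hε hq2 ⊢
    refine foldAt_of_nondegenerate ?_
    rw [L.desingularization_eq_toForm hx hf hε (by linarith)]
    exact hΩ.toForm_nondegenerate (by rintro h0; rw [h0, abs_zero] at hq1; linarith)

/-- The desingularization is folded symplectic for small parameters. -/
theorem LaurentDecomposition.exists_isFoldedSymplectic [CompactSpace M] (L : LaurentDecomposition Ω)
    (hx : IsDefiningFunction (d := 2 * n) x) (hΩ : IsBSymplectic Ω) (hf : IsProfile k f) :
    ∃ ε₀ : ℝ, 0 < ε₀ ∧ ∀ ε : ℝ, 0 < ε → ε < ε₀ →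
      IsFoldedSymplectic (L.desingularization f ε) ∧
      ∀ p : M, 2 * ε ≤ |x p| → L.desingularization f ε p = Ω.toForm p := by
  have h1 : ∀ᶠ ε : ℝ in 𝓝[>] 0, ∀ p ∈ (Set.univ : Set M),
      FoldAt (inChart (L.desingularization f ε) p) (extChartAt (𝓡 (2 * n)) p p) := by
    exact (eventually_forall_of_compactSpace (L.eventually_foldAt hx hΩ hf)).mono fun ε h p _ => h p
  obtain ⟨ρ, hρ, h2⟩ := mem_nhdsGT_iff_exists_Ioo_subset.1 h1
  have hδ := L.δ_pos
  refine ⟨min ρ (L.δ / 2), lt_min hρ (by linarith), fun ε hε hε' => ⟨?_, fun p hp =>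
    L.desingularization_eq_toForm hx hf hε hp⟩⟩
  have hεδ : 2 * ε < L.δ := by linarith [hε'.trans_le (min_le_right _ _)]
  exact isFoldedSymplectic_of_foldAt (L.smoothAt_desingularization hx hΩ hf hε hεδ)
    (L.extD_desingularization hx hΩ hf hε hεδ)
    fun p => h2 ⟨hε, hε'.trans_le (min_le_left _ _)⟩ p trivial

end Main

/-! ### The smooth inverse function theorem for germs -/

section LocalInverse

variable {E : Type*} [NormedAddCommGroup E] [NormedSpace ℝ E] [FiniteDimensional ℝ E]

/-- The inverse function theorem for germs of smooth maps. -/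
theorem exists_smooth_local_inverse {g : E → E} {y : E} (hg : ∀ᶠ z in 𝓝 y, ContDiffAt ℝ ∞ g z)
    (hinj : ∀ u, fderiv ℝ g y u = 0 → u = 0) :
    ∃ h : E → E, (∀ᶠ w in 𝓝 (g y), ContDiffAt ℝ ∞ h w) ∧ (∀ᶠ z in 𝓝 y, h (g z) = z) ∧
      ∀ᶠ w in 𝓝 (g y), g (h w) = w := by
  have : CompleteSpace E := FiniteDimensional.complete ℝ E
  have hgy := hg.self_of_nhds
  have hinj' : Function.Injective (fderiv ℝ g y : E →ₗ[ℝ] E) :=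
    (injective_iff_map_eq_zero _).2 hinj
  let A : E ≃L[ℝ] E := (LinearEquiv.ofInjectiveEndo _ hinj').toContinuousLinearEquiv
  have hA : (A : E →L[ℝ] E) = fderiv ℝ g y := by ext u; rfl
  have hd : HasFDerivAt g (A : E →L[ℝ] E) y := by
    rw [hA]; exact (hgy.differentiableAt (by simp)).hasFDerivAt
  let Φ := hgy.toOpenPartialHomeomorph g hd (by simp)
  have hΦ : (Φ : E → E) = g := rfl
  have hys : y ∈ Φ.source := hgy.mem_toOpenPartialHomeomorph_source hd (by simp)
  have hyt : g y ∈ Φ.target := hgy.image_mem_toOpenPartialHomeomorph_target hd (by simp)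
  have hsy : Φ.symm (g y) = y := Φ.left_inv hys
  have hc : Filter.Tendsto Φ.symm (𝓝 (g y)) (𝓝 y) := by
    have := Φ.continuousAt_symm hyt
    rwa [ContinuousAt, hsy] at this
  -- Invertible linear maps form an open set; this gives smoothness of the inverse on a
  -- neighbourhood and not only at `g y`.
  have hequiv : ∀ᶠ z in 𝓝 y, ∃ B : E ≃L[ℝ] E, (B : E →L[ℝ] E) = fderiv ℝ g z := by
    have h1 : ContinuousAt (fderiv ℝ g) y := (hgy.fderiv_right (m := 0) (by simp)).continuousAt
    refine h1.eventually (p := fun L => ∃ B : E ≃L[ℝ] E, (B : E →L[ℝ] E) = L) ?_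
    rw [← hA]
    exact A.nhds
  refine ⟨Φ.symm, ?_, ?_, ?_⟩
  · filter_upwards [Φ.open_target.mem_nhds hyt, hc.eventually hequiv, hc.eventually hg] with w h1 h2 h3
    obtain ⟨B, hB⟩ := h2
    refine Φ.contDiffAt_symm (f₀' := B) h1 ?_ h3
    rw [hB]
    exact (h3.differentiableAt (by simp)).hasFDerivAt
  · filter_upwards [Φ.open_source.mem_nhds hys] with z hz
    exact Φ.left_inv hz
  · filter_upwards [Φ.open_target.mem_nhds hyt] with w hw
    exact Φ.right_inv hw

end LocalInverse

/-! ### Coordinates adapted to the hypersurface and the retraction onto it -/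

section Coordinates

variable {d : ℕ} {M : Type*} [TopologicalSpace M] [ChartedSpace (Model d) M]

theorem LocalCoord.eventually_symm {κ : M → Model d} {σ : Model d → M} {p : M}
    (h : ∀ᶠ q in 𝓝 p, LocalCoord κ σ q) :
    ∀ᶠ y in 𝓝 (κ p), LocalCoord κ σ (σ y) ∧ κ (σ y) = y :=
  (h.self_of_nhds.tendsto_symm.eventually h).and h.self_of_nhds.right_inv

/-- Local coordinates may be changed by a smooth germ with invertible derivative. -/
theorem LocalCoord.exists_comp {κ : M → Model d} {σ : Model d → M} {p : M}
    (h : ∀ᶠ q in 𝓝 p, LocalCoord κ σ q) {G : Model d → Model d}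
    (hG : ∀ᶠ y in 𝓝 (κ p), ContDiffAt ℝ ∞ G y)
    (hinj : ∀ u, fderiv ℝ G (κ p) u = 0 → u = 0) :
    ∃ σ' : Model d → M, ∀ᶠ q in 𝓝 p, LocalCoord (fun q => G (κ q)) σ' q := by
  obtain ⟨g, hg, hgl, hgr⟩ := exists_smooth_local_inverse hG hinj
  have hκ := h.self_of_nhds.smooth.continuousAt
  have hGκ : ContinuousAt (fun q => G (κ q)) p :=
    ContinuousAt.comp (f := κ) hG.self_of_nhds.continuousAt hκ
  refine ⟨fun w => σ (g w), ?_⟩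
  filter_upwards [h, hκ.eventually hG, hGκ.eventually hg, hκ.eventually hgl.eventually_nhds,
    hGκ.eventually hgr.eventually_nhds] with q h1 h2 h3 h4 h5
  have e1 : g (G (κ q)) = κ q := h4.self_of_nhds
  refine ⟨?_, ?_, ?_, ?_⟩
  · exact ContMDiffAt.comp (g := G) q (contMDiffAt_iff_contDiffAt.2 h2) h1.smooth
  · refine ContMDiffAt.comp (g := σ) (G (κ q)) ?_ (contMDiffAt_iff_contDiffAt.2 h3)
    rw [e1]; exact h1.smooth_symm
  · filter_upwards [h1.smooth.continuousAt.eventually h4, h1.left_inv] with q' a b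
    rw [a, b]
  · have hc : Filter.Tendsto g (𝓝 (G (κ q))) (𝓝 (κ q)) := by
      have := h3.continuousAt
      rwa [ContinuousAt, e1] at this
    filter_upwards [hc.eventually h1.right_inv, h5] with w a b
    rw [a, b]

/-- Local coordinates `κ` near `z`, with inverse `σ`, in which the function `x` is the linear form
`ℓ`, and a vector `e` with `ℓ e = 1`. -/
structure StraightCoord (x : M → ℝ) (ℓ : Model d →L[ℝ] ℝ) (e : Model d) (κ : M → Model d)
    (σ : Model d → M) (z : M) : Prop where
  apply_e : ℓ e = 1
  coord : ∀ᶠ q in 𝓝 z, LocalCoord κ σ q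
  eq : ∀ᶠ q in 𝓝 z, x q = ℓ (κ q)

variable {x : M → ℝ} {z : M}

theorem StraightCoord.eq_symm {ℓ : Model d →L[ℝ] ℝ} {e : Model d} {κ : M → Model d}
    {σ : Model d → M} (h : StraightCoord x ℓ e κ σ z) : ∀ᶠ y in 𝓝 (κ z), x (σ y) = ℓ y := by
  filter_upwards [h.coord.self_of_nhds.tendsto_symm.eventually h.eq,
    h.coord.self_of_nhds.right_inv] with y h1 h2
  rw [h1, h2]

/-- The map `P` is, near `Z`, a smooth map fixing `Z`. -/
structure FixesZeros (x : M → ℝ) (P : M → M) : Prop where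
  smooth : ∀ᶠ p in 𝓝ˢ {z | x z = 0}, ContMDiffAt (𝓡 d) (𝓡 d) ∞ P p
  eq_self : ∀ z, x z = 0 → P z = z

theorem FixesZeros.tendsto {P : M → M} (h : FixesZeros (d := d) x P) (hz : x z = 0) :
    Filter.Tendsto P (𝓝 z) (𝓝 z) := by
  have := ((eventually_nhdsSet_iff_forall.1 h.smooth) z hz).self_of_nhds.continuousAt
  rwa [ContinuousAt, h.eq_self z hz] at this

variable [IsManifold (𝓡 d) ∞ M]

/-- Shifting the chart along `e` by X - ℓ, where ℓ = dX at the base point and ℓ e = 1, gives ℓ ∘ G =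
X. The shift vanishes to first order up to a constant, so the derivative of `G` there is the
identity. -/
theorem IsDefiningFunction.exists_straightCoord (hx : IsDefiningFunction (d := d) x)
    (hz : x z = 0) : ∃ (ℓ : Model d →L[ℝ] ℝ) (e : Model d) (κ : M → Model d) (σ : Model d → M),
      StraightCoord x ℓ e κ σ z := by
  have hle := localCoord_extChartAt_eventually (d := d) z
  have hl := hle.self_of_nhds
  set κ := extChartAt (𝓡 d) z
  set X : Model d → ℝ := fun y => x (κ.symm y)
  have hX : ∀ᶠ y in 𝓝 (κ z), ContDiffAt ℝ ∞ X y := by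
    filter_upwards [LocalCoord.eventually_symm hle] with y hy
    have := hy.1.contDiffAt_comp_symm hx.smooth.contMDiffAt
    rwa [hy.2] at this
  have hℓ : fderiv ℝ X (κ z) ≠ 0 := hx.fderiv_ne_zero hl hz
  set ℓ := fderiv ℝ X (κ z)
  obtain ⟨v, hv⟩ : ∃ v, ℓ v ≠ 0 := by
    by_contra! hcon
    exact hℓ (ContinuousLinearMap.ext hcon)
  let e := (ℓ v)⁻¹ • v
  have he : ℓ e = 1 := by simp [e, hv]
  let G : Model d → Model d := fun y => y + (X y - ℓ y) • e
  have hG : ∀ᶠ y in 𝓝 (κ z), ContDiffAt ℝ ∞ G y := hX.mono fun y hy =>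
    contDiffAt_id.add ((hy.sub ℓ.contDiff.contDiffAt).smul contDiffAt_const)
  have hGd : HasFDerivAt G (ContinuousLinearMap.id ℝ (Model d)) (κ z) := by
    have h1 : HasFDerivAt X ℓ (κ z) :=
      (hX.self_of_nhds.differentiableAt (by simp)).hasFDerivAt
    have h2 := (hasFDerivAt_id (𝕜 := ℝ) (κ z)).add ((h1.sub ℓ.hasFDerivAt).smul_const e)
    refine h2.congr_fderiv ?_
    ext1 v
    simp
  obtain ⟨σ, hσ⟩ := LocalCoord.exists_comp hle hG fun u hu => by
    rw [hGd.fderiv] at hu; exact hu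
  refine ⟨ℓ, e, _, σ, he, hσ, ?_⟩
  filter_upwards [hl.left_inv] with q hq
  simp only [G, map_add, map_smul, he, smul_eq_mul, mul_one, X]
  rw [hq]; ring

/-- Near a zero `z`, a smooth map fixing `Z` can be pushed into `Z` by a motion supported near `z`. -/
theorem IsDefiningFunction.exists_push [T2Space M] (hx : IsDefiningFunction (d := d) x)
    (hz : x z = 0) : ∃ χ : M → ℝ, (∀ᶠ p in 𝓝 z, χ p = 1) ∧ ∀ P : M → M, FixesZeros (d := d) x P →
      ∃ P' : M → M, FixesZeros (d := d) x P' ∧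
        ∀ w, x w = 0 → ∀ᶠ p in 𝓝 w, x (P' p) = x (P p) * (1 - χ p) := by
  obtain ⟨ℓ, e, κ, σ, h⟩ := hx.exists_straightCoord hz
  obtain ⟨W, hWsub, hWo, hzW⟩ := eventually_nhds_iff.1 (h.coord.and h.eq)
  obtain ⟨χ, -, hχ⟩ := (SmoothBumpFunction.nhds_basis_tsupport (I := 𝓡 d) z).mem_iff.1
    (hWo.mem_nhds hzW)
  refine ⟨χ, χ.eventuallyEq_one, fun P hP => ?_⟩
  classical
  -- In straight coordinates x is ℓ, so this shift along `e` multiplies x(P p) by 1 - χ. It moves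
  -- nothing on Z, where x(P p) = 0.
  let Q : M → M := fun p => σ (κ (P p) - (χ p * x (P p)) • e)
  let P' : M → M := fun p => if p ∈ tsupport χ then Q p else P p
  have hout : ∀ w, w ∉ tsupport χ → P' =ᶠ[𝓝 w] P := fun w hw => by
    filter_upwards [(isClosed_tsupport χ).isOpen_compl.mem_nhds hw] with p hp
    exact if_neg hp
  -- The two branches of `P'` match across the edge of the support, since χ = 0 turns `Q p` into
  -- σ(κ(P p)) = P p.
  have hin : ∀ w, x w = 0 → w ∈ tsupport χ → P' =ᶠ[𝓝 w] Q := fun w hw hwt => by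
    have hc := (hWsub w (hχ hwt)).1
    filter_upwards [(hP.tendsto hw).eventually hc.left_inv] with p hp
    by_cases h1 : p ∈ tsupport χ
    · exact if_pos h1
    · have h2 : χ p = 0 := image_eq_zero_of_notMem_tsupport h1
      simp only [P', if_neg h1, Q, h2, zero_mul, zero_smul, sub_zero, hp]
  have hfix : ∀ w, x w = 0 → P' w = w := fun w hw => by
    by_cases hwt : w ∈ tsupport χ
    · have hc := (hWsub w (hχ hwt)).1
      rw [(hin w hw hwt).self_of_nhds]
      simp only [Q, hP.eq_self w hw, hw, mul_zero, zero_smul, sub_zero, hc.apply_self]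
    · rw [(hout w hwt).self_of_nhds, hP.eq_self w hw]
  have hPs := eventually_nhdsSet_iff_forall.1 hP.smooth
  have htend : ∀ w, x w = 0 → w ∈ tsupport χ →
      Filter.Tendsto (fun p => κ (P p) - (χ p * x (P p)) • e) (𝓝 w) (𝓝 (κ w)) := by
    intro w hw hwt
    have hc := (hWsub w (hχ hwt)).1
    have h1 : Filter.Tendsto (fun p => κ (P p)) (𝓝 w) (𝓝 (κ w)) :=
      hc.smooth.continuousAt.tendsto.comp (hP.tendsto hw)
    have h2 : Filter.Tendsto (fun p => x (P p)) (𝓝 w) (𝓝 0) := by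
      rw [← hw]
      exact hx.smooth.continuous.continuousAt.tendsto.comp (hP.tendsto hw)
    have h3 : Filter.Tendsto χ (𝓝 w) (𝓝 (χ w)) := χ.continuous.continuousAt
    simpa using h1.sub ((h3.mul h2).smul_const e)
  refine ⟨P', ⟨eventually_nhdsSet_iff_forall.2 fun w hw => ?_, hfix⟩, fun w hw => ?_⟩
  · by_cases hwt : w ∈ tsupport χ
    · have hc : ∀ᶠ q in 𝓝 w, LocalCoord κ σ q :=
        Filter.eventually_of_mem (hWo.mem_nhds (hχ hwt)) fun q hq => (hWsub q hq).1
      filter_upwards [(hin w hw hwt).eventually_nhds, hPs w hw, (hP.tendsto hw).eventually hc,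
        (htend w hw hwt).eventually (LocalCoord.eventually_symm hc)] with p h1 h2 h3 h4
      refine ContMDiffAt.congr_of_eventuallyEq ?_ h1
      have h5 : ContMDiffAt (𝓡 d) (𝓡 d) ∞ σ (κ (P p) - (χ p * x (P p)) • e) := by
        have := h4.1.smooth_symm
        rwa [h4.2] at this
      refine ContMDiffAt.comp (g := σ) p h5 ?_
      have h6 : ContMDiffAt (𝓡 d) (𝓡 d) ∞ (fun p => κ (P p)) p :=
        ContMDiffAt.comp (g := κ) p h3.smooth h2
      have h7 : ContMDiffAt (𝓡 d) 𝓘(ℝ, ℝ) ∞ (fun p => x (P p)) p :=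
        ContMDiffAt.comp (g := x) p hx.smooth.contMDiffAt h2
      exact h6.sub ((χ.contMDiff.contMDiffAt.mul h7).smul contMDiffAt_const)
    · filter_upwards [(hout w hwt).eventually_nhds, hPs w hw] with p h1 h2
      exact h2.congr_of_eventuallyEq h1
  · by_cases hwt : w ∈ tsupport χ
    · have hW : ∀ᶠ q in 𝓝 w, q ∈ W := hWo.mem_nhds (hχ hwt)
      have hc := (hWsub w (hχ hwt)).1
      filter_upwards [hin w hw hwt, (hP.tendsto hw).eventually hW,
        (htend w hw hwt).eventually hc.right_inv,
        (hc.tendsto_symm.comp (htend w hw hwt)).eventually hW] with p h1 h2 h3 h4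
      rw [h1, (hWsub (Q p) h4).2]
      simp only [Q] at h3 ⊢
      rw [h3, map_sub, map_smul, h.apply_e, ← (hWsub _ h2).2, smul_eq_mul]
      ring
    · filter_upwards [hout w hwt, (isClosed_tsupport χ).isOpen_compl.mem_nhds hwt] with p h1 h2
      rw [h1, image_eq_zero_of_notMem_tsupport h2]
      ring

/-- A smooth retraction of a neighbourhood of `Z` onto `Z`. -/
theorem IsDefiningFunction.exists_retraction [T2Space M] [CompactSpace M]
    (hx : IsDefiningFunction (d := d) x) : ∃ r : M → M, FixesZeros (d := d) x r ∧
      ∀ᶠ p in 𝓝ˢ {z | x z = 0}, x (r p) = 0 := by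
  have hK : IsCompact {z | x z = 0} :=
    (isClosed_singleton.preimage hx.smooth.continuous).isCompact
  suffices H : ∀ P : M → M, FixesZeros (d := d) x P → ∃ P', FixesZeros (d := d) x P' ∧
      (∀ w ∈ {z | x z = 0}, x w = 0 → ∀ᶠ p in 𝓝 w, x (P' p) = 0) ∧
      ∀ w, x w = 0 → (∀ᶠ p in 𝓝 w, x (P p) = 0) → ∀ᶠ p in 𝓝 w, x (P' p) = 0 by
    obtain ⟨r, h1, h2, -⟩ := H id
      ⟨Filter.Eventually.of_forall fun p => contMDiffAt_id, fun _ _ => rfl⟩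
    exact ⟨r, h1, eventually_nhdsSet_iff_forall.2 fun w hw => h2 w hw hw⟩
  -- Compact induction over the part of Z already treated. The last clause, that a push keeps
  -- whatever already maps into Z, is what allows pushes from different charts to be composed.
  refine hK.induction_on (p := fun S => ∀ P : M → M, FixesZeros (d := d) x P →
    ∃ P', FixesZeros (d := d) x P' ∧ (∀ w ∈ S, x w = 0 → ∀ᶠ p in 𝓝 w, x (P' p) = 0) ∧
      ∀ w, x w = 0 → (∀ᶠ p in 𝓝 w, x (P p) = 0) → ∀ᶠ p in 𝓝 w, x (P' p) = 0) ?_ ?_ ?_ ?_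
  · exact fun P hP => ⟨P, hP, by simp, fun _ _ h => h⟩
  · intro S T hST hT P hP
    obtain ⟨P', h1, h2, h3⟩ := hT P hP
    exact ⟨P', h1, fun w hw => h2 w (hST hw), h3⟩
  · intro S T hS hT P hP
    obtain ⟨P', h1, h2, h3⟩ := hS P hP
    obtain ⟨P'', h4, h5, h6⟩ := hT P' h1
    refine ⟨P'', h4, fun w hw hw0 => ?_, fun w hw0 hw => h6 w hw0 (h3 w hw0 hw)⟩
    rcases hw with hw | hw
    · exact h6 w hw0 (h2 w hw hw0)
    · exact h5 w hw hw0
  · intro z hz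
    obtain ⟨χ, hχ, H⟩ := hx.exists_push hz
    refine ⟨{w | ∀ᶠ p in 𝓝 w, χ p = 1}, mem_nhdsWithin_of_mem_nhds hχ.eventually_nhds,
      fun P hP => ?_⟩
    obtain ⟨P', h1, h2⟩ := H P hP
    refine ⟨P', h1, fun w hw hw0 => ?_, fun w hw0 hw => ?_⟩
    · filter_upwards [hw, h2 w hw0] with p a b
      rw [b, a]; ring
    · filter_upwards [hw, h2 w hw0] with p a b
      rw [b, a]; ring

/-- Straight coordinates in which the map `r` is the projection along `e`. -/
structure AdaptedCoord (x : M → ℝ) (r : M → M) (ℓ : Model d →L[ℝ] ℝ) (e : Model d)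
    (κ : M → Model d) (σ : Model d → M) (z : M) : Prop extends StraightCoord x ℓ e κ σ z where
  proj : ∀ᶠ q in 𝓝 z, κ (r q) = κ q - x q • e

/-- Take G = R + ℓ e, with R the retraction in straight coordinates. As r maps into Z, ℓ ∘ R = 0 and
ℓ ∘ G = ℓ, while G is the identity on the hyperplane ℓ = 0. A vector killed by dG thus has ℓ u = 0,
and along such directions dG is the identity, so u = 0. In the coordinates G ∘ κ the retraction
subtracts x e. -/
theorem IsDefiningFunction.exists_adaptedCoord (hx : IsDefiningFunction (d := d) x) {r : M → M}
    (hr : FixesZeros (d := d) x r) (hr0 : ∀ᶠ p in 𝓝 z, x (r p) = 0) (hz : x z = 0) :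
    ∃ (ℓ : Model d →L[ℝ] ℝ) (e : Model d) (κ : M → Model d) (σ : Model d → M),
      AdaptedCoord x r ℓ e κ σ z := by
  obtain ⟨ℓ, e, κ, σ, h⟩ := hx.exists_straightCoord hz
  have hl := h.coord.self_of_nhds
  have hrs := eventually_nhdsSet_iff_forall.1 hr.smooth z hz
  have hrz := hr.tendsto hz
  let R : Model d → Model d := fun y => κ (r (σ y))
  have hR : ∀ᶠ y in 𝓝 (κ z), ContDiffAt ℝ ∞ R y := by
    filter_upwards [LocalCoord.eventually_symm h.coord, hl.tendsto_symm.eventually hrs,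
      (hrz.comp hl.tendsto_symm).eventually h.coord] with y h1 h2 h3
    have h4 : ContMDiffAt (𝓡 d) (𝓡 d) ∞ σ y := by
      have := h1.1.smooth_symm
      rwa [h1.2] at this
    exact ContMDiffAt.contDiffAt (ContMDiffAt.comp (g := κ) y h3.smooth (h2.comp y h4))
  let G : Model d → Model d := fun y => R y + ℓ y • e
  have hG : ∀ᶠ y in 𝓝 (κ z), ContDiffAt ℝ ∞ G y := hR.mono fun y hy =>
    hy.add (ℓ.contDiff.contDiffAt.smul contDiffAt_const)
  have hℓR : ∀ᶠ q in 𝓝 z, ℓ (κ (r q)) = 0 := by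
    filter_upwards [hrz.eventually h.eq, hr0] with q h1 h2
    rw [← h1, h2]
  have hℓG : ∀ᶠ y in 𝓝 (κ z), ℓ (G y) = ℓ y := by
    filter_upwards [hl.tendsto_symm.eventually hℓR] with y hy
    simp only [G, R, map_add, map_smul, h.apply_e, hy, smul_eq_mul, mul_one, zero_add]
  have hGker : ∀ᶠ y in 𝓝 (κ z), ℓ y = 0 → G y = y := by
    filter_upwards [h.eq_symm, hl.right_inv] with y h1 h2 h3
    simp only [G, R, h3, zero_smul, add_zero]
    rw [hr.eq_self _ (h1.trans h3), h2]
  have hGd := (hG.self_of_nhds.differentiableAt (by simp)).hasFDerivAt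
  have hz0 : ℓ (κ z) = 0 := by rw [← h.eq.self_of_nhds, hz]
  obtain ⟨σ', hσ'⟩ := LocalCoord.exists_comp h.coord hG fun u hu => by
    have h1 : ℓ u = 0 := by
      have h2 : fderiv ℝ (fun y => ℓ (G y)) (κ z) = ℓ := by
        rw [Filter.EventuallyEq.fderiv_eq hℓG]
        exact ℓ.fderiv
      have h3 := (ℓ.hasFDerivAt.comp (κ z) hGd).fderiv
      rw [← h2]
      refine (congrArg (fun L : Model d →L[ℝ] ℝ => L u) h3).trans ?_
      simp [hu]
    have hline : HasDerivAt (fun t : ℝ => κ z + t • u) u 0 := by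
      simpa using ((hasDerivAt_id (0 : ℝ)).smul_const u).const_add (κ z)
    have hl0 : κ z + (0 : ℝ) • u = κ z := by simp
    have h2 : HasDerivAt (fun t : ℝ => G (κ z + t • u)) (fderiv ℝ G (κ z) u) 0 := by
      refine HasFDerivAt.comp_hasDerivAt (l := G) (0 : ℝ) ?_ hline
      rwa [hl0]
    have h3 : (fun t : ℝ => G (κ z + t • u)) =ᶠ[𝓝 0] fun t => κ z + t • u := by
      have hc : Filter.Tendsto (fun t : ℝ => κ z + t • u) (𝓝 0) (𝓝 (κ z)) := by
        have := hline.continuousAt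
        rwa [ContinuousAt, hl0] at this
      filter_upwards [hc.eventually hGker] with t ht
      exact ht (by simp [hz0, h1])
    rw [← (h2.congr_of_eventuallyEq h3.symm).unique hline, hu]
  refine ⟨ℓ, e, _, σ', ⟨h.apply_e, hσ', ?_⟩, ?_⟩
  · filter_upwards [hl.smooth.continuousAt.eventually hℓG, h.eq] with q h1 h2
    rw [h1, h2]
  · filter_upwards [hrz.eventually hl.left_inv, hl.left_inv, h.eq, hℓR, hr0] with q h1 h2 h3 h4 h5
    simp only [G, R]
    rw [h1, hr.eq_self (r q) h5, h4, h2, ← h3]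
    simp

end Coordinates

/-! ### Parametric integrals and Hadamard's lemma -/

section Hadamard

universe u

variable {E : Type u} [NormedAddCommGroup E] [NormedSpace ℝ E] [FiniteDimensional ℝ E]

theorem hasFDerivAt_integral_of_contDiff {F : Type*} [NormedAddCommGroup F] [NormedSpace ℝ F]
    {φ : E × ℝ → F} (hφ : ContDiff ℝ 1 φ) (y : E) :
    HasFDerivAt (fun y => ∫ s in (0 : ℝ)..1, φ (y, s))
      (∫ s in (0 : ℝ)..1, (fderiv ℝ φ (y, s)).comp (ContinuousLinearMap.inl ℝ E ℝ)) y := by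
  have hd : Continuous fun q : E × ℝ => (fderiv ℝ φ q).comp (ContinuousLinearMap.inl ℝ E ℝ) :=
    (hφ.continuous_fderiv one_ne_zero).clm_comp continuous_const
  obtain ⟨C, hC⟩ := ((isCompact_closedBall y 1).prod
    (isCompact_Icc (a := (0 : ℝ)) (b := 1))).exists_bound_of_continuousOn hd.continuousOn
  refine intervalIntegral.hasFDerivAt_integral_of_dominated_of_fderiv_le
    (F := fun y s => φ (y, s)) (bound := fun _ => C)
    (F' := fun y s => (fderiv ℝ φ (y, s)).comp (ContinuousLinearMap.inl ℝ E ℝ))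
    (Metric.closedBall_mem_nhds y one_pos) ?_ ?_ ?_ ?_ intervalIntegrable_const ?_
  · exact Filter.Eventually.of_forall fun w =>
      (hφ.continuous.comp (by fun_prop : Continuous fun s : ℝ => (w, s))).aestronglyMeasurable
  · exact (hφ.continuous.comp
      (by fun_prop : Continuous fun s : ℝ => (y, s))).intervalIntegrable _ _
  · exact (hd.comp (by fun_prop : Continuous fun s : ℝ => (y, s))).aestronglyMeasurable
  · refine Filter.Eventually.of_forall fun s hs w hw => hC (w, s) ⟨hw, ?_⟩
    rw [Set.uIoc_of_le zero_le_one] at hs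
    exact ⟨hs.1.le, hs.2⟩
  · refine Filter.Eventually.of_forall fun s _ w _ => ?_
    exact ((hφ.differentiable one_ne_zero (w, s)).hasFDerivAt).comp w (hasFDerivAt_prodMk_left w s)

/-- Induction on the order: the derivative is again such an integral, with values in E →L F. Hence
`F` is generalized and shares the universe of `E`. -/
theorem contDiff_integral_of_contDiff_nat {n : ℕ} {F : Type u} [NormedAddCommGroup F]
    [NormedSpace ℝ F] {φ : E × ℝ → F} (hφ : ContDiff ℝ n φ) :
    ContDiff ℝ n fun y => ∫ s in (0 : ℝ)..1, φ (y, s) := by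
  induction n generalizing F with
  | zero =>
    rw [Nat.cast_zero, contDiff_zero] at *
    exact intervalIntegral.continuous_parametric_intervalIntegral_of_continuous'
      (f := fun y s => φ (y, s)) hφ 0 1
  | succ n ih =>
    have h1 : ContDiff ℝ 1 φ := hφ.of_le (by simp)
    rw [Nat.cast_succ, contDiff_succ_iff_hasFDerivAt] at *
    refine ⟨_, ?_, fun y => hasFDerivAt_integral_of_contDiff h1 y⟩
    obtain ⟨φ', h2, h3⟩ := hφ
    have h4 : fderiv ℝ φ = φ' := funext fun q => (h3 q).fderiv
    exact ih (φ := fun q => (fderiv ℝ φ q).comp (ContinuousLinearMap.inl ℝ E ℝ))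
      (by rw [h4]; exact h2.clm_comp contDiff_const)

/-- Integrals of smooth functions are smooth in the parameters. -/
theorem contDiff_integral_of_contDiff {F : Type u} [NormedAddCommGroup F]
    [NormedSpace ℝ F] {φ : E × ℝ → F} (hφ : ContDiff ℝ ∞ φ) :
    ContDiff ℝ ∞ fun y => ∫ s in (0 : ℝ)..1, φ (y, s) :=
  contDiff_infty.2 fun n => contDiff_integral_of_contDiff_nat (contDiff_infty.1 hφ n)

/-- Hadamard's lemma: a smooth germ vanishing on the hyperplane `ℓ = 0` is divisible by `ℓ`. -/
theorem exists_eq_smul_of_eq_zero {F : Type u} [NormedAddCommGroup F] [NormedSpace ℝ F]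
    [CompleteSpace F] {ℓ : E →L[ℝ] ℝ} {e : E} (he : ℓ e = 1) {f : E → F} {y : E} (hy : ℓ y = 0)
    (hf : ∀ᶠ z in 𝓝 y, ContDiffAt ℝ ∞ f z) (h0 : ∀ᶠ z in 𝓝 y, ℓ z = 0 → f z = 0) :
    ∃ g : E → F, ContDiff ℝ ∞ g ∧ ∀ᶠ z in 𝓝 y, f z = ℓ z • g z := by
  obtain ⟨ρ, hρ, hfρ⟩ := Metric.eventually_nhds_iff_ball.1 hf
  -- Cutting off makes the germ a global smooth function, so that the integral below is smooth
  -- everywhere.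
  let χ : ContDiffBump y := ⟨ρ / 4, ρ / 2, by positivity, by linarith⟩
  have hF : ContDiff ℝ ∞ fun z => χ z • f z := by
    rw [contDiff_iff_contDiffAt]
    intro z
    by_cases hz : z ∈ Metric.ball y ρ
    · exact χ.contDiff.contDiffAt.smul (hfρ z hz)
    · have h1 : z ∉ tsupport χ := by
        rw [χ.tsupport_eq]
        intro h2
        exact hz (Metric.closedBall_subset_ball (by change ρ / 2 < ρ; linarith) h2)
      refine (contDiffAt_const (c := (0 : F))).congr_of_eventuallyEq ?_
      filter_upwards [(isClosed_tsupport χ).isOpen_compl.mem_nhds h1] with w hw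
      rw [image_eq_zero_of_notMem_tsupport hw, zero_smul]
  set f₁ : E → F := fun z => χ z • f z
  -- The derivative along e on the segment from the projection of z to the hyperplane (s = 0) to z
  -- itself (s = 1); its integral in s is the quotient.
  let φ : E × ℝ → F := fun q => fderiv ℝ f₁ (q.1 - ℓ q.1 • e + (q.2 * ℓ q.1) • e) e
  have hφ : ContDiff ℝ ∞ φ := by
    refine ContDiff.clm_apply ?_ contDiff_const
    exact (hF.fderiv_right (m := ∞) (by simp)).comp (by fun_prop)
  refine ⟨_, contDiff_integral_of_contDiff hφ, ?_⟩
  have hproj : Filter.Tendsto (fun z => z - ℓ z • e) (𝓝 y) (𝓝 y) := by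
    have : Continuous fun z : E => z - ℓ z • e := by fun_prop
    simpa [hy] using this.tendsto y
  filter_upwards [hproj.eventually h0, χ.eventuallyEq_one] with z h1 h2
  have h3 : ∀ s : ℝ, HasDerivAt (fun s : ℝ => f₁ (z - ℓ z • e + (s * ℓ z) • e)) (ℓ z • φ (z, s)) s := by
    intro s
    have h4 : HasDerivAt (fun s : ℝ => z - ℓ z • e + (s * ℓ z) • e) (ℓ z • e) s := by
      simpa using (((hasDerivAt_id s).mul_const (ℓ z)).smul_const e).const_add (z - ℓ z • e)
    have h5 := ((hF.differentiable (by simp)) (z - ℓ z • e + (s * ℓ z) • e)).hasFDerivAt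
    have h6 := h5.comp_hasDerivAt s h4
    rwa [map_smul] at h6
  have h4 := intervalIntegral.integral_eq_sub_of_hasDerivAt (a := 0) (b := 1) (fun s _ => h3 s)
    ((continuous_const.smul (hφ.continuous.comp
      (by fun_prop : Continuous fun s : ℝ => (z, s)))).intervalIntegrable _ _)
  rw [intervalIntegral.integral_smul] at h4
  have h5 : f₁ z = f z := by simp only [f₁]; rw [h2]; simp
  have h6 : f₁ (z - ℓ z • e) = 0 := by
    simp only [f₁]
    rw [h1 (by simp [he]), smul_zero]
  rw [h4]
  simp [h5, h6]

end Hadamard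

/-! ### The tubular neighbourhood -/

section Tubular

variable {d : ℕ} {M : Type*} [TopologicalSpace M] [ChartedSpace (Model d) M] {x : M → ℝ} {r : M → M}
  {z : M}

section AdaptedCoord

variable {ℓ : Model d →L[ℝ] ℝ} {e : Model d} {κ : M → Model d} {σ : Model d → M}

theorem AdaptedCoord.apply_base (h : AdaptedCoord x r ℓ e κ σ z) (hz : x z = 0) : ℓ (κ z) = 0 := by
  rw [← h.eq.self_of_nhds, hz]

theorem AdaptedCoord.symm_proj (h : AdaptedCoord x r ℓ e κ σ z)
    (hr : Filter.Tendsto r (𝓝 z) (𝓝 z)) :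
    ∀ᶠ y in 𝓝 (κ z), r (σ y) = σ (y - ℓ y • e) := by
  have hl := h.coord.self_of_nhds
  filter_upwards [(hr.comp hl.tendsto_symm).eventually hl.left_inv,
    hl.tendsto_symm.eventually h.proj, hl.right_inv, h.eq_symm] with y h1 h2 h3 h4
  rw [← h4]
  rw [h3] at h2
  rw [← h2]
  exact h1.symm

/-- In adapted coordinates κ q = κ(r q) + x(q) e, so r and x together determine q. -/
theorem AdaptedCoord.eventually_injective (h : AdaptedCoord x r ℓ e κ σ z) :
    ∀ᶠ q : M × M in 𝓝 z ×ˢ 𝓝 z, r q.1 = r q.2 → x q.1 = x q.2 → q.1 = q.2 := by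
  have hl := h.coord.self_of_nhds
  filter_upwards [(h.proj.and hl.left_inv).prod_mk (h.proj.and hl.left_inv)] with q hq h1 h2
  obtain ⟨⟨a, b⟩, c, e⟩ := hq
  rw [← b, ← e]
  congr 1
  rw [h1, c, h2] at a
  exact (sub_left_injective a).symm

theorem AdaptedCoord.eventually_surjective (h : AdaptedCoord x r ℓ e κ σ z)
    (hr : Filter.Tendsto r (𝓝 z) (𝓝 z)) :
    ∀ᶠ q : M × ℝ in 𝓝 z ×ˢ 𝓝 0, x q.1 = 0 → ∃ p, r p = q.1 ∧ x p = q.2 := by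
  have hl := h.coord.self_of_nhds
  have hc : Filter.Tendsto (fun q : M × ℝ => κ q.1 + q.2 • e) (𝓝 z ×ˢ 𝓝 0) (𝓝 (κ z)) := by
    have h1 : Filter.Tendsto (fun q : M × ℝ => κ q.1) (𝓝 z ×ˢ 𝓝 0) (𝓝 (κ z)) :=
      hl.smooth.continuousAt.tendsto.comp Filter.tendsto_fst
    have h2 : Filter.Tendsto (fun q : M × ℝ => q.2) (𝓝 z ×ˢ 𝓝 0) (𝓝 0) := Filter.tendsto_snd
    simpa using h1.add (h2.smul_const e)
  filter_upwards [hc.eventually h.eq_symm, hc.eventually (h.symm_proj hr),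
    Filter.tendsto_fst.eventually h.eq, Filter.tendsto_fst.eventually hl.left_inv]
    with q h1 h2 h3 h4 h5
  have h6 : ℓ (κ q.1 + q.2 • e) = q.2 := by
    rw [map_add, ← h3, h5, map_smul, h.apply_e]; simp
  refine ⟨σ (κ q.1 + q.2 • e), ?_, ?_⟩
  · rw [h2, h6, add_sub_cancel_right, h4]
  · rw [h1, h6]

theorem AdaptedCoord.mfderiv_proj (hx : IsDefiningFunction (d := d) x)
    (hr : FixesZeros (d := d) x r) (hz : x z = 0) (h : AdaptedCoord x r ℓ e κ σ z) :
    ∀ᶠ q in 𝓝 z, ∀ (u : TangentSpace (𝓡 d) q) (v : Model d), v = mfderiv (𝓡 d) (𝓡 d) κ q u →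
      (mfderiv (𝓡 d) (𝓡 d) κ (r q) (mfderiv (𝓡 d) (𝓡 d) r q u) : Model d) =
        v - dFun (d := d) x q u • e := by
  have hrs := eventually_nhdsSet_iff_forall.1 hr.smooth z hz
  filter_upwards [h.proj.eventually_nhds, h.coord, hrs, (hr.tendsto hz).eventually h.coord]
    with q h1 h2 h3 h4 u v hv
  have e1 : (mfderiv (𝓡 d) (𝓡 d) (fun q => κ (r q)) q : TangentSpace (𝓡 d) q →L[ℝ] Model d) =
      mfderiv (𝓡 d) (𝓡 d) (fun q => κ q - x q • e) q := Filter.EventuallyEq.mfderiv_eq h1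
  have e2 := mfderiv_comp q (h4.smooth.mdifferentiableAt (by simp))
    (h3.mdifferentiableAt (by simp))
  have e3 : HasMFDerivAt (𝓡 d) 𝓘(ℝ, ℝ) x q (dFun x q) := (hx.mdifferentiable q).hasMFDerivAt
  have e4 : HasMFDerivAt (𝓡 d) (𝓡 d) (fun q => x q • e) q
      (((ContinuousLinearMap.id ℝ ℝ).smulRight e).comp (dFun x q)) :=
    HasMFDerivAt.comp q (I' := 𝓘(ℝ, ℝ)) (g := fun t : ℝ => t • e)
      (((ContinuousLinearMap.id ℝ ℝ).smulRight e).hasMFDerivAt) e3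
  have e5 := ((h2.smooth.mdifferentiableAt (by simp)).hasMFDerivAt.sub e4).mfderiv
  refine (congrArg (fun L : TangentSpace (𝓡 d) q →L[ℝ] Model d => L u) (e2.symm.trans
    (e1.trans e5))).trans ?_
  rw [hv]
  rfl

/-- The retraction and the defining function together form an immersion. -/
theorem AdaptedCoord.immersion (hx : IsDefiningFunction (d := d) x)
    (hr : FixesZeros (d := d) x r) (hz : x z = 0) (h : AdaptedCoord x r ℓ e κ σ z) :
    ∀ᶠ q in 𝓝 z, ∀ u : TangentSpace (𝓡 d) q, mfderiv (𝓡 d) (𝓡 d) r q u = 0 → dFun x q u = 0 →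
      u = 0 := by
  filter_upwards [h.mfderiv_proj hx hr hz, h.coord] with q h1 h2 u hu hu'
  obtain ⟨v, hv⟩ : ∃ v : Model d, v = mfderiv (𝓡 d) (𝓡 d) κ q u := ⟨_, rfl⟩
  have h3 := h1 u v hv
  rw [hu, hu', zero_smul, sub_zero] at h3
  have h4 : (mfderiv (𝓡 d) (𝓡 d) κ q u : Model d) = 0 :=
    hv.symm.trans (h3.symm.trans (map_zero (mfderiv (𝓡 d) (𝓡 d) κ (r q))))
  rw [← h2.mfderiv_symm_mfderiv u]
  exact (congrArg (mfderiv (𝓡 d) (𝓡 d) σ (κ q)) h4).trans (map_zero _)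

end AdaptedCoord

/-- Near a point off Z the condition |x| < δ becomes vacuous for small δ, so only points of Z matter
in the compactness arguments. -/
theorem IsDefiningFunction.eventually_le_abs (hx : IsDefiningFunction (d := d) x) (hz : x z ≠ 0) :
    ∀ᶠ q : M × ℝ in 𝓝 z ×ˢ 𝓝[>] 0, q.2 ≤ |x q.1| := by
  have h1 : 0 < |x z| / 2 := by positivity
  have h2 : ∀ᶠ p in 𝓝 z, |x z| / 2 < |x p| :=
    hx.smooth.continuous.abs.continuousAt.eventually (lt_mem_nhds (half_lt_self (by positivity)))
  have h3 : ∀ᶠ δ : ℝ in 𝓝[>] 0, δ < |x z| / 2 :=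
    nhdsWithin_le_nhds (gt_mem_nhds h1)
  filter_upwards [h2.prod_mk h3] with q hq
  exact (hq.2.trans hq.1).le

/-- What holds near `Z` holds on a tubular neighbourhood. -/
theorem IsDefiningFunction.eventually_forall_lt [CompactSpace M]
    (hx : IsDefiningFunction (d := d) x) {Q : M → Prop} (hQ : ∀ᶠ p in 𝓝ˢ {z | x z = 0}, Q p) :
    ∀ᶠ δ : ℝ in 𝓝[>] 0, ∀ p, |x p| < δ → Q p := by
  refine eventually_forall_of_compactSpace (P := fun p δ => |x p| < δ → Q p) fun y => ?_
  by_cases hy : x y = 0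
  · filter_upwards [Filter.tendsto_fst.eventually (eventually_nhdsSet_iff_forall.1 hQ y hy)]
      with q hq _
    exact hq
  · filter_upwards [hx.eventually_le_abs hy] with q hq h
    exact absurd h (not_lt.2 hq)

variable [IsManifold (𝓡 d) ∞ M]

/-- Injectivity is a compactness argument on M × M. Pairs with a point off Z are excluded by |x| <
δ, distinct points of Z are separated because r fixes them and is continuous there, and diagonal
points use adapted coordinates. Surjectivity is local in the base point, with uniform δ by
compactness. -/
theorem IsDefiningFunction.eventually_bijOn [CompactSpace M] [T2Space M]
    (hx : IsDefiningFunction (d := d) x) (hr : FixesZeros (d := d) x r)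
    (hr0 : ∀ᶠ p in 𝓝ˢ {z | x z = 0}, x (r p) = 0) : ∀ᶠ δ : ℝ in 𝓝[>] 0,
      Set.BijOn (fun p => (r p, x p)) {p | |x p| < δ} ({z | x z = 0} ×ˢ Set.Ioo (-δ) δ) := by
  have hinj : ∀ᶠ δ : ℝ in 𝓝[>] 0, ∀ q : M × M, |x q.1| < δ → |x q.2| < δ → r q.1 = r q.2 →
      x q.1 = x q.2 → q.1 = q.2 := by
    refine eventually_forall_of_compactSpace (P := fun (q : M × M) δ => |x q.1| < δ → |x q.2| < δ →
      r q.1 = r q.2 → x q.1 = x q.2 → q.1 = q.2) ?_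
    rintro ⟨y₁, y₂⟩
    rw [nhds_prod_eq]
    by_cases h1 : x y₁ = 0
    · by_cases h2 : x y₂ = 0
      · refine Filter.Eventually.mono (p := fun q : (M × M) × ℝ => r q.1.1 = r q.1.2 →
          x q.1.1 = x q.1.2 → q.1.1 = q.1.2) ?_ fun q hq _ _ => hq
        refine Filter.tendsto_fst.eventually (p := fun q : M × M => r q.1 = r q.2 →
          x q.1 = x q.2 → q.1 = q.2) ?_
        by_cases h3 : y₁ = y₂
        · subst h3
          obtain ⟨ℓ, e, κ, σ, h⟩ :=
            hx.exists_adaptedCoord hr (eventually_nhdsSet_iff_forall.1 hr0 y₁ h1) h1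
          exact h.eventually_injective
        · have h4 : Filter.Tendsto (fun q : M × M => (r q.1, r q.2)) (𝓝 y₁ ×ˢ 𝓝 y₂)
              (𝓝 (y₁, y₂)) := by
            rw [nhds_prod_eq]
            exact (hr.tendsto h1).prodMap (hr.tendsto h2)
          have h5 : ∀ᶠ q : M × M in 𝓝 (y₁, y₂), q.1 ≠ q.2 :=
            isClosed_diagonal.isOpen_compl.mem_nhds h3
          filter_upwards [h4.eventually h5] with q hq hq'
          exact absurd hq' hq
      · have h3 : Filter.Tendsto (fun q : (M × M) × ℝ => (q.1.2, q.2))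
            ((𝓝 y₁ ×ˢ 𝓝 y₂) ×ˢ 𝓝[>] 0) (𝓝 y₂ ×ˢ 𝓝[>] 0) :=
          (Filter.tendsto_snd.comp Filter.tendsto_fst).prodMk Filter.tendsto_snd
        filter_upwards [h3.eventually (hx.eventually_le_abs h2)] with q hq _ hq'
        exact absurd hq' (not_lt.2 hq)
    · have h3 : Filter.Tendsto (fun q : (M × M) × ℝ => (q.1.1, q.2))
          ((𝓝 y₁ ×ˢ 𝓝 y₂) ×ˢ 𝓝[>] 0) (𝓝 y₁ ×ˢ 𝓝[>] 0) :=
        (Filter.tendsto_fst.comp Filter.tendsto_fst).prodMk Filter.tendsto_snd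
      filter_upwards [h3.eventually (hx.eventually_le_abs h1)] with q hq hq'
      exact absurd hq' (not_lt.2 hq)
  have hsurj : ∀ᶠ δ : ℝ in 𝓝[>] 0, ∀ w : M, ∀ t, |t| < δ → x w = 0 → ∃ p, r p = w ∧ x p = t := by
    refine eventually_forall_of_compactSpace (P := fun w δ => ∀ t, |t| < δ → x w = 0 →
      ∃ p, r p = w ∧ x p = t) fun y => ?_
    by_cases hy : x y = 0
    · obtain ⟨ℓ, e, κ, σ, h⟩ :=
        hx.exists_adaptedCoord hr (eventually_nhdsSet_iff_forall.1 hr0 y hy) hy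
      obtain ⟨pa, ha, pb, hb, hab⟩ :=
        Filter.eventually_prod_iff.1 (h.eventually_surjective (hr.tendsto hy))
      obtain ⟨ρ, hρ, hbρ⟩ := Metric.eventually_nhds_iff.1 hb
      have h3 : ∀ᶠ δ : ℝ in 𝓝[>] 0, δ < ρ := nhdsWithin_le_nhds (gt_mem_nhds hρ)
      filter_upwards [ha.prod_mk h3] with q hq t ht hw
      exact hab hq.1 (hbρ (y := t) (by simpa using ht.trans hq.2)) hw
    · have h3 : ∀ᶠ w in 𝓝 y, x w ≠ 0 := hx.smooth.continuous.continuousAt.eventually_ne hy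
      filter_upwards [Filter.tendsto_fst.eventually h3] with q hq t _ hq'
      exact absurd hq' hq
  filter_upwards [hinj, hsurj, hx.eventually_forall_lt hr0] with δ h1 h2 h3
  refine ⟨fun p hp => ⟨h3 p hp, abs_lt.1 hp⟩, fun p hp q hq hpq => ?_, ?_⟩
  · exact h1 (p, q) hp hq (congrArg Prod.fst hpq) (congrArg Prod.snd hpq)
  · rintro ⟨w, t⟩ ⟨hw, ht⟩
    obtain ⟨p, hp, hp'⟩ := h2 w t (abs_lt.2 ht) hw
    refine ⟨p, ?_, by simp [hp, hp']⟩
    change |x p| < δ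
    rw [hp']
    exact abs_lt.2 ht

end Tubular

/-! ### Linear projection along the normal direction -/

section ProjAlong

variable {V : Type*} [AddCommGroup V] [Module ℝ V] [TopologicalSpace V] [IsTopologicalAddGroup V]
  [ContinuousSMul ℝ V]

/-- The projection along `e` onto the hyperplane `ℓ = 0`, where `ℓ e = 1`. -/
def projAlong (ℓ : V →L[ℝ] ℝ) (e : V) : V →L[ℝ] V := ContinuousLinearMap.id ℝ V - ℓ.smulRight e

theorem projAlong_apply (ℓ : V →L[ℝ] ℝ) (e y : V) : projAlong ℓ e y = y - ℓ y • e := rfl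

end ProjAlong

/-! ### Closedness of the Laurent coefficients in coordinates -/

section LaurentLocal

/-- Laurent coefficients are determined by their generating polynomial up to order `t ^ m`. -/
theorem eq_zero_of_sum_pow_mul_eq {m : ℕ} {K : ℕ → ℝ} {g : ℝ → ℝ} (hg : ContinuousAt g 0)
    (h : ∀ᶠ t in 𝓝[≠] (0 : ℝ), ∑ i ∈ Finset.range m, t ^ i * K i = t ^ m * g t) :
    ∀ i < m, K i = 0 := by
  induction m generalizing K with
  | zero => simp
  | succ m ih =>
    have hsplit : ∀ t : ℝ, ∑ i ∈ Finset.range (m + 1), t ^ i * K i =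
        K 0 + t * ∑ i ∈ Finset.range m, t ^ i * K (i + 1) := fun t => by
      rw [Finset.sum_range_succ', Finset.mul_sum, add_comm]
      simp only [pow_zero, one_mul, pow_succ']
      congr 1
      exact Finset.sum_congr rfl fun i _ => by ring
    -- Letting t → 0 isolates `K 0`; dividing by t afterwards lowers m by one.
    have h0 : K 0 = 0 := by
      have h1 : Filter.Tendsto (fun t : ℝ => K 0 + t * ∑ i ∈ Finset.range m, t ^ i * K (i + 1))
          (𝓝[≠] 0) (𝓝 (K 0)) := by
        have : Continuous fun t : ℝ => K 0 + t * ∑ i ∈ Finset.range m, t ^ i * K (i + 1) := by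
          fun_prop
        simpa using (this.tendsto 0).mono_left nhdsWithin_le_nhds
      have h2 : Filter.Tendsto (fun t : ℝ => t ^ (m + 1) * g t) (𝓝[≠] 0) (𝓝 0) := by
        have h3 : ContinuousAt (fun t : ℝ => t ^ (m + 1) * g t) 0 :=
          (continuous_pow (m + 1)).continuousAt.mul hg
        simpa [ContinuousAt] using h3.mono_left nhdsWithin_le_nhds
      refine tendsto_nhds_unique (h1.congr' ?_) h2
      filter_upwards [h] with t ht
      rw [← hsplit, ht]
    rintro (_ | i) hi
    · exact h0
    · refine ih (K := fun i => K (i + 1)) ?_ i (by omega)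
      filter_upwards [h, self_mem_nhdsWithin] with t ht ht0
      rw [hsplit, h0, zero_add, pow_succ', mul_assoc] at ht
      exact mul_left_cancel₀ ht0 ht

variable {E : Type*} [NormedAddCommGroup E] [NormedSpace ℝ E]

theorem extDeriv_apply_three {W : E → E [⋀^Fin 2]→L[ℝ] ℝ} {y : E} (hW : DifferentiableAt ℝ W y)
    (e u v : E) : extDeriv W y ![e, u, v] = fderiv ℝ (fun z => W z ![u, v]) y e -
      fderiv ℝ (fun z => W z ![e, v]) y u + fderiv ℝ (fun z => W z ![e, u]) y v := by
  have e0 : Fin.removeNth 0 ![e, u, v] = ![u, v] := by ext i; fin_cases i <;> rfl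
  have e1 : Fin.removeNth 1 ![e, u, v] = ![e, v] := by ext i; fin_cases i <;> rfl
  have e2 : Fin.removeNth 2 ![e, u, v] = ![e, u] := by ext i; fin_cases i <;> rfl
  rw [extDeriv_apply hW, Fin.sum_univ_three, e0, e1, e2]
  simp
  ring

theorem extDeriv_apply_two {A : E → E [⋀^Fin 1]→L[ℝ] ℝ} {y : E} (hA : DifferentiableAt ℝ A y)
    (u v : E) : extDeriv A y ![u, v] = fderiv ℝ (fun z => A z ![v]) y u -
      fderiv ℝ (fun z => A z ![u]) y v := by
  have e0 : Fin.removeNth 0 ![u, v] = ![v] := by ext i; fin_cases i; rfl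
  have e1 : Fin.removeNth 1 ![u, v] = ![u] := by ext i; fin_cases i; rfl
  rw [extDeriv_apply hA, Fin.sum_univ_two, e0, e1]
  simp
  ring

variable {ℓ : E →L[ℝ] ℝ} {e : E} {m : ℕ}

/-- Closedness of `ℓ^{-m} ℓ ∧ A + B` off the hyperplane `ℓ = 0`, tested on `e` and two vectors of
the hyperplane. -/
theorem extDeriv_apply_of_closed (he : ℓ e = 1) {A : E → E [⋀^Fin 1]→L[ℝ] ℝ}
    {B W : E → E [⋀^Fin 2]→L[ℝ] ℝ} {y : E} (hy : ℓ y ≠ 0) (hA : DifferentiableAt ℝ A y)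
    (hWd : DifferentiableAt ℝ W y)
    (hW : ∀ᶠ z in 𝓝 y, W z = wedge ((ℓ z ^ m)⁻¹ • ℓ) (A z) + B z)
    (hB : ∀ᶠ z in 𝓝 y, ∀ v, B z ![e, v] = 0) (hd : extDeriv W y = 0) {u v : E} (hu : ℓ u = 0)
    (hv : ℓ v = 0) :
    extDeriv A y ![u, v] = ℓ y ^ m * fderiv ℝ (fun z => B z ![u, v]) y e := by
  have h1 : (fun z => W z ![u, v]) =ᶠ[𝓝 y] fun z => B z ![u, v] := by
    filter_upwards [hW] with z hz
    rw [hz, ContinuousAlternatingMap.add_apply, wedge_apply]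
    simp [hu, hv]
  have h2 : ∀ w, ℓ w = 0 → (fun z => W z ![e, w]) =ᶠ[𝓝 y] fun z => (ℓ z ^ m)⁻¹ * A z ![w] := by
    intro w hw
    filter_upwards [hW, hB] with z hz hz'
    rw [hz, ContinuousAlternatingMap.add_apply, wedge_apply, hz']
    simp [he, hw]
  -- The factor ℓ⁻ᵐ is constant in directions of the hyperplane, so only A is differentiated.
  have h3 : ∀ w w', ℓ w = 0 → ℓ w' = 0 → fderiv ℝ (fun z => W z ![e, w]) y w' =
      (ℓ y ^ m)⁻¹ * fderiv ℝ (fun z => A z ![w]) y w' := by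
    intro w w' hw hw'
    obtain ⟨L, hH, hL⟩ : ∃ L : E →L[ℝ] ℝ, HasFDerivAt (fun z => (ℓ z ^ m)⁻¹) L y ∧ L w' = 0 :=
      ⟨_, (hasDerivAt_inv (pow_ne_zero m hy)).comp_hasFDerivAt y (ℓ.hasFDerivAt.pow m),
        by simp [hw']⟩
    rw [(h2 w hw).fderiv_eq, fderiv_fun_mul hH.differentiableAt
      (hA.continuousAlternatingMap_apply_const ![w]), hH.fderiv]
    simp [hL]
  have h4 := extDeriv_apply_three hWd e u v
  rw [hd, show (0 : E [⋀^Fin 3]→L[ℝ] ℝ) ![e, u, v] = 0 from rfl, h1.fderiv_eq, h3 v u hv hu, h3 u v hu hv] at h4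
  rw [extDeriv_apply_two hA]
  have h5 := pow_ne_zero m hy
  field_simp at h4
  linarith

theorem extDeriv_eq_comp_projAlong {A : E → E [⋀^Fin 1]→L[ℝ] ℝ} {y : E}
    (hA : DifferentiableAt ℝ A (projAlong ℓ e y))
    (h : ∀ᶠ z in 𝓝 y, A z = (A (projAlong ℓ e z)).compContinuousLinearMap (projAlong ℓ e)) :
    extDeriv A y =
      (extDeriv A (projAlong ℓ e y)).compContinuousLinearMap (projAlong ℓ e) := by
  have h1 : A =ᶠ[𝓝 y] fun z => (A (projAlong ℓ e z)).compContinuousLinearMap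
      (fderiv ℝ (projAlong ℓ e) z) := h.mono fun z hz => by
    beta_reduce
    rw [ContinuousLinearMap.fderiv]
    exact hz
  rw [h1.extDeriv_eq, extDeriv_pullback hA (projAlong ℓ e).contDiff.contDiffAt two_le_smooth,
    ContinuousLinearMap.fderiv]

theorem _root_.ContDiffAt.continuousAt_fderiv_apply {f : E → ℝ} {y : E} (hf : ContDiffAt ℝ ∞ f y)
    (u : E) : ContinuousAt (fun z => fderiv ℝ f z u) y :=
  (hf.fderiv_right (m := 0) (by simp)).continuousAt.clm_apply continuousAt_const

/-- The Laurent coefficients of a closed `b^m`-form are closed along the hypersurface. -/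
theorem extDeriv_coeff_eq_zero [FiniteDimensional ℝ E] (he : ℓ e = 1) {A : ℕ → E → E [⋀^Fin 1]→L[ℝ] ℝ}
    {C : E → E [⋀^Fin 1]→L[ℝ] ℝ} {B W : E → E [⋀^Fin 2]→L[ℝ] ℝ} {y : E} (hy : ℓ y = 0)
    (hA : ∀ i < m, ∀ᶠ z in 𝓝 y, ContDiffAt ℝ ∞ (A i) z) (hC : ContDiffAt ℝ ∞ C y)
    (hBs : ContDiffAt ℝ ∞ B y)
    (hAp : ∀ i < m, ∀ᶠ z in 𝓝 y,
      A i z = (A i (projAlong ℓ e z)).compContinuousLinearMap (projAlong ℓ e))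
    (hWs : ∀ᶠ z in 𝓝 y, ℓ z ≠ 0 → ContDiffAt ℝ ∞ W z)
    (hW : ∀ᶠ z in 𝓝 y, ℓ z ≠ 0 → W z = wedge ((ℓ z ^ m)⁻¹ • ℓ)
      (∑ i ∈ Finset.range m, ℓ z ^ i • A i z + ℓ z ^ m • C z) + B z)
    (hB : ∀ᶠ z in 𝓝 y, ∀ v, B z ![e, v] = 0) (hd : ∀ᶠ z in 𝓝 y, ℓ z ≠ 0 → extDeriv W z = 0) :
    ∀ i < m, extDeriv (A i) y = 0 := by
  have hproj : projAlong ℓ e y = y := by rw [projAlong_apply, hy]; simp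
  have hAe : ∀ᶠ z in 𝓝 y, ∀ i < m, DifferentiableAt ℝ (A i) z ∧
      extDeriv (A i) z =
        (extDeriv (A i) (projAlong ℓ e z)).compContinuousLinearMap (projAlong ℓ e) := by
    have hfin : ∀ᶠ z in 𝓝 y, ∀ i ∈ Finset.range m, DifferentiableAt ℝ (A i) z ∧
      extDeriv (A i) z =
        (extDeriv (A i) (projAlong ℓ e z)).compContinuousLinearMap (projAlong ℓ e) := by
      refine (Finset.eventually_all _).2 fun i hi => ?_
      have hc : Filter.Tendsto (projAlong ℓ e) (𝓝 y) (𝓝 y) := by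
        simpa [hproj] using (projAlong ℓ e).continuous.tendsto y
      have hi' := Finset.mem_range.1 hi
      filter_upwards [hA i hi', hc.eventually (hA i hi'), (hAp i hi').eventually_nhds]
        with z h1 h2 h3
      exact ⟨h1.differentiableAt (by simp),
        extDeriv_eq_comp_projAlong (h2.differentiableAt (by simp)) h3⟩
    exact hfin.mono fun z hz i hi => hz i (Finset.mem_range.2 hi)
  have hCd : ∀ᶠ z in 𝓝 y, DifferentiableAt ℝ C z := ((hC.of_le (m := 1) (by simp)).eventually
    (by simp)).mono fun z hz => hz.differentiableAt one_ne_zero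
  have key : ∀ u v, ℓ u = 0 → ℓ v = 0 → ∀ i < m, extDeriv (A i) y ![u, v] = 0 := by
    intro u v hu hv
    -- The continuous factor of tᵐ: the normal derivative of B minus the contribution of the
    -- remainder C.
    let g : E → ℝ := fun z => fderiv ℝ (fun z => B z ![u, v]) z e - extDeriv C z ![u, v]
    have hg : ContinuousAt g y := by
      have c1 := (hBs.alternating_apply_two (u := fun _ => u) (v := fun _ => v) contDiffAt_const
        contDiffAt_const).continuousAt_fderiv_apply e
      have c2 := (hC.alternating_apply_one (u := fun _ => v)
        contDiffAt_const).continuousAt_fderiv_apply u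
      have c3 := (hC.alternating_apply_one (u := fun _ => u)
        contDiffAt_const).continuousAt_fderiv_apply v
      refine (c1.sub (c2.sub c3)).congr ?_
      filter_upwards [hCd] with z hz
      simp only [g, extDeriv_apply_two hz]
      rfl
    -- Along this line the projection to the hyperplane is constantly `y`, so dAᵢ(u, v) keeps its
    -- value at `y` and closedness becomes a polynomial identity in t.
    have hline : Filter.Tendsto (fun t : ℝ => y + t • e) (𝓝 0) (𝓝 y) := by
      have : Continuous fun t : ℝ => y + t • e := by fun_prop
      simpa using this.tendsto 0
    refine eq_zero_of_sum_pow_mul_eq (g := fun t => g (y + t • e)) ?_ ?_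
    · refine ContinuousAt.comp (g := g) (f := fun t : ℝ => y + t • e) (by simpa using hg) ?_
      fun_prop
    · filter_upwards [nhdsWithin_le_nhds (hline.eventually hAe),
        nhdsWithin_le_nhds (hline.eventually hCd),
        nhdsWithin_le_nhds (hline.eventually hWs), nhdsWithin_le_nhds (hline.eventually hd),
        nhdsWithin_le_nhds (hline.eventually hW.eventually_nhds),
        nhdsWithin_le_nhds (hline.eventually hB.eventually_nhds), self_mem_nhdsWithin]
        with t h1 h2 h3 h4 h5 h6 h7
      have ht : ℓ (y + t • e) = t := by simp [hy, he]
      have ht0 : ℓ (y + t • e) ≠ 0 := by rw [ht]; exact h7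
      have hpt : projAlong ℓ e (y + t • e) = y := by
        rw [projAlong_apply, ht]; simp
      have hne : ∀ᶠ z in 𝓝 (y + t • e), ℓ z ≠ 0 := ℓ.continuous.continuousAt.eventually_ne ht0
      have hpow : ∀ j : ℕ, DifferentiableAt ℝ (fun z => ℓ z ^ j) (y + t • e) := fun j =>
        ℓ.differentiableAt.pow j
      have hfpow : ∀ (j : ℕ) w, ℓ w = 0 → fderiv ℝ (fun z => ℓ z ^ j) (y + t • e) w = 0 := by
        intro j w hw
        rw [(ℓ.hasFDerivAt.pow j).fderiv]
        simp [hw]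
      have hsd : ∀ i ∈ Finset.range m, DifferentiableAt ℝ (fun z => ℓ z ^ i • A i z) (y + t • e) :=
        fun i hi => (hpow i).smul (h1 i (Finset.mem_range.1 hi)).1
      have e1 := extDeriv_apply_of_closed he ht0
        (A := fun z => ∑ i ∈ Finset.range m, ℓ z ^ i • A i z + ℓ z ^ m • C z)
        ((DifferentiableAt.fun_sum hsd).add ((hpow m).smul h2)) ((h3 ht0).differentiableAt (by simp))
        (by filter_upwards [h5, hne] with z a b using a b) h6 (h4 ht0) hu hv
      rw [extDeriv_fun_add (DifferentiableAt.fun_sum hsd)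
        (ω₂ := fun z => ℓ z ^ m • C z) ((hpow m).smul h2),
        extDeriv_finset_sum _ hsd, extDeriv_smul_one_form (hpow m) h2,
        ContinuousAlternatingMap.add_apply, ContinuousAlternatingMap.add_apply,
        ContinuousAlternatingMap.sum_apply, wedge_apply, hfpow m u hu, hfpow m v hv] at e1
      have e2 : ∀ i ∈ Finset.range m, extDeriv (fun z => ℓ z ^ i • A i z) (y + t • e) ![u, v] =
          t ^ i * extDeriv (A i) y ![u, v] := by
        intro i hi
        obtain ⟨a, b⟩ := h1 i (Finset.mem_range.1 hi)
        rw [extDeriv_smul_one_form (hpow i) a, ContinuousAlternatingMap.add_apply, wedge_apply,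
          hfpow i u hu, hfpow i v hv, b, hpt, ContinuousAlternatingMap.smul_apply, comp_apply_two,
          projAlong_apply, projAlong_apply, hu, hv, ht]
        simp
      rw [Finset.sum_congr rfl e2, ht] at e1
      simp only [g]
      rw [ContinuousAlternatingMap.smul_apply, smul_eq_mul] at e1
      linarith
  intro i hi
  -- Since dAᵢ is its own pullback by the projection, vectors of the hyperplane suffice.
  refine form_two_ext fun u v => ?_
  rw [(hAe.self_of_nhds i hi).2, hproj, comp_apply_two,
    key _ _ (by rw [projAlong_apply]; simp [he]) (by rw [projAlong_apply]; simp [he]) i hi]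
  rfl

end LaurentLocal

/-! ### Coefficients annihilating a normal vector -/

section Semibasic

variable {V : Type*} [AddCommGroup V] [Module ℝ V] [TopologicalSpace V]

/-- The contraction of a two-form with a vector. -/
def contract (v : V) (b : V [⋀^Fin 2]→L[ℝ] ℝ) : V [⋀^Fin 1]→L[ℝ] ℝ :=
  ContinuousAlternatingMap.ofSubsingleton ℝ V ℝ 0 (b.toContinuousLinearMap ![v, 0] 1)

theorem contract_apply (v : V) (b : V [⋀^Fin 2]→L[ℝ] ℝ) (u : V) :
    contract v b ![u] = b ![v, u] := by
  change b (Function.update ![v, 0] 1 u) = _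
  congr 1
  ext i; fin_cases i <;> rfl

variable {d m : ℕ} {M : Type*} [TopologicalSpace M] [ChartedSpace (Model d) M] {x : M → ℝ}
  {Ω : BTwoForm d m x} {p : M}

variable {a α : TangentSpace (𝓡 d) p [⋀^Fin 1]→L[ℝ] ℝ}
    {b β : TangentSpace (𝓡 d) p [⋀^Fin 2]→L[ℝ] ℝ} {v : TangentSpace (𝓡 d) p}

/-- A `b^m`-two-form can be written with coefficients that annihilate a given normal vector. -/
theorem BTwoForm.EqAt.comp_projAlong (h : Ω.EqAt p α β) :
    Ω.EqAt p ((α + x p ^ m • contract v β).compContinuousLinearMap (projAlong (dFun x p) v))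
      (β.compContinuousLinearMap (projAlong (dFun x p) v)) := by
  intro w w'
  -- On the b^m-fibre dx = xᵐ c, so a vector is its projection plus xᵐ c v. The part of β involving
  -- v thereby passes into the coefficient of dx/xᵐ.
  have hw : ∀ w : bTangent (d := d) m x p, ∃ n : TangentSpace (𝓡 d) p,
      projAlong (dFun x p) v w.1.1 = n ∧ w.1.1 = n + (x p ^ m * w.1.2) • v := by
    intro w
    refine ⟨_, rfl, ?_⟩
    have h1 : dFun x p w.1.1 = x p ^ m * w.1.2 := w.2
    rw [projAlong_apply, h1, sub_add_cancel]
  obtain ⟨n, hn, hwn⟩ := hw w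
  obtain ⟨n', hn', hwn'⟩ := hw w'
  rw [h w w', comp_apply_one, comp_apply_one, comp_apply_two, hn, hn']
  simp only [ContinuousAlternatingMap.add_apply, ContinuousAlternatingMap.smul_apply,
    contract_apply, smul_eq_mul]
  have e1 : ∀ w c, α ![w + c • v] = α ![w] + c * α ![v] := fun w c => by
    rw [apply_vec_add, apply_vec_smul]
  have e2 : ∀ c c' : ℝ, β ![n + c • v, n' + c' • v] =
      β ![n, n'] - c' * β ![v, n] + c * β ![v, n'] := by
    intro c c'
    have h1 : β ![n, v] = - β ![v, n] := ((isAlt_toBilin β).neg v n).symm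
    have h2 : β ![v, v] = 0 := toBilin_self β v
    simp only [← toBilin_apply] at *
    simp only [map_add, map_smul, LinearMap.add_apply, LinearMap.smul_apply, smul_eq_mul, h1, h2]
    ring
  rw [hwn, hwn', e1, e1, e2]
  ring

/-- Such coefficients are unique: evaluating on (xᵐ v, 1) and on vectors (u, 0) with dx(u) = 0,
which lie in the fibre, recovers them from any α and β. Their smoothness follows from that of α and
β. -/
theorem BTwoForm.EqAt.apply_eq (h : Ω.EqAt p a b) (h' : Ω.EqAt p α β) (hv : dFun x p v = 1)
    (ha : a ![v] = 0) (hb : ∀ u, b ![v, u] = 0) :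
    (∀ u, a ![u] = α ![projAlong (dFun x p) v u] + x p ^ m * β ![v, projAlong (dFun x p) v u]) ∧
      ∀ u u', b ![u, u'] = β ![projAlong (dFun x p) v u, projAlong (dFun x p) v u'] := by
  have hker : ∀ u, dFun x p (projAlong (dFun x p) v u) = 0 := fun u => by
    rw [projAlong_apply, map_sub, map_smul, hv]; simp
  have hmem : ∀ u, (projAlong (dFun x p) v u, (0 : ℝ)) ∈ bTangent (d := d) m x p := fun u => by
    change dFun x p _ = x p ^ m * 0
    rw [hker, mul_zero]
  have hvm : (x p ^ m • v, (1 : ℝ)) ∈ bTangent (d := d) m x p := by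
    change dFun x p (x p ^ m • v) = x p ^ m * 1
    rw [map_smul, hv, smul_eq_mul]
  have hdec : ∀ u, u = projAlong (dFun x p) v u + dFun x p u • v := fun u => by
    rw [projAlong_apply, sub_add_cancel]
  have hsm : ∀ (γ : TangentSpace (𝓡 d) p [⋀^Fin 2]→L[ℝ] ℝ) (c : ℝ) w, γ ![c • v, w] = c * γ ![v, w] :=
    fun γ c w => by
      simp only [← toBilin_apply, map_smul, LinearMap.smul_apply, smul_eq_mul]
  constructor
  · intro u
    have h1 := (h ⟨_, hvm⟩ ⟨_, hmem u⟩).symm.trans (h' ⟨_, hvm⟩ ⟨_, hmem u⟩)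
    simp only [hsm, hb] at h1
    have h2 : a ![u] = a ![projAlong (dFun x p) v u] := by
      conv_lhs => rw [hdec u, apply_vec_add, apply_vec_smul, ha]
      ring
    rw [h2]
    linarith
  · intro u u'
    have h1 := (h ⟨_, hmem u⟩ ⟨_, hmem u'⟩).symm.trans (h' ⟨_, hmem u⟩ ⟨_, hmem u'⟩)
    simp only [zero_mul, sub_zero, zero_add] at h1
    rw [← h1]
    have h2 : ∀ w, b ![w, v] = 0 := fun w => by
      have := (isAlt_toBilin b).neg v w
      rw [toBilin_apply, toBilin_apply, hb] at this
      rw [← this, neg_zero]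
    conv_lhs => rw [hdec u, hdec u']
    simp only [← toBilin_apply] at *
    simp only [map_add, map_smul, LinearMap.add_apply, LinearMap.smul_apply, smul_eq_mul, h2, hb]
    ring

/-- dx/xᵐ ∧ xᵐ α = dx ∧ α: the Taylor remainder of order m is absorbed into the smooth part. -/
theorem BTwoForm.EqAt.add_wedge (h : Ω.EqAt p (a + x p ^ m • α) b) :
    Ω.EqAt p a (wedge (dFun x p) α + b) := by
  intro w w'
  have h1 : dFun x p w.1.1 = x p ^ m * w.1.2 := w.2
  have h2 : dFun x p w'.1.1 = x p ^ m * w'.1.2 := w'.2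
  rw [h w w']
  simp only [ContinuousAlternatingMap.add_apply, ContinuousAlternatingMap.smul_apply, wedge_apply,
    smul_eq_mul, h1, h2]
  ring

end Semibasic

/-! ### The normal vector field of the tubular neighbourhood -/

section Normal

variable {d : ℕ} {M : Type*} [TopologicalSpace M] [ChartedSpace (Model d) M] {x : M → ℝ} {r : M → M}
  {z : M}

variable (x r) in
/-- The vector field `∂/∂x` determined by the projection `r` and the function `x`. -/
def normalVec (p : M) : TangentSpace (𝓡 d) p :=
  -- Where the two conditions have no solution the value is arbitrary. Near Z, for a retraction r
  -- onto Z, there is exactly one.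
  Classical.epsilon fun v => mfderiv (𝓡 d) (𝓡 d) r p v = 0 ∧ dFun x p v = 1

theorem LocalCoord.eventually_of_symm {κ : M → Model d} {σ : Model d → M} (h : LocalCoord κ σ z)
    {Q : M → Prop} (hQ : ∀ᶠ y in 𝓝 (κ z), Q (σ y)) : ∀ᶠ q in 𝓝 z, Q q := by
  filter_upwards [h.smooth.continuousAt.eventually hQ, h.left_inv] with q h1 h2
  rwa [h2] at h1

variable [IsManifold (𝓡 d) ∞ M] {κ : M → Model d} {σ : Model d → M}

/-- Forms with the same coordinate expressions agree. -/
theorem LocalCoord.eventually_eq (h : LocalCoord κ σ z) {j : ℕ} {η η' : Form d M j}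
    (he : localForm σ η =ᶠ[𝓝 (κ z)] localForm σ η') : ∀ᶠ q in 𝓝 z, η q = η' q := by
  filter_upwards [h.pullback_pullback η, h.pullback_pullback η',
    h.smooth.continuousAt.eventually he] with q h1 h2 h3
  rw [← h1, ← h2]
  exact congrArg (fun ζ : (Model d) [⋀^Fin j]→L[ℝ] ℝ =>
    ζ.compContinuousLinearMap (mfderiv (𝓡 d) (𝓡 d) κ q)) h3

/-- Smooth forms that agree off `Z` agree. -/
theorem IsDefiningFunction.eq_of_smoothAt (hx : IsDefiningFunction (d := d) x) {j : ℕ}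
    {η η' : Form d M j} (hη : SmoothAt η z) (hη' : SmoothAt η' z)
    (h : ∀ᶠ q in 𝓝 z, x q ≠ 0 → η q = η' q) : η z = η' z := by
  have hl := localCoord_extChartAt (d := d) (p := z) (mem_extChartAt_source z)
  set κ := extChartAt (𝓡 d) z
  have c1 := ((hl.smoothAt_iff η).1 hη).continuousAt
  have c2 := ((hl.smoothAt_iff η').1 hη').continuousAt
  have h1 : localForm κ.symm η (κ z) = localForm κ.symm η' (κ z) := by
    by_contra hne
    obtain ⟨y, hy1, hy2, hy3⟩ := ((hx.frequently_ne hl).and_eventually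
      (((c1.ne_iff_eventually_ne c2).1 hne).and (hl.tendsto_symm.eventually h))).exists
    refine hy2 ?_
    rw [localForm_def, localForm_def, hy3 hy1]
  rw [← (hl.pullback_pullback η).self_of_nhds, ← (hl.pullback_pullback η').self_of_nhds]
  exact congrArg (fun ζ : (Model d) [⋀^Fin j]→L[ℝ] ℝ =>
    ζ.compContinuousLinearMap (mfderiv (𝓡 d) (𝓡 d) κ z)) h1

variable {ℓ : Model d →L[ℝ] ℝ} {e : Model d}

/-- In adapted coordinates r is the linear map `projAlong ℓ e`, which is its own derivative. -/
theorem AdaptedCoord.localForm_pullback (hr : FixesZeros (d := d) x r) (hz : x z = 0)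
    (h : AdaptedCoord x r ℓ e κ σ z) {j : ℕ} (η : Form d M j) :
    ∀ᶠ y in 𝓝 (κ z), localForm σ (pullback r η) y =
      (localForm σ η (projAlong ℓ e y)).compContinuousLinearMap (projAlong ℓ e) := by
  have hl := h.coord.self_of_nhds
  have hproj : projAlong ℓ e (κ z) = κ z := by rw [projAlong_apply, h.apply_base hz]; simp
  have hc : Filter.Tendsto (projAlong ℓ e) (𝓝 (κ z)) (𝓝 (κ z)) := by
    simpa [hproj] using (projAlong ℓ e).continuous.tendsto (κ z)
  have hrs := eventually_nhdsSet_iff_forall.1 hr.smooth z hz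
  have hσ := hl.smooth_symm.eventually_mdifferentiableAt
  filter_upwards [(h.symm_proj (hr.tendsto hz)).eventually_nhds, hσ, hc.eventually hσ,
    hl.tendsto_symm.eventually hrs] with y h1 h2 h3 h4
  have e1 : pullback (d := d) σ (pullback (d := d) r η) y = pullback (d := d) (r ∘ σ) η y :=
    (pullback_comp (d := d) η (h4.mdifferentiableAt (by simp)) h2).symm
  have e2 : pullback (d := d) (r ∘ σ) η y = pullback (d := d) (σ ∘ projAlong ℓ e) η y :=
    pullback_congr η h1
  have e3 : pullback (d := d) (σ ∘ projAlong ℓ e) η y =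
      pullback (d := d) (projAlong ℓ e) (pullback (d := d) σ η) y :=
    pullback_comp (d := d) (d' := d) η h3
      (projAlong ℓ e).differentiableAt.mdifferentiableAt
  refine (e1.trans (e2.trans e3)).trans ?_
  unfold pullback
  rw [mfderiv_eq_fderiv, ContinuousLinearMap.fderiv]
  rfl

/-- In adapted coordinates the normal vector field is the constant `e`. -/
theorem AdaptedCoord.normalVec_symm (hx : IsDefiningFunction (d := d) x)
    (hr : FixesZeros (d := d) x r) (hz : x z = 0) (h : AdaptedCoord x r ℓ e κ σ z) :
    ∀ᶠ y in 𝓝 (κ z), mfderiv (𝓡 d) (𝓡 d) r (σ y) (normalVec x r (σ y)) = 0 ∧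
      dFun x (σ y) (normalVec (d := d) x r (σ y)) = 1 ∧
      mfderiv (𝓡 d) (𝓡 d) σ y e = normalVec x r (σ y) ∧
      ∀ u : Model d, dFun x (σ y) (mfderiv (𝓡 d) (𝓡 d) σ y u) = ℓ u := by
  have hl := h.coord.self_of_nhds
  have hrs := eventually_nhdsSet_iff_forall.1 hr.smooth z hz
  have hproj : projAlong ℓ e (κ z) = κ z := by rw [projAlong_apply, h.apply_base hz]; simp
  have hc : Filter.Tendsto (projAlong ℓ e) (𝓝 (κ z)) (𝓝 (κ z)) := by
    simpa [hproj] using (projAlong ℓ e).continuous.tendsto (κ z)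
  have hσ := hl.smooth_symm.eventually_mdifferentiableAt
  filter_upwards [(h.symm_proj (hr.tendsto hz)).eventually_nhds, hσ, hc.eventually hσ,
    hl.tendsto_symm.eventually hrs, h.eq_symm.eventually_nhds,
    hl.tendsto_symm.eventually (h.immersion hx hr hz)] with y h1 h2 h3 h4 h5 h6
  have e1 : ∀ u : Model d, dFun x (σ y) (mfderiv (𝓡 d) (𝓡 d) σ y u) = ℓ u := fun u => by
    have h7 := fderiv_comp_eq_dFun (hx.mdifferentiable (σ y)) h2
    have h8 : (fun z => x (σ z)) =ᶠ[𝓝 y] ℓ := h5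
    rw [h8.fderiv_eq, ContinuousLinearMap.fderiv] at h7
    exact (congrArg (fun L : Model d →L[ℝ] ℝ => L u) h7).symm
  have e2 : mfderiv (𝓡 d) (𝓡 d) r (σ y) (mfderiv (𝓡 d) (𝓡 d) σ y e) = 0 := by
    refine (mfderiv_comp_apply y (h4.mdifferentiableAt (by simp)) h2 e).symm.trans ?_
    have h7 : (mfderiv (𝓡 d) (𝓡 d) (r ∘ σ) y : Model d →L[ℝ] Model d) =
      mfderiv (𝓡 d) (𝓡 d) (σ ∘ projAlong ℓ e) y := Filter.EventuallyEq.mfderiv_eq h1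
    refine (congrArg (fun L : Model d →L[ℝ] Model d => L e) h7).trans ?_
    have h8 := mfderiv_comp_apply (I := 𝓡 d) (I' := 𝓡 d) (I'' := 𝓡 d) y (g := σ)
      (f := projAlong ℓ e) h3
      (projAlong ℓ e).differentiableAt.mdifferentiableAt e
    refine h8.trans ?_
    have h9 : (mfderiv (𝓡 d) (𝓡 d) (projAlong ℓ e) y e : Model d) = 0 := by
      rw [mfderiv_eq_fderiv, ContinuousLinearMap.fderiv]
      change projAlong ℓ e e = 0
      rw [projAlong_apply, h.apply_e]; simp
    exact (congrArg (mfderiv (𝓡 d) (𝓡 d) σ (projAlong ℓ e y)) h9).trans (map_zero _)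
  have e1e : dFun x (σ y) (mfderiv (𝓡 d) (𝓡 d) σ y e) = 1 := (e1 e).trans h.apply_e
  have e3 : mfderiv (𝓡 d) (𝓡 d) r (σ y) (normalVec x r (σ y)) = 0 ∧
      dFun x (σ y) (normalVec (d := d) x r (σ y)) = 1 :=
    Classical.epsilon_spec (p := fun v => mfderiv (𝓡 d) (𝓡 d) r (σ y) v = 0 ∧ dFun x (σ y) v = 1)
      ⟨mfderiv (𝓡 d) (𝓡 d) σ y e, e2, e1e⟩
  refine ⟨e3.1, e3.2, ?_, e1⟩
  refine sub_eq_zero.1 (h6 _ ?_ ?_)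
  · rw [map_sub, e3.1, sub_zero]
    exact e2
  · rw [map_sub, e3.2, sub_eq_zero]
    exact e1e

end Normal

/-! ### Local expansion along the fibres of the retraction -/

section LaurentExpansion

variable {d m : ℕ} {M : Type*} [TopologicalSpace M] [ChartedSpace (Model d) M]
  [IsManifold (𝓡 d) ∞ M] {x : M → ℝ} {r : M → M} {z : M} {κ : M → Model d} {σ : Model d → M}
  {ℓ : Model d →L[ℝ] ℝ} {e : Model d} {Ω : BTwoForm d m x}

theorem LocalCoord.eventually_smoothAt_iff (h : ∀ᶠ q in 𝓝 z, LocalCoord κ σ q) {j : ℕ}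
    (η : Form d M j) : (∀ᶠ q in 𝓝 z, SmoothAt η q) ↔
      ∀ᶠ y in 𝓝 (κ z), ContDiffAt ℝ ∞ (localForm σ η) y := by
  have hl := h.self_of_nhds
  refine ⟨fun hη => ?_, fun hη => ?_⟩
  · filter_upwards [hl.tendsto_symm.eventually hη, LocalCoord.eventually_symm h] with y h1 h2
    have := (h2.1.smoothAt_iff η).1 h1
    rwa [h2.2] at this
  · filter_upwards [h, hl.smooth.continuousAt.eventually hη] with q h1 h2
    exact (h1.smoothAt_iff η).2 h2

namespace AdaptedCoord

variable (hx : IsDefiningFunction (d := d) x) (hr : FixesZeros (d := d) x r) (hz : x z = 0)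
  (h : AdaptedCoord x r ℓ e κ σ z)
include hx hr hz h

theorem eventually_normalVec : ∀ᶠ q in 𝓝 z, mfderiv (𝓡 d) (𝓡 d) r q (normalVec x r q) = 0 ∧
    dFun x q (normalVec (d := d) x r q) = 1 :=
  h.coord.self_of_nhds.eventually_of_symm
    ((h.normalVec_symm hx hr hz).mono fun _ hy => ⟨hy.1, hy.2.1⟩)

/-- The coefficients of a smooth `b^m`-two-form that annihilate the normal vector field are
smooth. -/
theorem smoothAt_coefficients (hΩ : Ω.IsSmooth) {a : Form d M 1} {b : Form d M 2}
    (hab : ∀ᶠ q in 𝓝 z, Ω.EqAt q (a q) (b q) ∧ a q ![normalVec x r q] = 0 ∧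
      ∀ u, b q ![normalVec x r q, u] = 0) :
    ∀ᶠ q in 𝓝 z, SmoothAt a q ∧ SmoothAt b q := by
  have hl := h.coord.self_of_nhds
  obtain ⟨α, β, hαβ⟩ := hΩ z
  -- Uniqueness of the coefficients expresses them through the smooth α and β, the normal vector
  -- being the constant `e` in these coordinates.
  have key : ∀ᶠ y in 𝓝 (κ z),
      (∀ u, localForm σ a y ![u] = localForm σ α y ![projAlong ℓ e u] +
        ℓ y ^ m * localForm σ β y ![e, projAlong ℓ e u]) ∧
      ∀ u u', localForm σ b y ![u, u'] =
        localForm σ β y ![projAlong ℓ e u, projAlong ℓ e u'] := by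
    filter_upwards [hl.tendsto_symm.eventually hab, hl.tendsto_symm.eventually hαβ,
      h.normalVec_symm hx hr hz, h.eq_symm] with y h1 h2 h3 h4
    obtain ⟨e1, e2⟩ := h1.1.apply_eq h2.2.2 h3.2.1 h1.2.1 h1.2.2
    have e3 : ∀ u : Model d, projAlong (dFun x (σ y)) (normalVec x r (σ y))
        (mfderiv (𝓡 d) (𝓡 d) σ y u) = mfderiv (𝓡 d) (𝓡 d) σ y (projAlong ℓ e u) := fun u => by
      rw [projAlong_apply, projAlong_apply, h3.2.2.2]
      refine Eq.symm ((map_sub (mfderiv (𝓡 d) (𝓡 d) σ y) u (ℓ u • e)).trans ?_)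
      refine congrArg (fun w => mfderiv (𝓡 d) (𝓡 d) σ y u - w) ?_
      refine (map_smul (mfderiv (𝓡 d) (𝓡 d) σ y) (ℓ u) e).trans ?_
      rw [← h3.2.2.1]
      rfl
    refine ⟨fun u => ?_, fun u u' => ?_⟩
    · rw [localForm_def, localForm_def, localForm_def]
      refine (comp_apply_one _ _ _).trans ?_
      rw [e1, e3, ← h3.2.2.1, h4]
      exact congrArg₂ (· + ℓ y ^ m * ·) (comp_apply_one _ _ _).symm (comp_apply_two _ _ _ _).symm
    · rw [localForm_def, localForm_def]
      refine (comp_apply_two _ _ _ _).trans ?_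
      rw [e2, e3, e3]
      exact (comp_apply_two _ _ _ _).symm
  have hα := (LocalCoord.eventually_smoothAt_iff h.coord α).1 (hαβ.mono fun q hq => hq.1)
  have hβ := (LocalCoord.eventually_smoothAt_iff h.coord β).1 (hαβ.mono fun q hq => hq.2.1)
  refine Filter.Eventually.and ?_ ?_
  · rw [LocalCoord.eventually_smoothAt_iff h.coord]
    filter_upwards [key.eventually_nhds, hα, hβ] with y h1 h2 h3
    refine contDiffAt_alternating_of_apply fun w => ?_
    rw [eq_vec_one w]
    refine ContDiffAt.congr_of_eventuallyEq ?_ (h1.mono fun y hy => hy.1 (w 0))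
    exact (h2.alternating_apply_one contDiffAt_const).add
      ((ℓ.contDiff.contDiffAt.pow m).mul (h3.alternating_apply_two contDiffAt_const contDiffAt_const))
  · rw [LocalCoord.eventually_smoothAt_iff h.coord]
    filter_upwards [key.eventually_nhds, hβ] with y h1 h3
    refine contDiffAt_alternating_of_apply fun w => ?_
    rw [eq_vec_two w]
    refine ContDiffAt.congr_of_eventuallyEq ?_ (h1.mono fun y hy => hy.2 (w 0) (w 1))
    exact h3.alternating_apply_two contDiffAt_const contDiffAt_const

/-- A one-form annihilating the normal vector field is, up to a multiple of `x`, the pullback of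
its restriction to `Z`: local version. -/
theorem exists_eq_pullback_add {a : Form d M 1}
    (ha : ∀ᶠ q in 𝓝 z, SmoothAt a q ∧ a q ![normalVec x r q] = 0) :
    ∃ c : Form d M 1, ∀ᶠ q in 𝓝 z, (SmoothAt c q ∧ c q ![normalVec x r q] = 0) ∧
      a q = pullback r a q + x q • c q := by
  have hl := h.coord.self_of_nhds
  have hV := h.normalVec_symm hx hr hz
  have hproj : projAlong ℓ e (κ z) = κ z := by rw [projAlong_apply, h.apply_base hz]; simp
  have hc : Filter.Tendsto (projAlong ℓ e) (𝓝 (κ z)) (𝓝 (κ z)) := by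
    simpa [hproj] using (projAlong ℓ e).continuous.tendsto (κ z)
  have hPe : projAlong ℓ e e = 0 := by rw [projAlong_apply, h.apply_e]; simp
  set A := localForm σ a with hA
  have hAs := (LocalCoord.eventually_smoothAt_iff h.coord a).1 (ha.mono fun q hq => hq.1)
  have hAe : ∀ᶠ y in 𝓝 (κ z), A y ![e] = 0 := by
    filter_upwards [hl.tendsto_symm.eventually ha, hV] with y h1 h2
    rw [hA, localForm_def]
    refine (comp_apply_one _ _ _).trans ?_
    rw [h2.2.2.1]
    exact h1.2
  have hAP : ∀ y, A y ![e] = 0 → ∀ w, A y ![projAlong ℓ e w] = A y ![w] := by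
    intro y hy w
    rw [projAlong_apply, sub_eq_add_neg, ← neg_smul, apply_vec_add, apply_vec_smul, hy]
    simp
  -- On the hyperplane this difference vanishes because A annihilates e; Hadamard's lemma then
  -- divides it by ℓ.
  let F : Model d → (Model d) [⋀^Fin 1]→L[ℝ] ℝ := fun y =>
    A y - (A (projAlong ℓ e y)).compContinuousLinearMap (projAlong ℓ e)
  have hFs : ∀ᶠ y in 𝓝 (κ z), ContDiffAt ℝ ∞ F y := by
    filter_upwards [hAs, hc.eventually hAs] with y h1 h2
    exact h1.sub (ContDiffAt.alternating_comp (h2.comp y (projAlong ℓ e).contDiff.contDiffAt)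
      contDiffAt_const)
  have hF0 : ∀ᶠ y in 𝓝 (κ z), ℓ y = 0 → F y = 0 := by
    filter_upwards [hAe] with y h1 h2
    have h3 : projAlong ℓ e y = y := by rw [projAlong_apply, h2]; simp
    ext w
    simp only [F, h3]
    rw [eq_vec_one w, ContinuousAlternatingMap.sub_apply, comp_apply_one, hAP y h1, sub_self]
    rfl
  have : CompleteSpace ((Model d) [⋀^Fin 1]→L[ℝ] ℝ) := by
    have := finiteDimensional_continuousAlternatingMap (E := Model d) (j := 1)
    exact FiniteDimensional.complete ℝ _
  obtain ⟨G, hG, hFG⟩ := exists_eq_smul_of_eq_zero h.apply_e (h.apply_base hz) hFs hF0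
  -- Composing the quotient with the projection makes it annihilate e everywhere, so that the
  -- division step can be iterated.
  let C₀ : Model d → (Model d) [⋀^Fin 1]→L[ℝ] ℝ := fun y =>
    (G y).compContinuousLinearMap (projAlong ℓ e)
  have hC₀ : ∀ y, ContDiffAt ℝ ∞ C₀ y := fun y =>
    ContDiffAt.alternating_comp hG.contDiffAt contDiffAt_const
  let C : Form d (Model d) 1 := C₀
  have hCs : ∀ y, SmoothAt C y := fun y => smoothAt_model_iff.2 (hC₀ y)
  have hCe : ∀ y, C y ![e] = 0 := fun y => by
    refine (comp_apply_one _ _ _).trans ?_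
    rw [hPe]
    exact (G y).map_coord_zero 0 rfl
  let c : Form d M 1 := pullback κ C
  have hCloc : ∀ᶠ y in 𝓝 (κ z), localForm σ c y = C₀ y := hl.pullback_pullback_symm C
  refine ⟨c, ?_⟩
  have e1 : ∀ᶠ q in 𝓝 z, SmoothAt c q :=
    h.coord.mono fun q hq => SmoothAt.pullback (d := d) (d' := d) (hCs _) hq.smooth
  have e2 : ∀ᶠ q in 𝓝 z, c q ![normalVec x r q] = 0 := by
    refine hl.eventually_of_symm ?_
    filter_upwards [hCloc, hV] with y h1 h2
    rw [← h2.2.2.1]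
    refine (comp_apply_one (c (σ y)) (mfderiv (𝓡 d) (𝓡 d) σ y) e).symm.trans ?_
    exact (congrArg (fun ζ : (Model d) [⋀^Fin 1]→L[ℝ] ℝ => ζ ![e]) h1).trans (hCe y)
  have e3 : ∀ᶠ q in 𝓝 z, a q = pullback r a q + x q • c q := by
    refine hl.eventually_eq (η' := fun q => pullback r a q + x q • c q) ?_
    filter_upwards [hCloc, h.localForm_pullback hr hz a, hFG, h.eq_symm, hAe] with y h1 h2 h3 h4 h8
    have h5 : localForm σ (fun q => pullback r a q + x q • c q) y =
        localForm σ (pullback r a) y + x (σ y) • localForm σ c y := rfl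
    rw [h5, h1, h2, h4]
    refine ContinuousAlternatingMap.ext fun w => ?_
    have h6 : A y ![projAlong ℓ e (w 0)] - (A (projAlong ℓ e y)).compContinuousLinearMap
        (projAlong ℓ e) ![projAlong ℓ e (w 0)] = ℓ y * G y ![projAlong ℓ e (w 0)] :=
      congrArg (fun ζ : (Model d) [⋀^Fin 1]→L[ℝ] ℝ => ζ ![projAlong ℓ e (w 0)]) h3
    have h7 : projAlong ℓ e (projAlong ℓ e (w 0)) = projAlong ℓ e (w 0) := by
      rw [projAlong_apply ℓ e (projAlong ℓ e (w 0)), projAlong_apply, map_sub, map_smul, h.apply_e]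
      simp
    rw [hAP y h8, comp_apply_one, h7] at h6
    rw [eq_vec_one w, ContinuousAlternatingMap.add_apply, ContinuousAlternatingMap.smul_apply,
      comp_apply_one, smul_eq_mul]
    refine (sub_eq_iff_eq_add'.1 h6).trans ?_
    exact congrArg (fun t => _ + ℓ y * t) (comp_apply_one (G y) _ _).symm
  filter_upwards [e1, e2, e3] with q h1 h2 h3
  exact ⟨⟨h1, h2⟩, h3⟩

end AdaptedCoord

end LaurentExpansion

/-! ### Global expansion near the hypersurface -/

section GlobalExpansion

variable {d m : ℕ} {M : Type*} [TopologicalSpace M] [ChartedSpace (Model d) M]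
  {x : M → ℝ} {r : M → M} {Ω : BTwoForm d m x}

theorem FixesZeros.eventually_pullback_pullback (hr : FixesZeros (d := d) x r)
    (hr0 : ∀ᶠ p in 𝓝ˢ {z | x z = 0}, x (r p) = 0) {j : ℕ} (η : Form d M j) :
    ∀ᶠ p in 𝓝ˢ {z | x z = 0}, pullback (d := d) r (pullback (d := d) r η) p = pullback (d := d) r η p := by
  rw [eventually_nhdsSet_iff_forall] at *
  intro z hz
  have h1 := eventually_nhdsSet_iff_forall.1 hr.smooth z hz
  filter_upwards [(hr0 z hz).eventually_nhds, h1, (hr.tendsto hz).eventually h1] with p h2 h3 h4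
  rw [← pullback_comp η (h4.mdifferentiableAt (by simp)) (h3.mdifferentiableAt (by simp))]
  exact pullback_congr η (h2.mono fun q hq => hr.eq_self _ hq)

variable [IsManifold (𝓡 d) ∞ M]

variable (hx : IsDefiningFunction (d := d) x) (hr : FixesZeros (d := d) x r)
  (hr0 : ∀ᶠ p in 𝓝ˢ {z | x z = 0}, x (r p) = 0)
include hx hr hr0

/-- A one-form annihilating the normal vector field is, up to a multiple of `x`, the pullback of
its restriction to `Z`. -/
theorem exists_eq_pullback_add {a : Form d M 1}
    (ha : ∀ᶠ p in 𝓝ˢ {z | x z = 0}, SmoothAt a p ∧ a p ![normalVec x r p] = 0) :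
    ∃ c : Form d M 1, (∀ᶠ p in 𝓝ˢ {z | x z = 0}, SmoothAt c p ∧ c p ![normalVec x r p] = 0) ∧
      ∀ᶠ p in 𝓝ˢ {z | x z = 0}, a p = pullback r a p + x p • c p := by
  classical
  have hloc : ∀ z, x z = 0 → ∃ c : Form d M 1, ∀ᶠ q in 𝓝 z,
      (SmoothAt c q ∧ c q ![normalVec x r q] = 0) ∧ a q = pullback r a q + x q • c q := by
    intro z hz
    obtain ⟨ℓ, e, κ, σ, h⟩ :=
      hx.exists_adaptedCoord hr (eventually_nhdsSet_iff_forall.1 hr0 z hz) hz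
    exact h.exists_eq_pullback_add hx hr hz (eventually_nhdsSet_iff_forall.1 ha z hz)
  choose! c hc using hloc
  -- Off Z the quotient is forced; on Z the local quotients agree because they are smooth and agree
  -- off Z. No partition of unity is needed.
  let C : Form d M 1 := fun p =>
    if x p = 0 then c p p else (x p)⁻¹ • (a p - pullback r a p)
  have hC : ∀ z, x z = 0 → ∀ᶠ q in 𝓝 z, C q = c z q := by
    intro z hz
    filter_upwards [(hc z hz).eventually_nhds] with q hq
    by_cases h0 : x q = 0
    · have h1 : C q = c q q := if_pos h0
      rw [h1]
      refine hx.eq_of_smoothAt (hc q h0).self_of_nhds.1.1 hq.self_of_nhds.1.1 ?_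
      filter_upwards [hc q h0, hq] with w h2 h3 h4
      have h5 := h2.2.symm.trans h3.2
      have h6 := add_left_cancel h5
      rw [← inv_smul_smul₀ h4 (c q w), h6, inv_smul_smul₀ h4]
    · have h1 : C q = (x q)⁻¹ • (a q - pullback r a q) := if_neg h0
      rw [h1, sub_eq_iff_eq_add'.2 hq.self_of_nhds.2, inv_smul_smul₀ h0]
  refine ⟨C, ?_, ?_⟩
  · rw [eventually_nhdsSet_iff_forall]
    intro z hz
    filter_upwards [(hC z hz).eventually_nhds, hc z hz] with q h1 h2
    refine ⟨h2.1.1.congr (h1.mono fun w hw => hw.symm), ?_⟩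
    rw [h1.self_of_nhds]
    exact h2.1.2
  · rw [eventually_nhdsSet_iff_forall]
    intro z hz
    filter_upwards [hC z hz, hc z hz] with q h1 h2
    rw [h1]
    exact h2.2

/-- The Taylor expansion along the fibres of `r` of a form annihilating the normal vector field. -/
theorem exists_taylor_expansion {a : Form d M 1}
    (ha : ∀ᶠ p in 𝓝ˢ {z | x z = 0}, SmoothAt a p ∧ a p ![normalVec x r p] = 0) :
    ∃ c : ℕ → Form d M 1,
      (∀ i, ∀ᶠ p in 𝓝ˢ {z | x z = 0}, SmoothAt (c i) p ∧ c i p ![normalVec x r p] = 0) ∧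
      ∀ m, ∀ᶠ p in 𝓝ˢ {z | x z = 0},
        a p = ∑ i ∈ Finset.range m, x p ^ i • pullback r (c i) p + x p ^ m • c m p := by
  let T := {a : Form d M 1 //
    ∀ᶠ p in 𝓝ˢ {z | x z = 0}, SmoothAt a p ∧ a p ![normalVec x r p] = 0}
  have hnext : ∀ a : T, ∃ c : T, ∀ᶠ p in 𝓝ˢ {z | x z = 0},
      a.1 p = pullback r a.1 p + x p • c.1 p := fun a => by
    obtain ⟨c, h1, h2⟩ := exists_eq_pullback_add hx hr hr0 a.2
    exact ⟨⟨c, h1⟩, h2⟩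
  choose next hnext using hnext
  let c : ℕ → T := fun i => next^[i] ⟨a, ha⟩
  have hc : ∀ i, c (i + 1) = next (c i) := fun i => Function.iterate_succ_apply' next i _
  refine ⟨fun i => (c i).1, fun i => (c i).2, fun m => ?_⟩
  induction m with
  | zero =>
    refine Filter.Eventually.of_forall fun p => ?_
    rw [Finset.sum_range_zero, pow_zero, one_smul, zero_add]
    rfl
  | succ m ih =>
    filter_upwards [ih, hnext (c m)] with p h1 h2
    rw [h1, Finset.sum_range_succ, hc, add_assoc]
    congr 1
    conv_lhs => rw [h2]
    rw [smul_add, smul_smul, pow_succ]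

/-- A smooth `b^m`-two-form has smooth coefficients that annihilate the normal vector field. -/
theorem exists_semibasic_coefficients (hΩ : Ω.IsSmooth) : ∃ (a : Form d M 1) (b : Form d M 2),
    ∀ᶠ p in 𝓝ˢ {z | x z = 0}, (SmoothAt a p ∧ SmoothAt b p) ∧ Ω.EqAt p (a p) (b p) ∧
      a p ![normalVec x r p] = 0 ∧ ∀ u, b p ![normalVec x r p, u] = 0 := by
  -- The choice is made point by point; smoothness comes afterwards from uniqueness.
  have hpt : ∀ p, ∃ (a : TangentSpace (𝓡 d) p [⋀^Fin 1]→L[ℝ] ℝ)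
      (b : TangentSpace (𝓡 d) p [⋀^Fin 2]→L[ℝ] ℝ), dFun x p (normalVec (d := d) x r p) = 1 →
        Ω.EqAt p a b ∧ a ![normalVec x r p] = 0 ∧ ∀ u, b ![normalVec x r p, u] = 0 := by
    intro p
    obtain ⟨α, β, h⟩ := hΩ p
    refine ⟨_, _, fun hv => ⟨h.self_of_nhds.2.2.comp_projAlong (v := normalVec x r p), ?_,
      fun u => ?_⟩⟩
    · rw [comp_apply_one, projAlong_apply, hv, one_smul, sub_self]
      exact ContinuousAlternatingMap.map_coord_zero _ 0 rfl
    · rw [comp_apply_two, projAlong_apply, hv, one_smul, sub_self]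
      exact ContinuousAlternatingMap.map_coord_zero _ 0 rfl
  choose a b hab using hpt
  refine ⟨a, b, ?_⟩
  rw [eventually_nhdsSet_iff_forall]
  intro z hz
  obtain ⟨ℓ, e, κ, σ, h⟩ :=
    hx.exists_adaptedCoord hr (eventually_nhdsSet_iff_forall.1 hr0 z hz) hz
  have h1 : ∀ᶠ q in 𝓝 z, Ω.EqAt q (a q) (b q) ∧ a q ![normalVec x r q] = 0 ∧
      ∀ u, b q ![normalVec x r q, u] = 0 :=
    (h.eventually_normalVec hx hr hz).mono fun q hq => hab q hq.2
  exact (h.smoothAt_coefficients hx hr hz hΩ h1).and h1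

/-- The Laurent coefficients of a `b^m`-symplectic form are closed. -/
theorem extD_coeff_eq_zero (hΩ : IsBSymplectic Ω) {a : Form d M 1} {b : Form d M 2}
    {c : ℕ → Form d M 1} (hb : ∀ᶠ p in 𝓝ˢ {z | x z = 0}, SmoothAt b p)
    (hab : ∀ᶠ p in 𝓝ˢ {z | x z = 0}, Ω.EqAt p (a p) (b p) ∧ a p ![normalVec x r p] = 0 ∧
      ∀ u, b p ![normalVec x r p, u] = 0)
    (hc : ∀ i, ∀ᶠ p in 𝓝ˢ {z | x z = 0}, SmoothAt (c i) p)
    (hac : ∀ᶠ p in 𝓝ˢ {z | x z = 0},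
        a p = ∑ i ∈ Finset.range m, x p ^ i • pullback r (c i) p + x p ^ m • c m p)
    {i : ℕ} (hi : i < m) {z : M} (hz : x z = 0) : extD (pullback (d := d) r (c i)) z = 0 := by
  obtain ⟨ℓ, e, κ, σ, h⟩ :=
    hx.exists_adaptedCoord hr (eventually_nhdsSet_iff_forall.1 hr0 z hz) hz
  have hl := h.coord.self_of_nhds
  have hrs := eventually_nhdsSet_iff_forall.1 hr.smooth z hz
  have hαs : ∀ i, ∀ᶠ q in 𝓝 z, SmoothAt (pullback (d := d) r (c i)) q := fun i => by
    filter_upwards [hrs, (hr.tendsto hz).eventually (eventually_nhdsSet_iff_forall.1 (hc i) z hz)]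
      with q h1 h2
    exact SmoothAt.pullback h2 h1
  rw [hl.extD_eq_zero_iff (hαs i).self_of_nhds]
  have hne : ∀ᶠ y in 𝓝 (κ z), ℓ y ≠ 0 → x (σ y) ≠ 0 := h.eq_symm.mono fun y hy h0 => by rwa [hy]
  refine extDeriv_coeff_eq_zero (m := m) (A := fun i => localForm σ (pullback (d := d) r (c i)))
    (C := localForm σ (c m)) (B := localForm σ b) (W := localForm σ Ω.toForm) h.apply_e
    (h.apply_base hz) (fun i _ => (LocalCoord.eventually_smoothAt_iff h.coord _).1 (hαs i))
    ((hl.smoothAt_iff _).1 (eventually_nhdsSet_iff_forall.1 (hc m) z hz).self_of_nhds)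
    ((hl.smoothAt_iff _).1 (eventually_nhdsSet_iff_forall.1 hb z hz).self_of_nhds)
    (fun i _ => ?_) ?_ ?_ ?_ ?_ i hi
  · filter_upwards [h.localForm_pullback hr hz (pullback (d := d) r (c i)),
      hl.tendsto_symm.eventually (eventually_nhdsSet_iff_forall.1
        (hr.eventually_pullback_pullback hr0 (c i)) z hz)] with y h1 h2
    rw [← h1, localForm_def, localForm_def, h2]
  · filter_upwards [LocalCoord.eventually_symm h.coord, hne] with y h1 h2 h0
    have h3 := (h1.1.smoothAt_iff _).1 (hΩ.smoothAt_toForm hx (h2 h0))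
    rwa [h1.2] at h3
  · filter_upwards [hl.tendsto_symm.eventually (eventually_nhdsSet_iff_forall.1 hab z hz),
      hl.tendsto_symm.eventually (eventually_nhdsSet_iff_forall.1 hac z hz), h.eq_symm, hne,
      h.normalVec_symm hx hr hz] with y h1 h2 h3 h4 h5 h0
    rw [localForm_def, EqAt.toForm_eq h1.1 (h4 h0), comp_wedge_add]
    have h6 : ((x (σ y) ^ m)⁻¹ • dFun x (σ y)).comp (mfderiv (𝓡 d) (𝓡 d) σ y) =
        (ℓ y ^ m)⁻¹ • ℓ := by
      refine ContinuousLinearMap.ext fun u => ?_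
      rw [← h3]
      exact congrArg (fun t => (x (σ y) ^ m)⁻¹ * t) (h5.2.2.2 u)
    have h7 : (a (σ y)).compContinuousLinearMap (mfderiv (𝓡 d) (𝓡 d) σ y) =
        ∑ i ∈ Finset.range m, ℓ y ^ i • localForm σ (pullback (d := d) r (c i)) y +
          ℓ y ^ m • localForm σ (c m) y := by
      rw [← h3, h2]
      exact congrArg (· + x (σ y) ^ m • (c m (σ y)).compContinuousLinearMap
        (mfderiv (𝓡 d) (𝓡 d) σ y)) (comp_finset_sum _ _ _)
    exact congrArg₂ (fun (θ : Model d →L[ℝ] ℝ) (ζ : (Model d) [⋀^Fin 1]→L[ℝ] ℝ) =>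
      wedge θ ζ + localForm σ b y) h6 h7
  · filter_upwards [hl.tendsto_symm.eventually (eventually_nhdsSet_iff_forall.1 hab z hz),
      h.normalVec_symm hx hr hz] with y h1 h2 u
    rw [localForm_def]
    refine (comp_apply_two _ _ _ _).trans ?_
    rw [h2.2.2.1]
    exact h1.2.2 _
  · filter_upwards [LocalCoord.eventually_symm h.coord, hne] with y h1 h2 h0
    have h3 := h1.1.extDeriv_pullback (hΩ.smoothAt_toForm hx (h2 h0))
    rw [h1.2] at h3
    rw [h3, localForm_def, hΩ.closed _ (h2 h0)]
    rfl

end GlobalExpansion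

/-! ### Existence of the Laurent decomposition -/

section LaurentDecomposition

variable {d m : ℕ} {M : Type*} [TopologicalSpace M] [ChartedSpace (Model d) M]
  [IsManifold (𝓡 d) ∞ M] [CompactSpace M] [T2Space M] {x : M → ℝ} {Ω : BTwoForm d m x}

/-- Every `b^m`-symplectic form has a Laurent decomposition. -/
theorem IsBSymplectic.nonempty_laurentDecomposition (hΩ : IsBSymplectic Ω)
    (hx : IsDefiningFunction (d := d) x) : Nonempty (LaurentDecomposition Ω) := by
  obtain ⟨r, hr, hr0⟩ := hx.exists_retraction
  obtain ⟨a, b, hab⟩ := exists_semibasic_coefficients hx hr hr0 hΩ.smooth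
  obtain ⟨c, hc, hac⟩ := exists_taylor_expansion hx hr hr0 (hab.mono fun p hp => ⟨hp.1.1, hp.2.2.1⟩)
  have himm : ∀ᶠ p in 𝓝ˢ {z | x z = 0}, ∀ u : TangentSpace (𝓡 d) p,
      mfderiv (𝓡 d) (𝓡 d) r p u = 0 → dFun x p u = 0 → u = 0 := by
    rw [eventually_nhdsSet_iff_forall]
    intro z hz
    obtain ⟨ℓ, e, κ, σ, h⟩ :=
      hx.exists_adaptedCoord hr (eventually_nhdsSet_iff_forall.1 hr0 z hz) hz
    exact h.immersion hx hr hz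
  have hβ : ∀ᶠ p in 𝓝ˢ {z | x z = 0},
      SmoothAt (fun q => wedge (dFun x q) (c m q) + b q) p := by
    filter_upwards [hc m, hab] with p h1 h2
    exact SmoothAt.dFun_wedge hx contDiff_id h1.1 h2.1.2
  have hα : ∀ᶠ p in 𝓝ˢ {z | x z = 0}, ∀ i : Fin m,
      SmoothAt (pullback (d := d) r (c i)) p ∧ extD (pullback (d := d) r (c i)) p = 0 ∧
        pullback (d := d) r (c i) p = pullback r (pullback (d := d) r (c i)) p := by
    rw [Filter.eventually_all]
    intro i
    have hid := hr.eventually_pullback_pullback hr0 (c i)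
    -- Closedness is needed only on Z: near Z, αᵢ = r*αᵢ and d commutes with r*, so dαᵢ at p is
    -- pulled back from its value at r(p).
    have hz0 : ∀ z, x z = 0 → SmoothAt (pullback (d := d) r (c i)) z ∧
        extD (pullback (d := d) r (c i)) z = 0 := by
      intro z hz
      refine ⟨SmoothAt.pullback ?_ (eventually_nhdsSet_iff_forall.1 hr.smooth z hz).self_of_nhds,
        extD_coeff_eq_zero hx hr hr0 hΩ (hab.mono fun p hp => hp.1.2) (hab.mono fun p hp => hp.2)
          (fun i => (hc i).mono fun p hp => hp.1) (hac m) i.2 hz⟩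
      rw [hr.eq_self z hz]
      exact (eventually_nhdsSet_iff_forall.1 (hc i) z hz).self_of_nhds.1
    filter_upwards [hid.eventually_nhdsSet, hr.smooth, hr0] with p h1 h2 h3
    obtain ⟨h4, h5⟩ := hz0 (r p) h3
    refine ⟨(SmoothAt.pullback h4 h2).congr h1, ?_, h1.self_of_nhds.symm⟩
    rw [← extD_congr h1, extD_pullback h4 h2, pullback, h5]
    rfl
  have hpos : ∀ᶠ δ : ℝ in 𝓝[>] 0, 0 < δ := self_mem_nhdsWithin
  obtain ⟨δ, hδ, hδ0, h1, h2, h3, h4, h5, h6⟩ := ((hx.eventually_bijOn hr hr0).and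
    (hpos.and ((hx.eventually_forall_lt hr.smooth).and
      ((hx.eventually_forall_lt himm).and ((hx.eventually_forall_lt hβ).and
        ((hx.eventually_forall_lt hα).and ((hx.eventually_forall_lt (hac m)).and
          (hx.eventually_forall_lt hab)))))))).exists
  exact ⟨{
    δ := δ
    π := r
    α := fun i => pullback r (c i)
    -- The term dx ∧ c_m is the Taylor remainder of order m, after cancelling xᵐ.
    β := fun q => wedge (dFun x q) (c m q) + b q
    δ_pos := hδ0
    π_smooth := fun p hp => (h1 p hp).contMDiffWithinAt
    π_eq_self := hr.eq_self
    bijOn := hδ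
    immersion := h2
    α_smooth := fun i p hp => (h4 p hp i).1
    α_closed := fun i p hp => (h4 p hp i).2.1
    α_pullback := fun i p hp => (h4 p hp i).2.2
    β_smooth := h3
    eqAt := fun p hp => by
      have h7 := (h6 p hp).2.1
      rw [h5 p hp, Finset.sum_range] at h7
      exact h7.add_wedge }⟩

end LaurentDecomposition

end BSymp

end

theorem mainTheorem7 (n k : ℕ) {M : Type*} [TopologicalSpace M] [T2Space M] [CompactSpace M]
    [ChartedSpace (BSymp.Model (2 * n)) M] [IsManifold (𝓡 (2 * n)) ∞ M]
    (x : M → ℝ) (hx : BSymp.IsDefiningFunction (d := 2 * n) x)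
    (Ω : BSymp.BTwoForm (2 * n) (2 * k + 1) x) (hΩ : BSymp.IsBSymplectic Ω) :
    (∃ η : BSymp.Form (2 * n) M 2, BSymp.IsFoldedSymplectic η) ∧
    Nonempty (BSymp.LaurentDecomposition Ω) ∧
    (∃ f : ℝ → ℝ, BSymp.IsProfile k f) ∧
    ∀ (L : BSymp.LaurentDecomposition Ω) (f : ℝ → ℝ), BSymp.IsProfile k f →
      ∃ ε₀ : ℝ, 0 < ε₀ ∧ ∀ ε : ℝ, 0 < ε → ε < ε₀ →
        BSymp.IsFoldedSymplectic (L.desingularization f ε) ∧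
        ∀ p : M, 2 * ε ≤ |x p| → L.desingularization f ε p = Ω.toForm p := by
  have h1 : Nonempty (BSymp.LaurentDecomposition Ω) := hΩ.nonempty_laurentDecomposition hx
  have h2 := BSymp.exists_isProfile k
  have h3 := fun (L : BSymp.LaurentDecomposition Ω) f (hf : BSymp.IsProfile k f) =>
    L.exists_isFoldedSymplectic hx hΩ hf
  refine ⟨?_, h1, h2, h3⟩
  obtain ⟨L⟩ := h1
  obtain ⟨f, hf⟩ := h2
  obtain ⟨ε₀, hε₀, h⟩ := h3 L f hf
  exact ⟨_, (h (ε₀ / 2) (by positivity) (by linarith)).1⟩
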